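/- **Setting.** Let $k\subset\mathbb{R}$ be a real quadratic field with ring of integers $\mathcal{O}_k$ and non-trivial embedding $\sigma:k\to\mathbb{R}$, let $n\ge 3$, and let $f=-a_0x_0^2+a_1x_1^2+\dots+a_nx_n^2$ with $a_i\in\mathcal{O}_k$ be admissible: all $a_i>0$, and the conjugate form $f^\sigma$ is definite. (For every $n\ge3$ such $k$ and $f$ exist.) Let $e_0,\dots,e_n$ be the standard orthogonal basis of $E=\mathbb{R}^{n+1}$, and let $\mathcal{Q}$ be the set of elements of the even Clifford algebra of $f$ all of whose coefficients in the basis $e_M$ ($|M|$ even) are in $\mathcal{O}_k$. Write $s_{\mathbb{R}}$ for the coefficient of $s$ at $e_\emptyset=1$. The group $\mathrm{Spin}_f(\mathbb{R})$ of even elements $s$ with $sEs^*\subseteq E$ and $ss^*=1$ acts by $x\mapsto sxs^*$ on the hyperboloid $f=-1$, $x_0>0$, a model of $\mathbb{H}^n$; let $\ell(s)=\inf_{x\in\mathbb{H}^n} d(x,sx)$. Put $\Gamma=\mathrm{Spin}_f(\mathbb{R})\cap\mathcal{Q}$. For an ideal $I\ne0$ of $\mathcal{O}_k$ let $\Gamma(I)=\{s\in\Gamma: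 s-1\in I\mathcal{Q}\}$; a congruence subgroup is a subgroup of $\Gamma$ containing some $\Gamma(I)$. For $0\ne\alpha\in\mathcal{O}_k$ and $\tau\in(\mathcal{O}_k/\alpha\mathcal{O}_k)^\times$ of order two let $\Gamma_\tau(\alpha)=\{s\in\Gamma: s\in\Gamma(\alpha)\text{ or }s\equiv\tau \bmod \alpha\mathcal{Q}\}$. Let $f'$ be the restriction of $f$ to the span of $e_0,e_1,e_2$, and let $\Gamma'$, $\Gamma'(I)$, $\Gamma'_\tau(\alpha)$ be the corresponding groups for $f'$; they act on $\mathbb{H}^2\subset\mathbb{H}^n$ and are included in $\Gamma$, $\Gamma(I)$, $\Gamma_\tau(\alpha)$. The systolic length $\mathrm{sys}$ is the shortest length of a closed geodesic. **Theorem C.** There are universal constants $L>0$, $K$ and $C_2,C_5,C_8>0$, and a choice of $l=l(t)\in\{2,5,8\}$ for each real $t$, such that the following holds for all $n\ge3$, $k$ and $f$ as above. 1. For each real $t$ there are $\alpha\in\mathcal{O}_k$ and $\tau\in(\mathcal{O}_k/\alpha\mathcal{O}_k)^\times$ of order two (depending on $t$) such that, for every loxodromic $s\in\Gamma'$ with $s_{\mathbb{R}}=t>L$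 and with $l=l(t)$: $\alpha\neq0$, $1\le|\sigma(\alpha)|\le5$ and $|\alpha-C_l\,t^{2(l+1)/3}|\le K\,t^{2(l+1)/3-2}$; one has $s^{l+1}-(s^{l+1})_{\mathbb{R}}\in\alpha\mathcal{Q}$, and $\tau$ is the class of $(s^{l+1})_{\mathbb{R}}\in\mathcal{O}_k$ modulo $\alpha$; $\Gamma_\tau(\alpha)$ and $\Gamma'_\tau(\alpha)$ are congruence subgroups of $\Gamma$ and $\Gamma'$; $M_{\tau,\alpha}=\Gamma_\tau(\alpha)\backslash\mathbb{H}^n$ and $S_{\tau,\alpha}=\Gamma'_\tau(\alpha)\backslash\mathbb{H}^2$ are closed hyperbolic manifolds, and $S_{\tau,\alpha}$ is embedded in $M_{\tau,\alpha}$ as a totally geodesic surface; the element $s^{l+1}$ of $\Gamma'_\tau(\alpha)$ is loxodromic and of minimal displacement in $\Gamma_\tau(\alpha)$, that is, $\ell(s^{l+1})\le\ell(r)$ for every loxodromic $r\in\Gamma_\tau(\alpha)$; and $$\mathrm{sys}(S_{\tau,\alpha})=\mathrm{sys}(M_{\tau,\alpha})=\ell(s^{l+1}).$$ 2. There is a congruence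 subgroup $\Lambda$ of $\Gamma$ such that $M=\Lambda\backslash\mathbb{H}^n$ is a closed hyperbolic manifold containing the embedded closed totally geodesic surface $S=\Lambda'\backslash\mathbb{H}^2$, where $\Lambda'=\Lambda\cap\Gamma'$ is a congruence subgroup of $\Gamma'$, and such that for every loxodromic $s\in\Lambda'$ with $s_{\mathbb{R}}=t>L$ the manifolds of part 1 are congruence coverings $M_{\tau,\alpha}\to M$ and $S_{\tau,\alpha}\to S$, that is, $\Gamma_\tau(\alpha)\le\Lambda$ and $\Gamma'_\tau(\alpha)\le\Lambda'$. The degrees of the coverings $M_{\tau,\alpha}\to M$ obtained in this way are finite and unbounded. -/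

import Mathlib

open scoped NumberField Topology

noncomputable section

namespace HypArith

/-! ### Diagonal quadratic forms and their Clifford algebras -/

/-- The diagonal quadratic form `f(x) = w 0 * x₀² + ... + w n * xₙ²` on `ℝⁿ⁺¹`. -/
def form {n : ℕ} (w : Fin (n + 1) → ℝ) : QuadraticForm ℝ (Fin (n + 1) → ℝ) :=
  QuadraticMap.weightedSumSquares ℝ w

/-- The bilinear form associated with `form w`, so that `bil w x x = form w x`. -/
def bil {n : ℕ} (w x y : Fin (n + 1) → ℝ) : ℝ := ∑ i, w i * x i * y i

/-- The real Clifford algebra of the form `form w`; here `v * v = form w v` for vectors `v`. -/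
abbrev Cl {n : ℕ} (w : Fin (n + 1) → ℝ) : Type := CliffordAlgebra (form w)

/-- The inclusion of the vector space `E = ℝⁿ⁺¹` in the Clifford algebra. -/
abbrev vec {n : ℕ} (w : Fin (n + 1) → ℝ) : (Fin (n + 1) → ℝ) →ₗ[ℝ] Cl w :=
  CliffordAlgebra.ι (form w)

/-- The generator `e_i` of the Clifford algebra. -/
def gen {n : ℕ} (w : Fin (n + 1) → ℝ) (i : Fin (n + 1)) : Cl w := vec w (Pi.single i 1)

/-- The basis element `e_M`: the product of the `e_i`, `i ∈ M`, in increasing order of `i`. -/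
def genProd {n : ℕ} (w : Fin (n + 1) → ℝ) (M : Finset (Fin (n + 1))) : Cl w :=
  ((M.sort (· ≤ ·)).map (gen w)).prod

/-- The real part of an element of the Clifford algebra: its coefficient at `e_∅ = 1` in the
basis `(e_M)`, taken as the degree zero part under the linear isomorphism of the Clifford algebra
with the exterior algebra, which carries each `e_M` to the corresponding wedge product; see
`realPart_algebraMap` and `realPart_genProd`. -/
def realPart {n : ℕ} (w : Fin (n + 1) → ℝ) (c : Cl w) : ℝ :=
  ExteriorAlgebra.algebraMapInv (CliffordAlgebra.equivExterior (form w) c)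

/-- The vector part of an element of the Clifford algebra (its degree one part); it is a left
inverse of the inclusion of the vectors, see `vecPart_vec`. -/
def vecPart {n : ℕ} (w : Fin (n + 1) → ℝ) : Cl w →ₗ[ℝ] (Fin (n + 1) → ℝ) :=
  ExteriorAlgebra.ιInv ∘ₗ (CliffordAlgebra.equivExterior (form w)).toLinearMap

theorem form_apply {n : ℕ} (w x : Fin (n + 1) → ℝ) : form w x = ∑ i, w i * (x i * x i) := by
  simp [form, QuadraticMap.weightedSumSquares_apply]

theorem vecPart_vec {n : ℕ} (w v : Fin (n + 1) → ℝ) : vecPart w (vec w v) = v := by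
  have h : CliffordAlgebra.equivExterior (form w) (vec w v) = ExteriorAlgebra.ι ℝ v :=
    CliffordAlgebra.changeForm_ι
      CliffordAlgebra.changeForm.associated_neg_proof v
  simp only [vecPart, LinearMap.comp_apply, LinearEquiv.coe_coe, h]
  exact ExteriorAlgebra.ι_leftInverse v

theorem vec_injective {n : ℕ} (w : Fin (n + 1) → ℝ) : Function.Injective (vec w) :=
  Function.LeftInverse.injective (vecPart_vec w)

theorem realPart_algebraMap {n : ℕ} (w : Fin (n + 1) → ℝ) (r : ℝ) :
    realPart w (algebraMap ℝ (Cl w) r) = r := by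
  have h : CliffordAlgebra.equivExterior (form w) (algebraMap ℝ (Cl w) r)
      = algebraMap ℝ _ r := CliffordAlgebra.changeForm_algebraMap
        CliffordAlgebra.changeForm.associated_neg_proof r
  rw [realPart, h]
  exact ExteriorAlgebra.algebraMap_leftInverse _ r

theorem gen_mul_self {n : ℕ} (w : Fin (n + 1) → ℝ) (i : Fin (n + 1)) :
    gen w i * gen w i = algebraMap ℝ (Cl w) (w i) := by
  rw [gen, CliffordAlgebra.ι_sq_scalar, form_apply]
  congr 1
  rw [Finset.sum_eq_single i] <;> simp +contextual

theorem polar_single {n : ℕ} (w : Fin (n + 1) → ℝ) {i j : Fin (n + 1)} (h : i ≠ j) :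
    QuadraticMap.polar (form w) (Pi.single i 1) (Pi.single j 1) = 0 := by
  simp only [QuadraticMap.polar, form_apply, ← Finset.sum_sub_distrib]
  refine Finset.sum_eq_zero fun a _ => ?_
  by_cases h1 : a = i
  · have h2 : a ≠ j := fun h2 => h (h1.symm.trans h2)
    simp [h1, h]
  · simp [Pi.single_apply, h1]

theorem gen_mul_gen {n : ℕ} (w : Fin (n + 1) → ℝ) {i j : Fin (n + 1)} (h : i ≠ j) :
    gen w i * gen w j = - (gen w j * gen w i) := by
  rw [gen, gen, eq_neg_iff_add_eq_zero, CliffordAlgebra.ι_mul_ι_add_swap, polar_single w h,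
    map_zero]

theorem associated_single {n : ℕ} (w : Fin (n + 1) → ℝ) {i j : Fin (n + 1)} (h : i ≠ j) :
    QuadraticMap.associated (R := ℝ) (-form w) (Pi.single i 1) (Pi.single j 1) = 0 := by
  have h1 := polar_single w h
  simp only [QuadraticMap.polar] at h1
  have h2 : ∀ x, (-form w) x = -(form w x) := fun _ => rfl
  rw [QuadraticMap.associated_apply, h2, h2, h2,
    show -(form w) (Pi.single i 1 + Pi.single j 1) - -(form w) (Pi.single i 1)
      - -(form w) (Pi.single j 1) = 0 by linarith, smul_zero]

theorem contract_list {n : ℕ} (d : Module.Dual ℝ (Fin (n + 1) → ℝ)) (l : List (Fin (n + 1)))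
    (h : ∀ j ∈ l, d (Pi.single j 1) = 0) :
    CliffordAlgebra.contractLeft (Q := (0 : QuadraticForm ℝ (Fin (n + 1) → ℝ))) d
      ((l.map fun j => ExteriorAlgebra.ι ℝ (Pi.single j (1 : ℝ) : Fin (n + 1) → ℝ)).prod) = 0 := by
  induction l with
  | nil => simp
  | cons a l ih =>
    have h1 := ih fun j hj => h j (List.mem_cons_of_mem _ hj)
    rw [List.map_cons, List.prod_cons]
    refine (CliffordAlgebra.contractLeft_ι_mul _ _ _).trans ?_
    rw [h1, h a List.mem_cons_self]
    simp

/-- The isomorphism with the exterior algebra carries `e_M` to the wedge product of the `e_i`. -/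
theorem equivExterior_list {n : ℕ} (w : Fin (n + 1) → ℝ) (l : List (Fin (n + 1)))
    (h : l.Nodup) :
    CliffordAlgebra.equivExterior (form w) ((l.map (gen w)).prod)
      = (l.map fun j => ExteriorAlgebra.ι ℝ (Pi.single j (1 : ℝ) : Fin (n + 1) → ℝ)).prod := by
  induction l with
  | nil => exact CliffordAlgebra.changeForm_one CliffordAlgebra.changeForm.associated_neg_proof
  | cons a l ih =>
    rw [List.nodup_cons] at h
    rw [List.map_cons, List.prod_cons, List.map_cons, List.prod_cons]
    refine (CliffordAlgebra.changeForm_ι_mul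
      CliffordAlgebra.changeForm.associated_neg_proof _ _).trans ?_
    have h2 := ih h.2
    change CliffordAlgebra.changeForm CliffordAlgebra.changeForm.associated_neg_proof _ = _ at h2
    rw [h2, contract_list, sub_zero]
    intro j hj
    exact associated_single w fun hh => h.1 (hh ▸ hj)

theorem realPart_genProd {n : ℕ} (w : Fin (n + 1) → ℝ) (M : Finset (Fin (n + 1)))
    (hM : M.Nonempty) : realPart w (genProd w M) = 0 := by
  rw [realPart, genProd, equivExterior_list w _ (M.sort_nodup _)]
  have : M.sort (· ≤ ·) ≠ [] := by
    intro h
    have := congrArg List.length h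
    simp at this
    simp [this] at hM
  obtain ⟨a, l, hl⟩ := List.exists_cons_of_ne_nil this
  rw [hl, List.map_cons, List.prod_cons, map_mul]
  have h0 : ExteriorAlgebra.algebraMapInv
      (ExteriorAlgebra.ι ℝ (Pi.single a (1 : ℝ) : Fin (n + 1) → ℝ)) = 0 := by
    simp [ExteriorAlgebra.algebraMapInv]
  rw [h0, zero_mul]

/-! ### The spin group and its action -/

/-- Conjugation of vectors: `s ↦ s * x * s^*`, followed by the vector part. For `s` in the spin
group `s * x * s^*` is a vector and `rot w s` is the map `φ_s`, see `vec_rot`. -/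
def rot {n : ℕ} (w : Fin (n + 1) → ℝ) (s : Cl w) :
    (Fin (n + 1) → ℝ) →ₗ[ℝ] (Fin (n + 1) → ℝ) :=
  vecPart w ∘ₗ LinearMap.mulRight ℝ (CliffordAlgebra.reverse s) ∘ₗ LinearMap.mulLeft ℝ s ∘ₗ vec w

/-- The conditions defining the spin group: `s` is even, `s E s^* ⊆ E` and `s s^* = 1`, where `*`
is the anti-involution of the Clifford algebra that fixes all vectors. -/
def IsSpin {n : ℕ} (w : Fin (n + 1) → ℝ) (s : Cl w) : Prop :=
  s ∈ CliffordAlgebra.evenOdd (form w) 0 ∧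
  (∀ x, ∃ y, s * vec w x * CliffordAlgebra.reverse s = vec w y) ∧
  s * CliffordAlgebra.reverse s = 1

theorem vec_rot_of_isSpin {n : ℕ} {w : Fin (n + 1) → ℝ} {s : Cl w} (hs : IsSpin w s)
    (x : Fin (n + 1) → ℝ) :
    vec w (rot w s x) = s * vec w x * CliffordAlgebra.reverse s := by
  obtain ⟨y, hy⟩ := hs.2.1 x
  have : rot w s x = vecPart w (s * vec w x * CliffordAlgebra.reverse s) := rfl
  rw [this, hy, vecPart_vec]

theorem IsSpin.one {n : ℕ} (w : Fin (n + 1) → ℝ) : IsSpin w (1 : Cl w) :=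
  ⟨CliffordAlgebra.one_le_evenOdd_zero _ (Submodule.one_le.mp le_rfl),
    fun x => ⟨x, by simp⟩, by simp⟩

theorem IsSpin.mul {n : ℕ} {w : Fin (n + 1) → ℝ} {s t : Cl w} (hs : IsSpin w s)
    (ht : IsSpin w t) : IsSpin w (s * t) := by
  refine ⟨?_, fun x => ?_, ?_⟩
  · have := CliffordAlgebra.evenOdd_mul_le (form w) 0 0 (Submodule.mul_mem_mul hs.1 ht.1)
    simpa using this
  · obtain ⟨y, hy⟩ := ht.2.1 x
    obtain ⟨z, hz⟩ := hs.2.1 y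
    refine ⟨z, ?_⟩
    rw [CliffordAlgebra.reverse.map_mul, ← hz, ← hy]
    simp only [mul_assoc]
  · rw [CliffordAlgebra.reverse.map_mul]
    calc s * t * (CliffordAlgebra.reverse t * CliffordAlgebra.reverse s)
        = s * (t * CliffordAlgebra.reverse t) * CliffordAlgebra.reverse s := by
          simp only [mul_assoc]
      _ = 1 := by rw [ht.2.2, mul_one, hs.2.2]

/-- The inverse of a unit satisfying the spin conditions is `s^*`. -/
theorem IsSpin.inv_eq {n : ℕ} {w : Fin (n + 1) → ℝ} {u : (Cl w)ˣ} (hu : IsSpin w (u : Cl w)) :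
    ((u⁻¹ : (Cl w)ˣ) : Cl w) = CliffordAlgebra.reverse (u : Cl w) :=
  Units.inv_eq_of_mul_eq_one_right hu.2.2

theorem IsSpin.inv {n : ℕ} {w : Fin (n + 1) → ℝ} {u : (Cl w)ˣ} (hu : IsSpin w (u : Cl w)) :
    IsSpin w ((u⁻¹ : (Cl w)ˣ) : Cl w) := by
  have hr : CliffordAlgebra.reverse (u : Cl w) * (u : Cl w) = 1 := by
    rw [← hu.inv_eq]; simp
  rw [hu.inv_eq]
  refine ⟨(CliffordAlgebra.reverse_mem_evenOdd_iff _).2 hu.1, fun x => ?_, ?_⟩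
  · have hinj : Function.Injective (rot w (u : Cl w)) := by
      intro a b hab
      apply vec_injective w
      have h := congrArg (vec w) hab
      rw [vec_rot_of_isSpin hu, vec_rot_of_isSpin hu] at h
      have h2 := congrArg (fun c => CliffordAlgebra.reverse (u : Cl w) * c * (u : Cl w)) h
      have key : ∀ c : Cl w, CliffordAlgebra.reverse (u : Cl w) *
          ((u : Cl w) * c * CliffordAlgebra.reverse (u : Cl w)) * (u : Cl w) = c := fun c => by
        calc _ = (CliffordAlgebra.reverse (u : Cl w) * (u : Cl w)) * c *
              (CliffordAlgebra.reverse (u : Cl w) * (u : Cl w)) := by simp only [mul_assoc]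
          _ = c := by rw [hr, one_mul, mul_one]
      simpa only [key] using h2
    obtain ⟨y, rfl⟩ := LinearMap.surjective_of_injective hinj x
    refine ⟨y, ?_⟩
    rw [vec_rot_of_isSpin hu, CliffordAlgebra.reverse_reverse]
    calc _ = (CliffordAlgebra.reverse (u : Cl w) * (u : Cl w)) * vec w y *
          (CliffordAlgebra.reverse (u : Cl w) * (u : Cl w)) := by simp only [mul_assoc]
      _ = vec w y := by rw [hr, one_mul, mul_one]
  · rw [CliffordAlgebra.reverse_reverse, hr]

/-- The spin group of `form w` over `ℝ`, as a subgroup of the units of the Clifford algebra. -/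
def spinSubgroup {n : ℕ} (w : Fin (n + 1) → ℝ) : Subgroup (Cl w)ˣ where
  carrier := {u | IsSpin w (u : Cl w)}
  one_mem' := IsSpin.one w
  mul_mem' := fun ha hb =>
    show IsSpin w _ from IsSpin.mul ha hb
  inv_mem' := fun ha => IsSpin.inv ha

/-- The spin group of `form w` over `ℝ`. -/
abbrev SpinGrp {n : ℕ} (w : Fin (n + 1) → ℝ) : Type := ↥(spinSubgroup w)

/-- The underlying element of the Clifford algebra. -/
def SpinGrp.val {n : ℕ} {w : Fin (n + 1) → ℝ} (s : SpinGrp w) : Cl w := ((s : (Cl w)ˣ) : Cl w)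

theorem SpinGrp.isSpin {n : ℕ} {w : Fin (n + 1) → ℝ} (s : SpinGrp w) : IsSpin w s.val := s.2

theorem SpinGrp.val_one {n : ℕ} {w : Fin (n + 1) → ℝ} : (1 : SpinGrp w).val = 1 := rfl

theorem SpinGrp.val_mul {n : ℕ} {w : Fin (n + 1) → ℝ} (s t : SpinGrp w) :
    (s * t).val = s.val * t.val := rfl

theorem SpinGrp.val_inv {n : ℕ} {w : Fin (n + 1) → ℝ} (s : SpinGrp w) :
    (s⁻¹).val = CliffordAlgebra.reverse s.val := IsSpin.inv_eq s.2

/-- The linear map `φ_s : x ↦ s x s^*` of `E = ℝⁿ⁺¹`. -/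
def act {n : ℕ} {w : Fin (n + 1) → ℝ} (s : SpinGrp w) :
    (Fin (n + 1) → ℝ) →ₗ[ℝ] (Fin (n + 1) → ℝ) := rot w s.val

theorem vec_act {n : ℕ} {w : Fin (n + 1) → ℝ} (s : SpinGrp w) (x : Fin (n + 1) → ℝ) :
    vec w (act s x) = s.val * vec w x * CliffordAlgebra.reverse s.val :=
  vec_rot_of_isSpin s.isSpin x

theorem act_one {n : ℕ} {w : Fin (n + 1) → ℝ} (x : Fin (n + 1) → ℝ) :
    act (1 : SpinGrp w) x = x :=
  vec_injective w (by rw [vec_act, SpinGrp.val_one]; simp)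

theorem act_mul {n : ℕ} {w : Fin (n + 1) → ℝ} (s t : SpinGrp w) (x : Fin (n + 1) → ℝ) :
    act (s * t) x = act s (act t x) :=
  vec_injective w (by
    rw [vec_act, vec_act, vec_act, SpinGrp.val_mul, CliffordAlgebra.reverse.map_mul]
    simp only [mul_assoc])

/-! ### The inclusion of spin groups for a coordinate subspace -/

/-- The weights of the restriction of `form w` to the span `E'` of `e_0, ..., e_d`. -/
abbrev restr {n d : ℕ} (h : d ≤ n) {β : Type} (w : Fin (n + 1) → β) : Fin (d + 1) → β :=
  fun i => w (Fin.castLE (Nat.add_le_add_right h 1) i)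

/-- The coordinate inclusion `(x₀, ..., x_d) ↦ (x₀, ..., x_d, 0, ..., 0)`. -/
def coordIncl {n d : ℕ} (h : d ≤ n) : (Fin (d + 1) → ℝ) →ₗ[ℝ] (Fin (n + 1) → ℝ) :=
  Function.ExtendByZero.linearMap ℝ (Fin.castLE (Nat.add_le_add_right h 1))

theorem coordIncl_castLE {n d : ℕ} (h : d ≤ n) (x : Fin (d + 1) → ℝ) (i : Fin (d + 1)) :
    coordIncl h x (Fin.castLE (Nat.add_le_add_right h 1) i) = x i :=
  (Fin.castLE_injective (Nat.add_le_add_right h 1)).extend_apply x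
    (0 : Fin (n + 1) → ℝ) i

theorem coordIncl_of_not_mem {n d : ℕ} (h : d ≤ n) (x : Fin (d + 1) → ℝ) (i : Fin (n + 1))
    (hi : ¬ ∃ j, Fin.castLE (Nat.add_le_add_right h 1) j = i) : coordIncl h x i = 0 :=
  Function.extend_apply' (f := Fin.castLE (Nat.add_le_add_right h 1)) x
    (0 : Fin (n + 1) → ℝ) i hi

theorem sum_coordIncl {n d : ℕ} (h : d ≤ n) (w : Fin (n + 1) → ℝ) (x y : Fin (d + 1) → ℝ) :
    ∑ i, w i * coordIncl h x i * coordIncl h y i = ∑ i, restr h w i * x i * y i := by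
  symm
  refine Finset.sum_of_injOn (Fin.castLE (Nat.add_le_add_right h 1))
    (Fin.castLE_injective _).injOn (fun _ _ => Finset.mem_univ _) ?_ ?_
  · intro i _ hi
    rw [coordIncl_of_not_mem h x i, mul_zero, zero_mul]
    rintro ⟨j, hj⟩
    exact hi ⟨j, by simp, hj⟩
  · intro i _
    rw [coordIncl_castLE, coordIncl_castLE]

theorem bil_coordIncl {n d : ℕ} (h : d ≤ n) (w : Fin (n + 1) → ℝ) (x y : Fin (d + 1) → ℝ) :
    bil w (coordIncl h x) (coordIncl h y) = bil (restr h w) x y := sum_coordIncl h w x y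

theorem form_eq_bil {n : ℕ} (w x : Fin (n + 1) → ℝ) : form w x = bil w x x := by
  simp only [form_apply, bil, mul_assoc]

/-- The coordinate inclusion as an isometry of quadratic spaces `(E', f') → (E, f)`. -/
def coordIsom {n d : ℕ} (h : d ≤ n) (w : Fin (n + 1) → ℝ) : form (restr h w) →qᵢ form w :=
  { coordIncl h with
    map_app' := fun x => by
      change form w (coordIncl h x) = _
      rw [form_eq_bil, form_eq_bil, bil_coordIncl] }

/-- The inclusion of Clifford algebras induced by `E' ⊆ E`. -/
def clIncl {n d : ℕ} (h : d ≤ n) (w : Fin (n + 1) → ℝ) : Cl (restr h w) →ₐ[ℝ] Cl w :=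
  CliffordAlgebra.map (coordIsom h w)

theorem clIncl_vec {n d : ℕ} (h : d ≤ n) (w : Fin (n + 1) → ℝ) (x : Fin (d + 1) → ℝ) :
    clIncl h w (vec (restr h w) x) = vec w (coordIncl h x) :=
  CliffordAlgebra.map_apply_ι _ _

theorem clIncl_reverse {n d : ℕ} (h : d ≤ n) (w : Fin (n + 1) → ℝ) (c : Cl (restr h w)) :
    clIncl h w (CliffordAlgebra.reverse c) = CliffordAlgebra.reverse (clIncl h w c) := by
  induction c using CliffordAlgebra.induction with
  | algebraMap r => simp
  | ι x =>
    rw [CliffordAlgebra.reverse_ι]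
    erw [clIncl_vec]
    rw [CliffordAlgebra.reverse_ι]
  | mul a b ha hb => simp only [CliffordAlgebra.reverse.map_mul, map_mul, ha, hb]
  | add a b ha hb => simp only [map_add, ha, hb]

theorem clIncl_even {n d : ℕ} (h : d ≤ n) (w : Fin (n + 1) → ℝ) (c : Cl (restr h w))
    (hc : c ∈ CliffordAlgebra.evenOdd (form (restr h w)) 0) :
    clIncl h w c ∈ CliffordAlgebra.evenOdd (form w) 0 := by
  induction c, hc using CliffordAlgebra.even_induction with
  | algebraMap r =>
    rw [AlgHom.commutes]
    exact CliffordAlgebra.one_le_evenOdd_zero _ (Submodule.mem_one.2 ⟨r, rfl⟩)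
  | add x y hx hy ihx ihy => rw [map_add]; exact add_mem ihx ihy
  | ι_mul_ι_mul m₁ m₂ x hx ih =>
    rw [map_mul, map_mul]
    erw [clIncl_vec, clIncl_vec]
    have := CliffordAlgebra.evenOdd_mul_le (form w) 0 0
      (Submodule.mul_mem_mul (CliffordAlgebra.ι_mul_ι_mem_evenOdd_zero (form w)
        (coordIncl h m₁) (coordIncl h m₂)) ih)
    simpa using this

/-- A vector that is orthogonal to `E'` commutes with the even elements of the Clifford algebra
of `E'`. -/
theorem clIncl_comm {n d : ℕ} (h : d ≤ n) (w : Fin (n + 1) → ℝ) (c : Cl (restr h w))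
    (hc : c ∈ CliffordAlgebra.evenOdd (form (restr h w)) 0) (v : Fin (n + 1) → ℝ)
    (hv : ∀ x, bil w (coordIncl h x) v = 0) :
    clIncl h w c * vec w v = vec w v * clIncl h w c := by
  have anti : ∀ m, vec w (coordIncl h m) * vec w v = - (vec w v * vec w (coordIncl h m)) := by
    intro m
    rw [eq_neg_iff_add_eq_zero, CliffordAlgebra.ι_mul_ι_add_swap]
    have : QuadraticMap.polar (form w) (coordIncl h m) v = 2 * bil w (coordIncl h m) v := by
      simp only [QuadraticMap.polar, form_eq_bil, bil, ← Finset.sum_sub_distrib, Finset.mul_sum,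
        Pi.add_apply]
      exact Finset.sum_congr rfl fun i _ => by ring
    rw [this, hv, mul_zero, map_zero]
  induction c, hc using CliffordAlgebra.even_induction with
  | algebraMap r => rw [AlgHom.commutes]; exact Algebra.commutes _ _
  | add x y hx hy ihx ihy => rw [map_add, add_mul, mul_add, ihx, ihy]
  | ι_mul_ι_mul m₁ m₂ x hx ih =>
    rw [map_mul, map_mul]
    erw [clIncl_vec, clIncl_vec]
    calc _ = vec w (coordIncl h m₁) * (vec w (coordIncl h m₂) * (clIncl h w x * vec w v)) := by
          simp only [mul_assoc]
      _ = vec w (coordIncl h m₁) * ((vec w (coordIncl h m₂) * vec w v) * clIncl h w x) := by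
          rw [ih]; simp only [mul_assoc]
      _ = - ((vec w (coordIncl h m₁) * vec w v) * (vec w (coordIncl h m₂) * clIncl h w x)) := by
          rw [anti m₂]; simp only [neg_mul, mul_neg, mul_assoc]
      _ = _ := by
          rw [anti m₁]; simp only [neg_mul, neg_neg, mul_assoc]

theorem IsSpin.clIncl {n d : ℕ} (h : d ≤ n) (w : Fin (n + 1) → ℝ) {c : Cl (restr h w)}
    (hc : IsSpin (restr h w) c) : IsSpin w (HypArith.clIncl h w c) := by
  have h1 : HypArith.clIncl h w c * CliffordAlgebra.reverse (HypArith.clIncl h w c) = 1 := by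
    rw [← clIncl_reverse, ← map_mul, hc.2.2, map_one]
  refine ⟨clIncl_even h w c hc.1, fun v => ?_, h1⟩
  let p : Fin (d + 1) → ℝ := fun i => v (Fin.castLE (Nat.add_le_add_right h 1) i)
  obtain ⟨q, hq⟩ := hc.2.1 p
  have hperp : ∀ x, bil w (coordIncl h x) (v - coordIncl h p) = 0 := by
    intro x
    refine Finset.sum_eq_zero fun i _ => ?_
    by_cases hi : ∃ j, Fin.castLE (Nat.add_le_add_right h 1) j = i
    · obtain ⟨j, rfl⟩ := hi
      rw [Pi.sub_apply, coordIncl_castLE h p, sub_self, mul_zero]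
    · rw [coordIncl_of_not_mem h x i hi, mul_zero, zero_mul]
  refine ⟨coordIncl h q + (v - coordIncl h p), ?_⟩
  have e1 : v = coordIncl h p + (v - coordIncl h p) := by abel
  have hcomm := clIncl_comm h w c hc.1 _ hperp
  conv_lhs => rw [e1]
  rw [map_add, map_add, mul_add, add_mul, hcomm]
  congr 1
  · rw [← clIncl_vec, ← clIncl_vec, ← clIncl_reverse, ← map_mul, ← map_mul, hq]
  · rw [mul_assoc, h1, mul_one]

/-- The natural inclusion of the spin group of the restricted form `f'` in that of `f`. -/
def spinIncl {n d : ℕ} (h : d ≤ n) (w : Fin (n + 1) → ℝ) : SpinGrp (restr h w) →* SpinGrp w :=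
  ((Units.map (clIncl h w : Cl (restr h w) →* Cl w)).comp
    (spinSubgroup (restr h w)).subtype).codRestrict (spinSubgroup w)
    fun s => IsSpin.clIncl h w (SpinGrp.isSpin s)

theorem val_spinIncl {n d : ℕ} (h : d ≤ n) (w : Fin (n + 1) → ℝ) (s : SpinGrp (restr h w)) :
    (spinIncl h w s).val = clIncl h w s.val := rfl

/-- The inclusion of spin groups is compatible with the inclusion of vector spaces. -/
theorem act_spinIncl {n d : ℕ} (h : d ≤ n) (w : Fin (n + 1) → ℝ) (s : SpinGrp (restr h w))
    (x : Fin (d + 1) → ℝ) : act (spinIncl h w s) (coordIncl h x) = coordIncl h (act s x) := by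
  apply vec_injective w
  rw [vec_act, val_spinIncl, ← clIncl_vec, ← clIncl_vec, vec_act, map_mul, map_mul,
    clIncl_reverse]

/-! ### Hyperbolic space and its quotients -/

/-- The hyperboloid model of hyperbolic `n`-space attached to a form of signature `(n, 1)` with
`w 0 < 0`: the sheet `x₀ > 0` of `f(x) = -1`. Rescaling the coordinates by `√|w i|` identifies it
with the standard hyperboloid. -/
def Hyp {n : ℕ} (w : Fin (n + 1) → ℝ) : Type := {x : Fin (n + 1) → ℝ // form w x = -1 ∧ 0 < x 0}

instance instTopologicalSpaceHyp {n : ℕ} (w : Fin (n + 1) → ℝ) : TopologicalSpace (Hyp w) :=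
  inferInstanceAs (TopologicalSpace {x : Fin (n + 1) → ℝ // form w x = -1 ∧ 0 < x 0})

/-- The hyperbolic distance, `cosh d(x, y) = -Φ(x, y)`. -/
def hdist {n : ℕ} (w x y : Fin (n + 1) → ℝ) : ℝ := Real.arcosh (-bil w x y)

/-- The displacement (translation length) `inf_x d(x, φ_s x)`. -/
def translationLength {n : ℕ} {w : Fin (n + 1) → ℝ} (s : SpinGrp w) : ℝ :=
  ⨅ x : Hyp w, hdist w x.1 (act s x.1)

/-- The fixed points of `φ_s` on the boundary sphere of hyperbolic space: the boundary is the set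
of isotropic lines, each given by its vector with `v₀ = 1`. -/
def boundaryFixed {n : ℕ} {w : Fin (n + 1) → ℝ} (s : SpinGrp w) : Set (Fin (n + 1) → ℝ) :=
  {v | v 0 = 1 ∧ form w v = 0 ∧ ∃ c : ℝ, act s v = c • v}

/-- Loxodromic elements: no fixed point in hyperbolic space, exactly two on the boundary. -/
def IsLoxodromic {n : ℕ} {w : Fin (n + 1) → ℝ} (s : SpinGrp w) : Prop :=
  (∀ x : Hyp w, act s x.1 ≠ x.1) ∧ (boundaryFixed s).ncard = 2

/-- The orbit equivalence relation of a group `G` on hyperbolic space. -/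
def orbitSetoid {n : ℕ} {w : Fin (n + 1) → ℝ} (G : Subgroup (SpinGrp w)) : Setoid (Hyp w) where
  r x y := ∃ s ∈ G, act s x.1 = y.1
  iseqv :=
    { refl := fun x => ⟨1, G.one_mem, act_one x.1⟩
      symm := by
        rintro x y ⟨s, hs, h⟩
        exact ⟨s⁻¹, G.inv_mem hs, by rw [← h, ← act_mul, inv_mul_cancel, act_one]⟩
      trans := by
        rintro x y z ⟨s, hs, h⟩ ⟨t, ht, h'⟩
        exact ⟨t * s, G.mul_mem ht hs, by rw [act_mul, h, h']⟩ }

/-- The quotient `G \ ℍⁿ`, with the quotient topology. -/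
abbrev HypQuot {n : ℕ} {w : Fin (n + 1) → ℝ} (G : Subgroup (SpinGrp w)) : Type :=
  Quotient (orbitSetoid G)

/-- `G \ ℍⁿ` is a closed hyperbolic manifold: `G` acts freely and properly discontinuously on
hyperbolic space, and the quotient is compact. -/
def IsClosedHyperbolicManifold {n : ℕ} {w : Fin (n + 1) → ℝ} (G : Subgroup (SpinGrp w)) : Prop :=
  (∀ s ∈ G, ∀ x : Hyp w, act s x.1 = x.1 → s = 1) ∧
  (∀ K : Set (Hyp w), IsCompact K →
    {s : SpinGrp w | s ∈ G ∧ ∃ x ∈ K, ∃ y ∈ K, act s x.1 = y.1}.Finite) ∧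
  CompactSpace (HypQuot G)

/-- Complete unit speed geodesics `ℝ → ℍⁿ`. -/
def IsGeodesicLine {n : ℕ} {w : Fin (n + 1) → ℝ} (g : ℝ → Hyp w) : Prop :=
  ∀ s t, hdist w (g s).1 (g t).1 = |s - t|

/-- Complete unit speed geodesics in `G \ ℍⁿ`: the projections of those of `ℍⁿ`. -/
def IsGeodesic {n : ℕ} {w : Fin (n + 1) → ℝ} (G : Subgroup (SpinGrp w)) (c : ℝ → HypQuot G) :
    Prop :=
  ∃ g : ℝ → Hyp w, IsGeodesicLine g ∧ ∀ t, c t = Quotient.mk (orbitSetoid G) (g t)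

/-- The lengths of the closed geodesics in `G \ ℍⁿ`. -/
def closedGeodesicLengths {n : ℕ} {w : Fin (n + 1) → ℝ} (G : Subgroup (SpinGrp w)) : Set ℝ :=
  {r | 0 < r ∧ ∃ c : ℝ → HypQuot G, IsGeodesic G c ∧ Function.Periodic c r}

/-- The systolic length of `G \ ℍⁿ`: the shortest length of a closed geodesic. -/
def systole {n : ℕ} {w : Fin (n + 1) → ℝ} (G : Subgroup (SpinGrp w)) : ℝ :=
  sInf (closedGeodesicLengths G)

/-- The isometric embedding of hyperbolic `d`-space in hyperbolic `n`-space. -/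
def hypIncl {n d : ℕ} (h : d ≤ n) (w : Fin (n + 1) → ℝ) (x : Hyp (restr h w)) : Hyp w :=
  ⟨coordIncl h x.1, by rw [form_eq_bil, bil_coordIncl, ← form_eq_bil]; exact x.2.1, by
    have := coordIncl_castLE h x.1 0
    have h0 : Fin.castLE (Nat.add_le_add_right h 1) (0 : Fin (d + 1)) = 0 := rfl
    rw [h0] at this
    rw [this]; exact x.2.2⟩

theorem hdist_hypIncl {n d : ℕ} (h : d ≤ n) (w : Fin (n + 1) → ℝ) (x y : Hyp (restr h w)) :
    hdist w (hypIncl h w x).1 (hypIncl h w y).1 = hdist (restr h w) x.1 y.1 := by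
  rw [hdist, hdist]
  congr 2
  exact bil_coordIncl h w x.1 y.1

/-- The map `G' \ ℍᵈ → G \ ℍⁿ` induced by the inclusions `ℍᵈ → ℍⁿ` and `G' → G`. -/
def quotMap {n d : ℕ} (h : d ≤ n) (w : Fin (n + 1) → ℝ) (G' : Subgroup (SpinGrp (restr h w)))
    (G : Subgroup (SpinGrp w)) (hG : ∀ s ∈ G', spinIncl h w s ∈ G) : HypQuot G' → HypQuot G :=
  Quotient.map' (s₁ := orbitSetoid G') (s₂ := orbitSetoid G) (hypIncl h w) (by
    rintro x y ⟨s, hs, hxy⟩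
    refine ⟨spinIncl h w s, hG s hs, ?_⟩
    change act (spinIncl h w s) (coordIncl h x.1) = coordIncl h y.1
    rw [act_spinIncl, hxy])

/-- `G' \ ℍᵈ` is a totally geodesic submanifold of `G \ ℍⁿ`: `G'` is contained in `G`, the
induced map of quotients is an embedding, and it carries geodesics to geodesics. -/
def IsTotallyGeodesicIn {n d : ℕ} (h : d ≤ n) (w : Fin (n + 1) → ℝ)
    (G' : Subgroup (SpinGrp (restr h w))) (G : Subgroup (SpinGrp w)) : Prop :=
  ∃ hG : ∀ s ∈ G', spinIncl h w s ∈ G,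
    Topology.IsEmbedding (quotMap h w G' G hG) ∧
    ∀ c, IsGeodesic G' c → IsGeodesic G (quotMap h w G' G hG ∘ c)

/-! ### Arithmetic and congruence subgroups -/

section Arithmetic

variable (k : IntermediateField ℚ ℝ) {n : ℕ}

/-- The weights, elements of the ring of integers of `k ⊆ ℝ`, regarded as real numbers. -/
abbrev realW (w : Fin (n + 1) → 𝓞 k) : Fin (n + 1) → ℝ := fun i => algebraMap (𝓞 k) ℝ (w i)

/-- Admissibility of the diagonal form with weights `w`: its signature is `(n, 1)` over `ℝ`, with
`w 0` negative, and its conjugate under every embedding `σ : k → ℝ` other than the inclusion is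
definite. -/
def IsAdmissible (w : Fin (n + 1) → 𝓞 k) : Prop :=
  realW k w 0 < 0 ∧ (∀ i, i ≠ 0 → 0 < realW k w i) ∧
  ∀ σ : k →+* ℝ, σ ≠ algebraMap k ℝ → (∀ i, 0 < σ (w i : k)) ∨ (∀ i, σ (w i : k) < 0)

variable (w : Fin (n + 1) → 𝓞 k)

/-- For an ideal `I` of the ring of integers of `k`: the elements of the even Clifford algebra whose
coefficients in the basis `e_M`, `|M|` even, lie in `I`. -/
def coeffIn (I : Ideal (𝓞 k)) : AddSubgroup (Cl (realW k w)) :=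
  AddSubgroup.closure {c | ∃ a ∈ I, ∃ M : Finset (Fin (n + 1)), Even M.card ∧
    c = algebraMap (𝓞 k) ℝ a • genProd (realW k w) M}

/-- The order `𝒬` of the even Clifford algebra: all coefficients are integers of `k`. Then
`coeffIn k w I` is `I 𝒬`. -/
def order : AddSubgroup (Cl (realW k w)) := coeffIn k w ⊤

theorem gen_mul_list (i : Fin (n + 1)) (l : List (Fin (n + 1))) (hl : l.Pairwise (· < ·)) :
    ∃ (c : 𝓞 k) (l' : List (Fin (n + 1))), l'.Pairwise (· < ·) ∧ (∀ j ∈ l', j = i ∨ j ∈ l) ∧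
      (l'.length : ZMod 2) = l.length + 1 ∧
      gen (realW k w) i * (l.map (gen (realW k w))).prod
        = algebraMap (𝓞 k) ℝ c • (l'.map (gen (realW k w))).prod := by
  induction l with
  | nil => exact ⟨1, [i], by simp⟩
  | cons a l ih =>
    rw [List.pairwise_cons] at hl
    rcases lt_trichotomy i a with h | h | h
    · refine ⟨1, i :: a :: l, ?_, by simp, by simp, by simp⟩
      simp only [List.pairwise_cons, List.mem_cons, forall_eq_or_imp]
      exact ⟨⟨h, fun b hb => h.trans (hl.1 b hb)⟩, hl.1, hl.2⟩
    · subst h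
      refine ⟨w i, l, hl.2, fun j hj => Or.inr (List.mem_cons_of_mem _ hj), ?_, ?_⟩
      · have : (1 : ZMod 2) + 1 = 0 := by decide
        simp [add_assoc, this]
      · rw [List.map_cons, List.prod_cons, ← mul_assoc, gen_mul_self, ← Algebra.smul_def]
    · obtain ⟨c, l', h1, h2, h3, h4⟩ := ih hl.2
      refine ⟨-c, a :: l', ?_, ?_, ?_, ?_⟩
      · rw [List.pairwise_cons]
        refine ⟨fun b hb => ?_, h1⟩
        rcases h2 b hb with rfl | hb
        · exact h
        · exact hl.1 b hb
      · intro j hj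
        rcases List.mem_cons.1 hj with rfl | hj
        · simp
        · rcases h2 j hj with h5 | h5
          · exact Or.inl h5
          · exact Or.inr (List.mem_cons_of_mem _ h5)
      · simp [h3]
      · rw [List.map_cons, List.prod_cons, List.map_cons, List.prod_cons, ← mul_assoc,
          gen_mul_gen _ h.ne', neg_mul, mul_assoc, h4, mul_smul_comm, map_neg, neg_smul]

theorem list_eq_genProd (l : List (Fin (n + 1))) (hl : l.Pairwise (· < ·)) :
    (l.map (gen (realW k w))).prod = genProd (realW k w) l.toFinset ∧
      l.toFinset.card = l.length :=
  ⟨by rw [genProd, (List.toFinset_sort (· ≤ ·) (hl.imp ne_of_lt)).2 (hl.imp le_of_lt)],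
    List.toFinset_card_of_nodup (hl.imp ne_of_lt)⟩

theorem gen_mul_genProd (i : Fin (n + 1)) (N : Finset (Fin (n + 1))) :
    ∃ (c : 𝓞 k) (P : Finset (Fin (n + 1))), (P.card : ZMod 2) = N.card + 1 ∧
      gen (realW k w) i * genProd (realW k w) N
        = algebraMap (𝓞 k) ℝ c • genProd (realW k w) P := by
  obtain ⟨c, l', h1, -, h3, h4⟩ := gen_mul_list k w i (N.sort (· ≤ ·)) N.sortedLT_sort.pairwise
  obtain ⟨h5, h6⟩ := list_eq_genProd k w l' h1
  refine ⟨c, l'.toFinset, ?_, ?_⟩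
  · rw [h6, h3, Finset.length_sort]
  · rw [← h5, ← h4, genProd]

theorem list_mul_genProd (l : List (Fin (n + 1))) (N : Finset (Fin (n + 1))) :
    ∃ (c : 𝓞 k) (P : Finset (Fin (n + 1))), (P.card : ZMod 2) = N.card + l.length ∧
      (l.map (gen (realW k w))).prod * genProd (realW k w) N
        = algebraMap (𝓞 k) ℝ c • genProd (realW k w) P := by
  induction l with
  | nil => exact ⟨1, N, by simp⟩
  | cons a l ih =>
    obtain ⟨c, P, h1, h2⟩ := ih
    obtain ⟨c', P', h1', h2'⟩ := gen_mul_genProd k w a P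
    refine ⟨c * c', P', ?_, ?_⟩
    · rw [h1', h1, List.length_cons, Nat.cast_succ, add_assoc]
    · rw [List.map_cons, List.prod_cons, mul_assoc, h2, mul_smul_comm, h2', smul_smul, map_mul]

theorem genProd_mul_genProd (M N : Finset (Fin (n + 1))) (hM : Even M.card) (hN : Even N.card) :
    ∃ (c : 𝓞 k) (P : Finset (Fin (n + 1))), Even P.card ∧
      genProd (realW k w) M * genProd (realW k w) N
        = algebraMap (𝓞 k) ℝ c • genProd (realW k w) P := by
  obtain ⟨c, P, h1, h2⟩ := list_mul_genProd k w (M.sort (· ≤ ·)) N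
  refine ⟨c, P, ?_, h2⟩
  rw [← ZMod.natCast_eq_zero_iff_even] at hM hN ⊢
  rw [h1, Finset.length_sort, hM, hN, add_zero]

theorem reverse_genProd (M : Finset (Fin (n + 1))) (hM : Even M.card) :
    ∃ (c : 𝓞 k) (P : Finset (Fin (n + 1))), Even P.card ∧
      CliffordAlgebra.reverse (genProd (realW k w) M)
        = algebraMap (𝓞 k) ℝ c • genProd (realW k w) P := by
  have h1 : CliffordAlgebra.reverse (genProd (realW k w) M)
      = (((M.sort (· ≤ ·)).reverse).map (gen (realW k w))).prod := by
    have := CliffordAlgebra.reverse_prod_map_ι (Q := form (realW k w))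
      ((M.sort (· ≤ ·)).map fun i => (Pi.single i 1 : Fin (n + 1) → ℝ))
    rw [List.map_map, ← List.map_reverse] at this
    exact this
  obtain ⟨c, P, h2, h3⟩ := list_mul_genProd k w (M.sort (· ≤ ·)).reverse ∅
  refine ⟨c, P, ?_, ?_⟩
  · rw [← ZMod.natCast_eq_zero_iff_even] at hM ⊢
    rw [h2, List.length_reverse, Finset.length_sort, hM]
    simp
  · have h4 : genProd (realW k w) ∅ = 1 := by simp [genProd]
    rw [h1, ← h3, h4, mul_one]

theorem coeffIn_mem {I : Ideal (𝓞 k)} {a : 𝓞 k} (ha : a ∈ I) {M : Finset (Fin (n + 1))}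
    (hM : Even M.card) : algebraMap (𝓞 k) ℝ a • genProd (realW k w) M ∈ coeffIn k w I :=
  AddSubgroup.subset_closure ⟨a, ha, M, hM, rfl⟩

theorem smul_mem_coeffIn {I : Ideal (𝓞 k)} {a : 𝓞 k} (ha : a ∈ I) {x : Cl (realW k w)}
    (hx : x ∈ order k w) : algebraMap (𝓞 k) ℝ a • x ∈ coeffIn k w I := by
  induction hx using AddSubgroup.closure_induction with
  | mem x h =>
    obtain ⟨b, -, M, hM, rfl⟩ := h
    rw [smul_smul, ← map_mul]
    exact coeffIn_mem k w (I.mul_mem_right b ha) hM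
  | zero => simp
  | add x y _ _ hx hy => rw [smul_add]; exact add_mem hx hy
  | neg x _ hx => rw [smul_neg]; exact neg_mem hx

theorem smul_mem_coeffIn_right {I : Ideal (𝓞 k)} (a : 𝓞 k) {x : Cl (realW k w)}
    (hx : x ∈ coeffIn k w I) : algebraMap (𝓞 k) ℝ a • x ∈ coeffIn k w I := by
  induction hx using AddSubgroup.closure_induction with
  | mem x h =>
    obtain ⟨b, hb, M, hM, rfl⟩ := h
    rw [smul_smul, ← map_mul]
    exact coeffIn_mem k w (I.mul_mem_left a hb) hM
  | zero => simp
  | add x y _ _ hx hy => rw [smul_add]; exact add_mem hx hy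
  | neg x _ hx => rw [smul_neg]; exact neg_mem hx

theorem one_mem_order : (1 : Cl (realW k w)) ∈ order k w := by
  have h4 : genProd (realW k w) ∅ = 1 := by simp [genProd]
  have := coeffIn_mem k w (I := ⊤) (a := 1) trivial (M := ∅) (by simp)
  rwa [map_one, one_smul, h4] at this

theorem mul_mem_coeffIn {I : Ideal (𝓞 k)} {x y : Cl (realW k w)} (hx : x ∈ order k w)
    (hy : y ∈ coeffIn k w I) : x * y ∈ coeffIn k w I := by
  induction hx using AddSubgroup.closure_induction with
  | mem x h =>
    obtain ⟨a, -, M, hM, rfl⟩ := h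
    induction hy using AddSubgroup.closure_induction with
    | mem y h =>
      obtain ⟨b, hb, N, hN, rfl⟩ := h
      obtain ⟨c, P, hP, h⟩ := genProd_mul_genProd k w M N hM hN
      rw [smul_mul_smul_comm, h, smul_smul, ← map_mul, ← map_mul]
      exact coeffIn_mem k w (I.mul_mem_right _ (I.mul_mem_left a hb)) hP
    | zero => simp
    | add x z _ _ hx hz => rw [mul_add]; exact add_mem hx hz
    | neg x _ hx => rw [mul_neg]; exact neg_mem hx
  | zero => simp
  | add x z _ _ hx hz => rw [add_mul]; exact add_mem hx hz
  | neg x _ hx => rw [neg_mul]; exact neg_mem hx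

theorem reverse_mem_coeffIn {I : Ideal (𝓞 k)} {x : Cl (realW k w)} (hx : x ∈ coeffIn k w I) :
    CliffordAlgebra.reverse x ∈ coeffIn k w I := by
  induction hx using AddSubgroup.closure_induction with
  | mem x h =>
    obtain ⟨a, ha, M, hM, rfl⟩ := h
    obtain ⟨c, P, hP, h⟩ := reverse_genProd k w M hM
    rw [map_smul, h, smul_smul, ← map_mul]
    exact coeffIn_mem k w (I.mul_mem_right _ ha) hP
  | zero => simp
  | add x z _ _ hx hz => rw [map_add]; exact add_mem hx hz
  | neg x _ hx => rw [map_neg]; exact neg_mem hx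

/-- The arithmetic group `Γ` of integral points of the spin group of the form with weights `w`. -/
def Gam : Subgroup (SpinGrp (realW k w)) where
  carrier := {s | s.val ∈ order k w}
  one_mem' := one_mem_order k w
  mul_mem' := fun ha hb => mul_mem_coeffIn k w ha hb
  inv_mem' := fun {s} hs => by
    change (s⁻¹).val ∈ order k w
    rw [SpinGrp.val_inv]
    exact reverse_mem_coeffIn k w hs

/-- The principal congruence subgroup `Γ(I)`: the elements of `Γ` congruent to `1` modulo
`I 𝒬`. -/
def GamI (I : Ideal (𝓞 k)) : Subgroup (SpinGrp (realW k w)) where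
  carrier := {s | s ∈ Gam k w ∧ s.val - 1 ∈ coeffIn k w I}
  one_mem' := ⟨one_mem _, by rw [SpinGrp.val_one, sub_self]; exact zero_mem _⟩
  mul_mem' := fun {s t} hs ht => ⟨mul_mem hs.1 ht.1, by
    have : (s * t).val - 1 = s.val * (t.val - 1) + (s.val - 1) := by
      rw [SpinGrp.val_mul, mul_sub, mul_one]; abel
    rw [this]
    exact add_mem (mul_mem_coeffIn k w hs.1 ht.2) hs.2⟩
  inv_mem' := fun {s} hs => ⟨inv_mem hs.1, by
    have := reverse_mem_coeffIn k w hs.2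
    rwa [map_sub, CliffordAlgebra.reverse.map_one, ← SpinGrp.val_inv] at this⟩

/-- A congruence subgroup of `Γ`: it contains `Γ(I)` for some nonzero ideal `I`. -/
def IsCongruenceSubgroup (G : Subgroup (SpinGrp (realW k w))) : Prop :=
  G ≤ Gam k w ∧ ∃ I : Ideal (𝓞 k), I ≠ ⊥ ∧ GamI k w I ≤ G

/-- A pair `(α, τ)` where `α` is an integer of `k` and `τ` is a unit of order two modulo `α`. -/
structure CongruenceLevel where
  α : 𝓞 k
  τ : (𝓞 k ⧸ Ideal.span {α})ˣ
  order_two : orderOf τ = 2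

/-- An integer of `k` as a scalar of the Clifford algebra. -/
abbrev scal (t : 𝓞 k) : Cl (realW k w) := algebraMap ℝ (Cl (realW k w)) (algebraMap (𝓞 k) ℝ t)

/-- `s` is congruent modulo `α 𝒬` to a representative of the residue class `τ`. -/
def CongrTau (D : CongruenceLevel k) (s : SpinGrp (realW k w)) : Prop :=
  ∃ t : 𝓞 k, Ideal.Quotient.mk (Ideal.span {D.α}) t = D.τ ∧
    s.val - scal k w t ∈ coeffIn k w (Ideal.span {D.α})

theorem congr_mul {I : Ideal (𝓞 k)} {x y : Cl (realW k w)} {t u : 𝓞 k} (hx : x ∈ order k w)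
    (h : x - scal k w t ∈ coeffIn k w I) (h' : y - scal k w u ∈ coeffIn k w I) :
    x * y - scal k w (t * u) ∈ coeffIn k w I := by
  have e : x * y - scal k w (t * u)
      = x * (y - scal k w u) + algebraMap (𝓞 k) ℝ u • (x - scal k w t) := by
    rw [mul_sub, smul_sub, Algebra.smul_def, Algebra.smul_def, scal, map_mul, map_mul,
      Algebra.commutes (algebraMap (𝓞 k) ℝ u) x, Algebra.commutes (algebraMap (𝓞 k) ℝ t)]
    abel
  rw [e]
  exact add_mem (mul_mem_coeffIn k w hx h') (smul_mem_coeffIn_right k w u h)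

theorem congr_change {I : Ideal (𝓞 k)} {x : Cl (realW k w)} {t u : 𝓞 k}
    (h : x - scal k w t ∈ coeffIn k w I)
    (htu : Ideal.Quotient.mk I t = Ideal.Quotient.mk I u) :
    x - scal k w u ∈ coeffIn k w I := by
  have e : x - scal k w u
      = (x - scal k w t) + algebraMap (𝓞 k) ℝ (t - u) • (1 : Cl (realW k w)) := by
    rw [Algebra.smul_def, mul_one, map_sub, map_sub]; abel
  rw [e]
  exact add_mem h (smul_mem_coeffIn k w (Ideal.Quotient.eq.1 htu) (one_mem_order k w))

/-- The group `Γ_τ(α)`: the elements of `Γ` that lie in `Γ(α)` or are congruent to `τ` modulo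
`α 𝒬`. -/
def GamTau (D : CongruenceLevel k) : Subgroup (SpinGrp (realW k w)) where
  carrier := {s | s ∈ Gam k w ∧ (s ∈ GamI k w (Ideal.span {D.α}) ∨ CongrTau k w D s)}
  one_mem' := ⟨one_mem _, Or.inl (one_mem _)⟩
  mul_mem' := by
    have hsq : (D.τ : 𝓞 k ⧸ Ideal.span {D.α}) * D.τ = 1 := by
      rw [← Units.val_mul, ← pow_two, ← D.order_two, pow_orderOf_eq_one, Units.val_one]
    rintro s t ⟨hs, hs'⟩ ⟨ht, ht'⟩
    refine ⟨mul_mem hs ht, ?_⟩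
    rcases hs' with hs' | ⟨a, ha, hs'⟩ <;> rcases ht' with ht' | ⟨b, hb, ht'⟩
    · exact Or.inl (mul_mem hs' ht')
    · have h1 : s.val - scal k w 1 ∈ coeffIn k w (Ideal.span {D.α}) := by
        rw [scal, map_one, map_one]; exact hs'.2
      exact Or.inr ⟨1 * b, by rw [one_mul, hb], congr_mul k w hs h1 ht'⟩
    · have h1 : t.val - scal k w 1 ∈ coeffIn k w (Ideal.span {D.α}) := by
        rw [scal, map_one, map_one]; exact ht'.2
      exact Or.inr ⟨a * 1, by rw [mul_one, ha], congr_mul k w hs hs' h1⟩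
    · refine Or.inl ⟨mul_mem hs ht, ?_⟩
      have h1 := congr_mul k w hs hs' ht'
      have h2 := congr_change k w (u := 1) h1 (by rw [map_mul, ha, hb, hsq, map_one])
      rwa [scal, map_one, map_one] at h2
  inv_mem' := by
    rintro s ⟨hs, hs'⟩
    refine ⟨inv_mem hs, ?_⟩
    rcases hs' with hs' | ⟨a, ha, hs'⟩
    · exact Or.inl (inv_mem hs')
    · refine Or.inr ⟨a, ha, ?_⟩
      have := reverse_mem_coeffIn k w hs'
      rwa [map_sub, CliffordAlgebra.reverse.commutes, ← SpinGrp.val_inv] at this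

end Arithmetic

end HypArith

end

open HypArith

noncomputable section

namespace HypArith

/-! ### Coordinates in the Clifford algebra of a diagonal form -/

section Coordinates

variable {n : ℕ} (w : Fin (n + 1) → ℝ)

/-! The real part controls everything. For `s` in the spin group the coefficients satisfy `∑ c_M²
w_M = 1`, while the hyperbolic cosine of the displacement of the base point is `∑ c_M² |w_M|`.
Adding the two and using transitivity gives `2 s_ℝ² ≤ 1 + cosh d(x, sx)` for all `x`
(`two_mul_realPart_sq_le`). For a ternary form and `s_ℝ > 1` equality holds along an axis
(`exists_isAxis`). Minimal displacement thus becomes a question about the size of real parts.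

At the other real place the form is definite, so the conjugate of the norm equation has nonnegative
terms and forces `|σ(s_ℝ)| ≤ 1` for integral `s` (`abs_conj_realPart_le`). Since a nonzero integer
of `k` has norm at least one in absolute value, a nonzero integer that is bounded at `σ` cannot be
too small at the given place.

If `S ∈ Γ'` has real part `T`, then `S³ = (4T² - 1) S - 2T`, so `S³` is a scalar modulo `α = 4T² -
1`, namely `P = 4T³ - 3T`, and `P² - 1 = (T² - 1) α²`. If `r` is congruent to `Q ∈ {1, P}` modulo
`α`, then `r r* = 1` improves this to `α² ∣ 2 (r_ℝ - Q)` (`two_mul_realPart_sub_mem`). When `|σ(α)|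
≥ 1`, either `r_ℝ = Q` or `|r_ℝ - Q| ≥ α²/8`, which has order `2T⁴` and dwarfs `P`. Real part `1`
occurs only for `r = 1`, so every `r ≠ 1` in `Γ_τ(α)` has `|r_ℝ| ≥ P`, and `S³` attains this bound
(`le_abs_realPart_of_mem_GamTau`). To secure `|σ(α)| ≥ 1`, take `S` among `s`, `s²`, `s³`: with
`σ(s_ℝ) = cos θ`, one of `cos θ`, `cos 2θ`, `cos 3θ` has square at least `1/2` (`two_le_chebT_sq`).
Hence the exponents 3, 6 and 9.

Compactness is a Mahler type argument. Translates of the integral lattice of the Clifford algebra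
have no short vectors (`exists_no_short_vectors`), so Minkowski's theorem supplies bases bounded at
both places (`exists_bounded_basis`). Their Gram data take finitely many values, and two bases with
equal data differ by an element of the spin group (`exists_spin_mul_eq`). If the bases are also
congruent modulo a suitable integer, that element lies in `Γ(α)`; the pigeonhole principle then
gives a bounded fundamental domain (`exists_bound_GamI`).

The surface is embedded because reflections in the coordinates outside `E'` preserve the congruence
conditions. If `s` maps a point of the plane into the plane, then `s` and its reflected copy agree
at that point, hence are equal by freeness, and `s` comes from `Γ'` (`isTotallyGeodesicIn_of_flip`).

The base group is `Λ = Γ(3)`: if `T ≡ 1` modulo 3, then 3 divides `α` and `P ≡ 1`, so `Γ_τ(α) ≤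
Γ(3)`. The degrees are unbounded because finitely many fixed elements of `Γ(3)` lie in different
cosets of `Γ_τ(α)` once `T` exceeds the real parts of their quotients. -/

/-- The product of the weights `w i`, `i ∈ M`. -/
def wprod (M : Finset (Fin (n + 1))) : ℝ := ∏ i ∈ M, w i

theorem wprod_ne_zero {w : Fin (n + 1) → ℝ} (hw : ∀ i, w i ≠ 0) (M : Finset (Fin (n + 1))) :
    wprod w M ≠ 0 := Finset.prod_ne_zero_iff.2 fun i _ => hw i

theorem genProd_empty : genProd w ∅ = 1 := by simp [genProd]

theorem genProd_insert_of_lt {a : Fin (n + 1)} {M : Finset (Fin (n + 1))} (h : ∀ b ∈ M, a < b) :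
    genProd w (insert a M) = gen w a * genProd w M := by
  have ha : a ∉ M := fun h' => lt_irrefl _ (h a h')
  rw [genProd, Finset.sort_insert _ (fun b hb => (h b hb).le) ha, List.map_cons, List.prod_cons,
    genProd]

theorem genProd_singleton (a : Fin (n + 1)) : genProd w {a} = gen w a := by simp [genProd]

/-- Moving `e_i` to its place costs only signs, and meeting another `e_i` contracts the pair to `w
i`. Compared with an integrality statement, the exact factor and the index set `{i} ∆ M` are what
make the trace form below diagonal. -/
theorem gen_mul_genProd_symmDiff (i : Fin (n + 1)) (M : Finset (Fin (n + 1))) :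
    ∃ ε : ℝ, (ε = 1 ∨ ε = -1) ∧
      gen w i * genProd w M = (ε * if i ∈ M then w i else 1) • genProd w (symmDiff {i} M) := by
  induction M using Finset.induction_on_min with
  | empty => exact ⟨1, Or.inl rfl, by
      rw [← Finset.bot_eq_empty, symmDiff_bot, genProd_singleton, Finset.bot_eq_empty]
      simp [genProd_empty]⟩
  | insert a M ha ih =>
    have haM : a ∉ M := fun h' => lt_irrefl _ (ha a h')
    rcases lt_trichotomy i a with h | h | h
    · have h1 : i ∉ insert a M := by
        rw [Finset.mem_insert, not_or]
        exact ⟨h.ne, fun h' => lt_asymm h (ha i h')⟩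
      refine ⟨1, Or.inl rfl, ?_⟩
      have h2 : symmDiff {i} (insert a M) = insert i (insert a M) := by
        ext x; simp only [Finset.mem_symmDiff, Finset.mem_singleton]
        by_cases hx : x = i
        · subst hx; simp [h1]
        · simp [hx]
      rw [h2, genProd_insert_of_lt w (a := i), if_neg h1, mul_one, one_smul]
      intro b hb
      rcases Finset.mem_insert.1 hb with rfl | hb
      · exact h
      · exact h.trans (ha b hb)
    · subst h
      refine ⟨1, Or.inl rfl, ?_⟩
      have h2 : symmDiff {i} (insert i M) = M := by
        ext x; simp only [Finset.mem_symmDiff, Finset.mem_singleton, Finset.mem_insert]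
        by_cases hx : x = i
        · subst hx; simp [haM]
        · simp [hx]
      rw [h2, genProd_insert_of_lt w ha, ← mul_assoc, gen_mul_self, ← Algebra.smul_def]
      simp
    · obtain ⟨ε, hε, h1⟩ := ih
      refine ⟨-ε, by rcases hε with rfl | rfl <;> simp, ?_⟩
      have h2 : symmDiff {i} (insert a M) = insert a (symmDiff {i} M) := by
        ext x; simp only [Finset.mem_symmDiff, Finset.mem_singleton, Finset.mem_insert]
        by_cases hx : x = i
        · subst hx; simp [h.ne']
        · simp [hx]
      have h3 : i ∈ insert a M ↔ i ∈ M := by simp [h.ne']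
      rw [h2, genProd_insert_of_lt w ha, genProd_insert_of_lt w (a := a), ← mul_assoc,
        gen_mul_gen _ h.ne', neg_mul, mul_assoc, h1, mul_smul_comm, ← neg_smul, neg_mul]
      · simp only [h3]
      · intro b hb
        rcases Finset.mem_symmDiff.1 hb with ⟨hb, -⟩ | ⟨hb, -⟩
        · rw [Finset.mem_singleton.1 hb]; exact h
        · exact ha b hb

/-- Up to scalars the Clifford algebra is a group algebra of the subsets under symmetric difference;
each common generator contributes its weight. -/
theorem genProd_mul_genProd_symmDiff (M N : Finset (Fin (n + 1))) :
    ∃ ε : ℝ, (ε = 1 ∨ ε = -1) ∧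
      genProd w M * genProd w N = (ε * wprod w (M ∩ N)) • genProd w (symmDiff M N) := by
  induction M using Finset.induction_on_min with
  | empty =>
    refine ⟨1, Or.inl rfl, ?_⟩
    rw [show symmDiff ∅ N = N from bot_symmDiff N]
    simp [genProd_empty, wprod]
  | insert a M ha ih =>
    have haM : a ∉ M := fun h' => lt_irrefl _ (ha a h')
    obtain ⟨ε, hε, h1⟩ := ih
    obtain ⟨δ, hδ, h2⟩ := gen_mul_genProd_symmDiff w a (symmDiff M N)
    refine ⟨ε * δ, by rcases hε with rfl | rfl <;> rcases hδ with rfl | rfl <;> simp, ?_⟩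
    have h3 : symmDiff (insert a M) N = symmDiff {a} (symmDiff M N) := by
      rw [← symmDiff_assoc]
      congr 1
      ext x; simp only [Finset.mem_symmDiff, Finset.mem_singleton, Finset.mem_insert]
      by_cases hx : x = a
      · subst hx; simp [haM]
      · simp [hx]
    have h4 : a ∈ symmDiff M N ↔ a ∈ N := by simp [Finset.mem_symmDiff, haM]
    have h5 : wprod w (insert a M ∩ N) = (if a ∈ N then w a else 1) * wprod w (M ∩ N) := by
      by_cases h : a ∈ N
      · rw [Finset.insert_inter_of_mem h, wprod, Finset.prod_insert (by simp [haM]), if_pos h,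
          wprod]
      · rw [Finset.insert_inter_of_notMem h, if_neg h, one_mul]
    rw [genProd_insert_of_lt w ha, mul_assoc, h1, mul_smul_comm, h2, smul_smul, h3, h5]
    simp only [h4]
    congr 1
    ring

/-- The word and its reverse cancel from the middle outwards, so no sign appears. -/
theorem genProd_mul_reverse (M : Finset (Fin (n + 1))) :
    genProd w M * CliffordAlgebra.reverse (genProd w M) = algebraMap ℝ _ (wprod w M) := by
  induction M using Finset.induction_on_min with
  | empty => simp [genProd_empty, wprod]
  | insert a M ha ih =>
    have haM : a ∉ M := fun h' => lt_irrefl _ (ha a h')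
    have hr : CliffordAlgebra.reverse (gen w a) = gen w a := CliffordAlgebra.reverse_ι _
    rw [genProd_insert_of_lt w ha, CliffordAlgebra.reverse.map_mul, hr, mul_assoc,
      ← mul_assoc (genProd w M), ih, Algebra.commutes, ← mul_assoc, gen_mul_self, ← map_mul,
      wprod, wprod, Finset.prod_insert haM]

theorem reverse_mul_genProd (M : Finset (Fin (n + 1))) :
    CliffordAlgebra.reverse (genProd w M) * genProd w M = algebraMap ℝ _ (wprod w M) := by
  induction M using Finset.induction_on_min with
  | empty => simp [genProd_empty, wprod]
  | insert a M ha ih =>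
    have haM : a ∉ M := fun h' => lt_irrefl _ (ha a h')
    have hr : CliffordAlgebra.reverse (gen w a) = gen w a := CliffordAlgebra.reverse_ι _
    rw [genProd_insert_of_lt w ha, CliffordAlgebra.reverse.map_mul, hr, mul_assoc,
      ← mul_assoc (gen w a), gen_mul_self, ← mul_assoc, ← Algebra.commutes, mul_assoc, ih,
      ← map_mul, wprod, wprod, Finset.prod_insert haM]

/-- The sign is read off from the square of `e_M`: both `e_M e_M` and `e_M* e_M` are scalars equal
to the product of the weights up to sign, and that product can be cancelled. -/
theorem reverse_genProd_eq {w : Fin (n + 1) → ℝ} (hw : ∀ i, w i ≠ 0)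
    (M : Finset (Fin (n + 1))) :
    ∃ ε : ℝ, (ε = 1 ∨ ε = -1) ∧ CliffordAlgebra.reverse (genProd w M) = ε • genProd w M := by
  obtain ⟨ε, hε, h⟩ := genProd_mul_genProd_symmDiff w M M
  refine ⟨ε, hε, ?_⟩
  have h1 : CliffordAlgebra.reverse (genProd w M) * (genProd w M * genProd w M)
      = algebraMap ℝ _ (wprod w M) * genProd w M := by
    rw [← mul_assoc, reverse_mul_genProd]
  rw [h, Finset.inter_self, symmDiff_self, Finset.bot_eq_empty, genProd_empty, mul_smul_comm,
    mul_one, ← Algebra.smul_def, mul_smul, smul_comm] at h1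
  have h2 := smul_right_injective _ (wprod_ne_zero hw M) h1
  have h3 : ε * ε = 1 := by rcases hε with rfl | rfl <;> norm_num
  conv_rhs => rw [← h2, smul_smul, h3, one_smul]

/-- The real part as a linear map. -/
def realPartLin : Cl w →ₗ[ℝ] ℝ :=
  (ExteriorAlgebra.algebraMapInv).toLinearMap ∘ₗ
    (CliffordAlgebra.equivExterior (form w)).toLinearMap

theorem realPartLin_apply (c : Cl w) : realPartLin w c = realPart w c := rfl

theorem realPart_one : realPart w 1 = 1 := by
  have := realPart_algebraMap w 1
  rwa [map_one] at this

/-- The span contains `1` and is stable under left multiplication by vectors, which generate the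
algebra. -/
theorem span_genProd : Submodule.span ℝ (Set.range (genProd w)) = ⊤ := by
  set S := Submodule.span ℝ (Set.range (genProd w)) with hS
  have hvec : ∀ v, ∀ x ∈ S, vec w v * x ∈ S := by
    intro v x hx
    have hv : vec w v = ∑ i, v i • gen w i := by
      conv_lhs => rw [← Finset.univ_sum_single v]
      rw [map_sum]
      refine Finset.sum_congr rfl fun i _ => ?_
      rw [gen, ← map_smul, ← Pi.single_smul, smul_eq_mul, mul_one]
    rw [hv, Finset.sum_mul]
    refine Submodule.sum_mem _ fun i _ => ?_
    rw [smul_mul_assoc]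
    refine S.smul_mem _ ?_
    induction hx using Submodule.span_induction with
    | mem x h =>
      obtain ⟨M, rfl⟩ := h
      obtain ⟨ε, -, h⟩ := gen_mul_genProd_symmDiff w i M
      rw [h]
      exact S.smul_mem _ (Submodule.subset_span ⟨_, rfl⟩)
    | zero => simp
    | add x y _ _ hx hy => rw [mul_add]; exact add_mem hx hy
    | smul a x _ hx => rw [mul_smul_comm]; exact S.smul_mem _ hx
  have hone : (1 : Cl w) ∈ S := Submodule.subset_span ⟨∅, genProd_empty w⟩
  rw [eq_top_iff]
  intro c _
  have key : ∀ c : Cl w, ∀ x ∈ S, c * x ∈ S := by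
    intro c
    induction c using CliffordAlgebra.induction with
    | algebraMap r => intro x hx; rw [← Algebra.smul_def]; exact S.smul_mem _ hx
    | ι v => exact hvec v
    | mul a b ha hb => intro x hx; rw [mul_assoc]; exact ha _ (hb _ hx)
    | add a b ha hb => intro x hx; rw [add_mul]; exact add_mem (ha _ hx) (hb _ hx)
  simpa using key c 1 hone

/-- The coefficient of an element of the Clifford algebra at the basis element `e_M`. -/
def coef (M : Finset (Fin (n + 1))) : Cl w →ₗ[ℝ] ℝ :=
  (wprod w M)⁻¹ • (realPartLin w ∘ₗ LinearMap.mulRight ℝ (CliffordAlgebra.reverse (genProd w M)))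

theorem coef_apply (M : Finset (Fin (n + 1))) (c : Cl w) :
    coef w M c = (wprod w M)⁻¹ * realPart w (c * CliffordAlgebra.reverse (genProd w M)) := rfl

/-- The product is a multiple of the basis element indexed by the symmetric difference, which has
real part zero unless the two sets coincide. This orthogonality makes `coef` the dual family of the
`e_M`. -/
theorem realPart_genProd_mul_reverse {w : Fin (n + 1) → ℝ} (hw : ∀ i, w i ≠ 0)
    (N M : Finset (Fin (n + 1))) :
    realPart w (genProd w N * CliffordAlgebra.reverse (genProd w M))
      = if N = M then wprod w M else 0 := by
  split_ifs with h
  · rw [h, genProd_mul_reverse, realPart_algebraMap]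
  · obtain ⟨ε, -, h1⟩ := reverse_genProd_eq hw M
    obtain ⟨δ, -, h2⟩ := genProd_mul_genProd_symmDiff w N M
    rw [h1, mul_smul_comm, h2, ← realPartLin_apply, map_smul, map_smul, realPartLin_apply,
      realPart_genProd]
    · simp
    · rw [Finset.nonempty_iff_ne_empty]
      exact fun h' => h (symmDiff_eq_bot.1 h')

theorem coef_genProd {w : Fin (n + 1) → ℝ} (hw : ∀ i, w i ≠ 0) (M N : Finset (Fin (n + 1))) :
    coef w M (genProd w N) = if N = M then 1 else 0 := by
  rw [coef_apply, realPart_genProd_mul_reverse hw]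
  split_ifs
  · exact inv_mul_cancel₀ (wprod_ne_zero hw M)
  · simp

theorem coef_empty (c : Cl w) : coef w ∅ c = realPart w c := by
  simp [coef_apply, wprod, genProd_empty]

theorem sum_coef_smul {w : Fin (n + 1) → ℝ} (hw : ∀ i, w i ≠ 0) (c : Cl w) :
    ∑ M, coef w M c • genProd w M = c := by
  have : c ∈ Submodule.span ℝ (Set.range (genProd w)) := by rw [span_genProd]; trivial
  induction this using Submodule.span_induction with
  | mem x h =>
    obtain ⟨N, rfl⟩ := h
    simp [coef_genProd hw]
  | zero => simp
  | add x y _ _ hx hy =>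
    conv_rhs => rw [← hx, ← hy]
    rw [← Finset.sum_add_distrib]
    exact Finset.sum_congr rfl fun M _ => by rw [map_add, add_smul]
  | smul a x _ hx =>
    conv_rhs => rw [← hx]
    rw [Finset.smul_sum]
    exact Finset.sum_congr rfl fun M _ => by rw [map_smul, smul_eq_mul, mul_smul]

theorem ext_coef {w : Fin (n + 1) → ℝ} (hw : ∀ i, w i ≠ 0) {c d : Cl w}
    (h : ∀ M, coef w M c = coef w M d) : c = d := by
  rw [← sum_coef_smul hw c, ← sum_coef_smul hw d]
  exact Finset.sum_congr rfl fun M _ => by rw [h]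

theorem coef_sum_smul {w : Fin (n + 1) → ℝ} (hw : ∀ i, w i ≠ 0)
    (s : Finset (Finset (Fin (n + 1)))) (a : Finset (Fin (n + 1)) → ℝ)
    (M : Finset (Fin (n + 1))) :
    coef w M (∑ N ∈ s, a N • genProd w N) = if M ∈ s then a M else 0 := by
  simp [map_sum, coef_genProd hw]

/-- The trace form is diagonal in the basis `e_M`. Applied to `a = b = s` it is the source of the
norm equation of the spin group. -/
theorem realPart_mul_reverse {w : Fin (n + 1) → ℝ} (hw : ∀ i, w i ≠ 0) (a b : Cl w) :
    realPart w (a * CliffordAlgebra.reverse b) = ∑ M, coef w M a * coef w M b * wprod w M := by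
  conv_lhs => rw [← sum_coef_smul hw a, ← sum_coef_smul hw b]
  rw [map_sum, Finset.sum_mul_sum, ← realPartLin_apply, map_sum]
  refine Finset.sum_congr rfl fun M _ => ?_
  rw [map_sum, Finset.sum_eq_single M]
  · rw [map_smul, smul_mul_smul_comm, map_smul, realPartLin_apply,
      realPart_genProd_mul_reverse hw, if_pos rfl, smul_eq_mul]
  · intro N _ h
    rw [map_smul, smul_mul_smul_comm, map_smul, realPartLin_apply,
      realPart_genProd_mul_reverse hw, if_neg h.symm, smul_zero]
  · simp

theorem realPart_reverse {w : Fin (n + 1) → ℝ} (hw : ∀ i, w i ≠ 0) (a : Cl w) :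
    realPart w (CliffordAlgebra.reverse a) = realPart w a := by
  have h := realPart_mul_reverse hw 1 a
  have h' := realPart_mul_reverse hw a 1
  rw [one_mul] at h
  rw [CliffordAlgebra.reverse.map_one, mul_one] at h'
  rw [h, h']
  exact Finset.sum_congr rfl fun M _ => by ring

/-- Only products of equal basis elements have a real part, and these commute. This trace property
makes the real part a conjugation invariant. -/
theorem realPart_mul_comm {w : Fin (n + 1) → ℝ} (hw : ∀ i, w i ≠ 0) (a b : Cl w) :
    realPart w (a * b) = realPart w (b * a) := by
  have key : ∀ M N, realPart w (genProd w M * genProd w N)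
      = realPart w (genProd w N * genProd w M) := by
    intro M N
    by_cases h : M = N
    · rw [h]
    · obtain ⟨ε, -, h1⟩ := genProd_mul_genProd_symmDiff w M N
      obtain ⟨δ, -, h2⟩ := genProd_mul_genProd_symmDiff w N M
      have h3 : (symmDiff M N).Nonempty := by
        rw [Finset.nonempty_iff_ne_empty]
        exact fun h' => h (symmDiff_eq_bot.1 h')
      rw [h1, h2, symmDiff_comm N M, ← realPartLin_apply, map_smul, ← realPartLin_apply, map_smul,
        realPartLin_apply, realPart_genProd _ _ h3]
      simp
  conv_lhs => rw [← sum_coef_smul hw a, ← sum_coef_smul hw b]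
  conv_rhs => rw [← sum_coef_smul hw a, ← sum_coef_smul hw b]
  rw [Finset.sum_mul_sum, Finset.sum_mul_sum, Finset.sum_comm]
  rw [← realPartLin_apply, ← realPartLin_apply, map_sum, map_sum]
  refine Finset.sum_congr rfl fun N _ => ?_
  rw [map_sum, map_sum]
  refine Finset.sum_congr rfl fun M _ => ?_
  rw [smul_mul_smul_comm, smul_mul_smul_comm, map_smul, map_smul, realPartLin_apply,
    realPartLin_apply, key, mul_comm]

theorem genProd_mem_even {M : Finset (Fin (n + 1))} (hM : Even M.card) :
    genProd w M ∈ CliffordAlgebra.evenOdd (form w) 0 := by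
  have : ∀ M : Finset (Fin (n + 1)),
      genProd w M ∈ CliffordAlgebra.evenOdd (form w) (M.card : ZMod 2) := by
    intro M
    induction M using Finset.induction_on_min with
    | empty =>
      rw [genProd_empty]
      exact CliffordAlgebra.one_le_evenOdd_zero _ (Submodule.one_le.mp le_rfl)
    | insert a M ha ih =>
      have haM : a ∉ M := fun h' => lt_irrefl _ (ha a h')
      rw [genProd_insert_of_lt w ha, Finset.card_insert_of_notMem haM, Nat.cast_succ]
      have := CliffordAlgebra.evenOdd_mul_le _ _ _
        (Submodule.mul_mem_mul (CliffordAlgebra.ι_mem_evenOdd_one (form w) (Pi.single a 1)) ih)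
      rwa [add_comm (1 : ZMod 2)] at this
  have h := this M
  rwa [(ZMod.natCast_eq_zero_iff_even).2 hM] at h

theorem vec_eq_sum (v : Fin (n + 1) → ℝ) : vec w v = ∑ i, v i • gen w i := by
  conv_lhs => rw [← Finset.univ_sum_single v]
  rw [map_sum]
  refine Finset.sum_congr rfl fun i _ => ?_
  rw [gen, ← map_smul, ← Pi.single_smul, smul_eq_mul, mul_one]

theorem card_symmDiff_add (M N : Finset (Fin (n + 1))) :
    (symmDiff M N).card + 2 * (M ∩ N).card = M.card + N.card := by
  have h1 := Finset.card_sdiff_add_card_inter M N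
  have h2 := Finset.card_sdiff_add_card_inter N M
  have h3 : (symmDiff M N).card = (M \ N).card + (N \ M).card :=
    Finset.card_union_of_disjoint disjoint_sdiff_sdiff
  rw [Finset.inter_comm N M] at h2
  omega

/-- Translates the parity grading into coordinates, so that coefficient formulas can both use and
prove evenness. -/
theorem mem_even_iff {w : Fin (n + 1) → ℝ} (hw : ∀ i, w i ≠ 0) (c : Cl w) :
    c ∈ CliffordAlgebra.evenOdd (form w) 0 ↔ ∀ M, ¬ Even M.card → coef w M c = 0 := by
  constructor
  · intro hc
    set S : Submodule ℝ (Cl w) := Submodule.span ℝ {c | ∃ M, Even M.card ∧ c = genProd w M} with hS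
    have hgen : ∀ i j, ∀ x ∈ S, gen w i * (gen w j * x) ∈ S := by
      intro i j x hx
      induction hx using Submodule.span_induction with
      | mem x h =>
        obtain ⟨M, hM, rfl⟩ := h
        obtain ⟨ε, -, h1⟩ := gen_mul_genProd_symmDiff w j M
        obtain ⟨δ, -, h2⟩ := gen_mul_genProd_symmDiff w i (symmDiff {j} M)
        rw [h1, mul_smul_comm, h2]
        refine S.smul_mem _ (S.smul_mem _ (Submodule.subset_span ⟨_, ?_, rfl⟩))
        have e1 := card_symmDiff_add {j} M
        have e2 := card_symmDiff_add {i} (symmDiff {j} M)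
        rw [Finset.card_singleton] at e1 e2
        rw [Nat.even_iff] at hM ⊢
        omega
      | zero => simp
      | add x y _ _ hx hy => rw [mul_add, mul_add]; exact add_mem hx hy
      | smul a x _ hx => rw [mul_smul_comm, mul_smul_comm]; exact S.smul_mem _ hx
    have hcS : c ∈ S := by
      induction c, hc using CliffordAlgebra.even_induction with
      | algebraMap r =>
        rw [Algebra.algebraMap_eq_smul_one]
        exact S.smul_mem _ (Submodule.subset_span ⟨∅, by simp, (genProd_empty w).symm⟩)
      | add x y hx hy ihx ihy => exact add_mem ihx ihy
      | ι_mul_ι_mul m₁ m₂ x hx ih =>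
        change vec w m₁ * vec w m₂ * x ∈ S
        rw [mul_assoc, vec_eq_sum w m₁, vec_eq_sum w m₂, Finset.sum_mul]
        refine Submodule.sum_mem _ fun i _ => ?_
        rw [Finset.sum_mul, Finset.mul_sum]
        refine Submodule.sum_mem _ fun j _ => ?_
        rw [smul_mul_assoc, smul_mul_assoc, mul_smul_comm]
        exact S.smul_mem _ (S.smul_mem _ (hgen i j x ih))
    intro M hM
    clear hc
    induction hcS using Submodule.span_induction with
    | mem x h =>
      obtain ⟨N, hN, rfl⟩ := h
      rw [coef_genProd hw, if_neg]
      rintro rfl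
      exact hM hN
    | zero => simp
    | add x y _ _ hx hy =>
      rw [map_add]
      rw [hx, hy, add_zero]
    | smul a x _ hx =>
      rw [map_smul]
      rw [hx, smul_zero]
  · intro h
    rw [← sum_coef_smul hw c]
    refine Submodule.sum_mem _ fun M _ => ?_
    by_cases hM : Even M.card
    · exact Submodule.smul_mem _ _ (genProd_mem_even w hM)
    · rw [h M hM, zero_smul]; exact zero_mem _

theorem coef_eq_zero_of_even {w : Fin (n + 1) → ℝ} (hw : ∀ i, w i ≠ 0) {c : Cl w}
    (hc : c ∈ CliffordAlgebra.evenOdd (form w) 0) {M : Finset (Fin (n + 1))}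
    (hM : ¬ Even M.card) : coef w M c = 0 := (mem_even_iff hw c).1 hc M hM

/-- Each generator of `M` other than `e_i` gives one sign; the count `|M| + [i ∈ M]` has the parity
of `|M| - [i ∈ M]` and avoids the subtraction. -/
theorem gen_mul_genProd_comm (M : Finset (Fin (n + 1))) (i : Fin (n + 1)) :
    gen w i * genProd w M = ((-1 : ℝ) ^ (M.card + if i ∈ M then 1 else 0)) •
      (genProd w M * gen w i) := by
  induction M using Finset.induction_on_min with
  | empty => simp [genProd_empty]
  | insert a M ha ih =>
    have haM : a ∉ M := fun h' => lt_irrefl _ (ha a h')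
    rw [genProd_insert_of_lt w ha, Finset.card_insert_of_notMem haM]
    by_cases h : i = a
    · subst h
      rw [if_neg haM, add_zero] at ih
      rw [if_pos (Finset.mem_insert_self _ _), mul_assoc, ih, mul_smul_comm]
      simp [pow_succ]
    · have : i ∈ insert a M ↔ i ∈ M := by simp [h]
      simp only [this]
      rw [← mul_assoc, gen_mul_gen w h, neg_mul, mul_assoc, ih, mul_smul_comm, ← mul_assoc,
        ← neg_smul]
      congr 1
      ring

end Coordinates

/-! ### Lorentzian geometry -/

section Lorentz

variable {n : ℕ} {w : Fin (n + 1) → ℝ}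

/-- The diagonal form with weights `w` has signature `(n, 1)`, the negative weight being `w 0`. -/
def IsLorentz (w : Fin (n + 1) → ℝ) : Prop := w 0 < 0 ∧ ∀ i, i ≠ 0 → 0 < w i

theorem IsLorentz.ne_zero (h : IsLorentz w) (i : Fin (n + 1)) : w i ≠ 0 := by
  by_cases hi : i = 0
  · rw [hi]; exact h.1.ne
  · exact (h.2 i hi).ne'

theorem bil_comm (x y : Fin (n + 1) → ℝ) : bil w x y = bil w y x :=
  Finset.sum_congr rfl fun i _ => by ring

theorem bil_add_left (x y z : Fin (n + 1) → ℝ) : bil w (x + y) z = bil w x z + bil w y z := by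
  simp only [bil, ← Finset.sum_add_distrib, Pi.add_apply]
  exact Finset.sum_congr rfl fun i _ => by ring

theorem bil_smul_left (a : ℝ) (x z : Fin (n + 1) → ℝ) : bil w (a • x) z = a * bil w x z := by
  simp only [bil, Finset.mul_sum, Pi.smul_apply, smul_eq_mul]
  exact Finset.sum_congr rfl fun i _ => by ring

theorem bil_add_right (x y z : Fin (n + 1) → ℝ) : bil w z (x + y) = bil w z x + bil w z y := by
  rw [bil_comm, bil_add_left, bil_comm x, bil_comm y]

theorem bil_smul_right (a : ℝ) (x z : Fin (n + 1) → ℝ) : bil w z (a • x) = a * bil w z x := by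
  rw [bil_comm, bil_smul_left, bil_comm]

theorem bil_neg_left (x z : Fin (n + 1) → ℝ) : bil w (-x) z = - bil w x z := by
  have := bil_smul_left (w := w) (-1) x z
  rwa [neg_one_smul, neg_one_mul] at this

theorem bil_neg_right (x z : Fin (n + 1) → ℝ) : bil w z (-x) = - bil w z x := by
  rw [bil_comm, bil_neg_left, bil_comm]

theorem bil_sub_left (x y z : Fin (n + 1) → ℝ) : bil w (x - y) z = bil w x z - bil w y z := by
  rw [sub_eq_add_neg, bil_add_left, bil_neg_left, ← sub_eq_add_neg]

theorem bil_sub_right (x y z : Fin (n + 1) → ℝ) : bil w z (x - y) = bil w z x - bil w z y := by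
  rw [bil_comm, bil_sub_left, bil_comm x, bil_comm y]

theorem bil_succ (x y : Fin (n + 1) → ℝ) :
    bil w x y = w 0 * x 0 * y 0 + ∑ i : Fin n, w i.succ * x i.succ * y i.succ := by
  rw [bil, Fin.sum_univ_succ]

theorem sum_succ_nonneg (h : IsLorentz w) (x : Fin (n + 1) → ℝ) :
    0 ≤ ∑ i : Fin n, w i.succ * x i.succ * x i.succ :=
  Finset.sum_nonneg fun i _ => by
    rw [mul_assoc]; exact mul_nonneg (h.2 _ (Fin.succ_ne_zero i)).le (mul_self_nonneg _)

theorem sum_succ_cauchy (h : IsLorentz w) (x y : Fin (n + 1) → ℝ) :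
    (∑ i : Fin n, w i.succ * x i.succ * y i.succ) ^ 2
      ≤ (∑ i : Fin n, w i.succ * x i.succ * x i.succ) *
        ∑ i : Fin n, w i.succ * y i.succ * y i.succ := by
  have := Finset.sum_mul_sq_le_sq_mul_sq Finset.univ
    (fun i : Fin n => √(w i.succ) * x i.succ) (fun i : Fin n => √(w i.succ) * y i.succ)
  have hs : ∀ i : Fin n, √(w i.succ) * √(w i.succ) = w i.succ := fun i =>
    Real.mul_self_sqrt (h.2 _ (Fin.succ_ne_zero i)).le
  refine le_of_eq_of_le ?_ (this.trans_eq ?_)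
  · congr 1
    refine Finset.sum_congr rfl fun i _ => ?_
    linear_combination -(x i.succ * y i.succ) * hs i
  · congr 1 <;> refine Finset.sum_congr rfl fun i _ => ?_ <;>
    · rw [mul_pow, Real.sq_sqrt (h.2 _ (Fin.succ_ne_zero i)).le]; ring

/-- In signature `(n, 1)` the complement of a negative vector is positive: if both vectors were
negative, their zeroth terms would outweigh the Cauchy–Schwarz bound on the remaining ones. -/
theorem form_nonneg_of_orthogonal (h : IsLorentz w) {u y : Fin (n + 1) → ℝ} (hy : form w y < 0)
    (huy : bil w u y = 0) : 0 ≤ form w u := by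
  rw [form_eq_bil, bil_succ] at hy ⊢
  rw [bil_succ] at huy
  have h1 := sum_succ_cauchy h u y
  have h2 := sum_succ_nonneg h u
  have h3 := sum_succ_nonneg h y
  set a := ∑ i : Fin n, w i.succ * u i.succ * u i.succ
  set b := ∑ i : Fin n, w i.succ * y i.succ * y i.succ
  set c := ∑ i : Fin n, w i.succ * u i.succ * y i.succ
  have h0 := h.1
  have hc : c = - (w 0 * u 0 * y 0) := by linarith
  rw [hc] at h1
  by_contra hcon
  push Not at hcon
  have e1 : 0 ≤ a ∧ a < -(w 0) * u 0 ^ 2 := ⟨h2, by nlinarith⟩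
  have e2 : 0 ≤ b ∧ b < -(w 0) * y 0 ^ 2 := ⟨h3, by nlinarith⟩
  have e3 : a * b < (-(w 0) * u 0 ^ 2) * (-(w 0) * y 0 ^ 2) :=
    mul_lt_mul'' e1.2 e2.2 e1.1 e2.1
  nlinarith

/-- The reversed Cauchy–Schwarz inequality, from positivity on the component of `u` orthogonal to
`y`. -/
theorem form_mul_form_le_bil_sq (h : IsLorentz w) {u y : Fin (n + 1) → ℝ} (hy : form w y = -1) :
    -form w u ≤ bil w u y ^ 2 := by
  have h1 : bil w (u + bil w u y • y) y = 0 := by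
    rw [bil_add_left, bil_smul_left, ← form_eq_bil, hy]; ring
  have h2 := form_nonneg_of_orthogonal h (by rw [hy]; norm_num) h1
  rw [form_eq_bil, bil_add_left, bil_smul_left, bil_add_right, bil_smul_right, bil_add_right,
    bil_smul_right, bil_comm y u, ← form_eq_bil, ← form_eq_bil, hy] at h2
  nlinarith

/-- Ordinary Cauchy–Schwarz on the semidefinite complement of `y`, through the discriminant of `t ↦
f(u + t v)`. -/
theorem bil_sq_le_of_orthogonal (h : IsLorentz w) {u v y : Fin (n + 1) → ℝ}
    (hy : form w y < 0) (hu : bil w u y = 0) (hv : bil w v y = 0) :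
    bil w u v ^ 2 ≤ form w u * form w v := by
  have h1 : ∀ t : ℝ, 0 ≤ form w v * (t * t) + (2 * bil w u v) * t + form w u := by
    intro t
    have h2 : bil w (u + t • v) y = 0 := by rw [bil_add_left, bil_smul_left, hu, hv]; simp
    have h3 := form_nonneg_of_orthogonal h hy h2
    rw [form_eq_bil, bil_add_left, bil_smul_left, bil_add_right, bil_smul_right, bil_add_right,
      bil_smul_right, bil_comm v u, ← form_eq_bil, ← form_eq_bil] at h3
    linarith
  have h2 := discrim_le_zero h1
  rw [discrim] at h2
  nlinarith

/-- A multiplicative form of the triangle inequality, valid on both sheets of the hyperboloid. -/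
theorem abs_bil_le (h : IsLorentz w) {x y z : Fin (n + 1) → ℝ} (hx : form w x = -1)
    (hy : form w y = -1) (hz : form w z = -1) :
    |bil w x z| ≤ 2 * |bil w x y| * |bil w y z| := by
  have hu : bil w (x + bil w x y • y) y = 0 := by
    rw [bil_add_left, bil_smul_left, ← form_eq_bil, hy]; ring
  have hv : bil w (z + bil w z y • y) y = 0 := by
    rw [bil_add_left, bil_smul_left, ← form_eq_bil, hy]; ring
  -- Cauchy–Schwarz for the components of `x` and `z` orthogonal to `y`; on one sheet this amounts
  -- to `cosh (a + b) ≤ 2 cosh a cosh b`.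
  have h1 := bil_sq_le_of_orthogonal h (by rw [hy]; norm_num) hu hv
  have fu : form w (x + bil w x y • y) = bil w x y ^ 2 - 1 := by
    rw [form_eq_bil, bil_add_left, bil_smul_left, bil_add_right, bil_smul_right, bil_add_right,
      bil_smul_right, bil_comm y x, ← form_eq_bil, ← form_eq_bil, hy, hx]; ring
  have fv : form w (z + bil w z y • y) = bil w z y ^ 2 - 1 := by
    rw [form_eq_bil, bil_add_left, bil_smul_left, bil_add_right, bil_smul_right, bil_add_right,
      bil_smul_right, bil_comm y z, ← form_eq_bil, ← form_eq_bil, hy, hz]; ring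
  have fuv : bil w (x + bil w x y • y) (z + bil w z y • y)
      = bil w x z + bil w x y * bil w z y := by
    rw [bil_add_left, bil_smul_left, bil_add_right, bil_smul_right, bil_add_right,
      bil_smul_right, bil_comm y z, ← form_eq_bil, hy]; ring
  have hx1 := form_mul_form_le_bil_sq h (u := x) hy
  have hz1 := form_mul_form_le_bil_sq h (u := z) hy
  rw [hx] at hx1
  rw [hz] at hz1
  rw [fu, fv, fuv] at h1
  have h2 : |bil w x z + bil w x y * bil w z y| ≤ |bil w x y * bil w z y| := by
    rw [← sq_le_sq, mul_pow]
    refine h1.trans ?_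
    gcongr <;> linarith
  have h3 : |bil w x z| ≤ |bil w x z + bil w x y * bil w z y| + |bil w x y * bil w z y| := by
    have := abs_sub (bil w x z + bil w x y * bil w z y) (bil w x y * bil w z y)
    rwa [add_sub_cancel_right] at this
  rw [abs_mul] at h2 h3
  rw [bil_comm y z]
  linarith

/-- Two negative vectors in the same half of the cone: the zeroth term dominates the rest by
Cauchy–Schwarz and has the sign of `w 0`. -/
theorem bil_neg_of_pos (h : IsLorentz w) {x y : Fin (n + 1) → ℝ} (hx : form w x < 0)
    (hy : form w y < 0) (hx0 : 0 < x 0) (hy0 : 0 < y 0) : bil w x y < 0 := by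
  rw [form_eq_bil, bil_succ] at hx hy
  rw [bil_succ]
  have h1 := sum_succ_cauchy h x y
  have h2 := sum_succ_nonneg h x
  have h3 := sum_succ_nonneg h y
  set a := ∑ i : Fin n, w i.succ * x i.succ * x i.succ
  set b := ∑ i : Fin n, w i.succ * y i.succ * y i.succ
  set c := ∑ i : Fin n, w i.succ * x i.succ * y i.succ
  have h0 := h.1
  have e3 : a * b < (-(w 0) * x 0 ^ 2) * (-(w 0) * y 0 ^ 2) :=
    mul_lt_mul'' (by nlinarith) (by nlinarith) h2 h3
  have e4 : c ^ 2 < (-(w 0) * x 0 * y 0) ^ 2 := by nlinarith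
  have e5 : 0 ≤ -(w 0) * x 0 * y 0 := by
    have := mul_pos hx0 hy0
    nlinarith
  have := lt_of_pow_lt_pow_left₀ 2 e5 e4
  linarith

theorem zero_ne_of_form_neg (h : IsLorentz w) {x : Fin (n + 1) → ℝ} (hx : form w x < 0) :
    x 0 ≠ 0 := by
  intro h0
  rw [form_eq_bil, bil_succ, h0] at hx
  have := sum_succ_nonneg h x
  linarith

theorem eq_zero_of_form_nonpos (h : IsLorentz w) {x : Fin (n + 1) → ℝ} (hx : form w x ≤ 0)
    (h0 : x 0 = 0) : x = 0 := by
  rw [form_eq_bil, bil_succ, h0] at hx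
  have h1 : ∑ i : Fin n, w i.succ * x i.succ * x i.succ = 0 :=
    le_antisymm (by linarith) (sum_succ_nonneg h x)
  rw [Finset.sum_eq_zero_iff_of_nonneg fun i _ => by
    rw [mul_assoc]; exact mul_nonneg (h.2 _ (Fin.succ_ne_zero i)).le (mul_self_nonneg _)] at h1
  funext i
  refine Fin.cases h0 (fun j => ?_) i
  have h2 := h1 j (Finset.mem_univ j)
  have h3 := (h.2 _ (Fin.succ_ne_zero j)).ne'
  rw [mul_assoc] at h2
  simpa [h3] using h2

theorem bil_le_neg_one (h : IsLorentz w) {x y : Fin (n + 1) → ℝ} (hx : form w x = -1)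
    (hy : form w y = -1) (hx0 : 0 < x 0) (hy0 : 0 < y 0) : bil w x y ≤ -1 := by
  have h1 := bil_neg_of_pos h (by rw [hx]; norm_num) (by rw [hy]; norm_num) hx0 hy0
  have h2 := form_mul_form_le_bil_sq h (u := x) hy
  rw [hx] at h2
  nlinarith

theorem one_le_neg_bil (h : IsLorentz w) (x y : Hyp w) : 1 ≤ -bil w x.1 y.1 := by
  have := bil_le_neg_one h x.2.1 y.2.1 x.2.2 y.2.2
  linarith

/-! ### The action of the spin group on hyperbolic space -/

theorem reverse_mul_val (s : SpinGrp w) : CliffordAlgebra.reverse s.val * s.val = 1 := by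
  rw [← SpinGrp.val_inv, ← SpinGrp.val_mul, inv_mul_cancel, SpinGrp.val_one]

theorem val_mul_reverse (s : SpinGrp w) : s.val * CliffordAlgebra.reverse s.val = 1 :=
  s.isSpin.2.2

theorem SpinGrp.val_injective : Function.Injective (SpinGrp.val (w := w)) :=
  fun _ _ h => Subtype.ext (Units.ext h)

theorem vec_mul_self (x : Fin (n + 1) → ℝ) :
    vec w x * vec w x = algebraMap ℝ _ (form w x) := CliffordAlgebra.ι_sq_scalar _ _

theorem vec_mul_add_swap (x y : Fin (n + 1) → ℝ) :
    vec w x * vec w y + vec w y * vec w x = algebraMap ℝ _ (2 * bil w x y) := by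
  rw [CliffordAlgebra.ι_mul_ι_add_swap]
  congr 1
  simp only [QuadraticMap.polar]
  rw [form_eq_bil, form_eq_bil, form_eq_bil, bil_add_left, bil_add_right, bil_add_right,
    bil_comm y x]
  ring

theorem realPart_vec_mul_vec (hw : ∀ i, w i ≠ 0) (x y : Fin (n + 1) → ℝ) :
    realPart w (vec w x * vec w y) = bil w x y := by
  have h1 := congrArg (realPartLin w) (vec_mul_add_swap (w := w) x y)
  rw [map_add, realPartLin_apply, realPartLin_apply, realPartLin_apply, realPart_algebraMap,
    realPart_mul_comm hw (vec w y)] at h1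
  linarith

theorem algebraMap_cl_injective : Function.Injective (algebraMap ℝ (Cl w)) := fun a b h => by
  rw [← realPart_algebraMap w a, h, realPart_algebraMap]

theorem form_act (s : SpinGrp w) (x : Fin (n + 1) → ℝ) : form w (act s x) = form w x := by
  apply algebraMap_cl_injective (w := w)
  rw [← vec_mul_self, vec_act, ← vec_mul_self]
  calc _ = s.val * vec w x * (CliffordAlgebra.reverse s.val * s.val) * vec w x *
        CliffordAlgebra.reverse s.val := by simp only [mul_assoc]
    _ = s.val * (vec w x * vec w x) * CliffordAlgebra.reverse s.val := by
        rw [reverse_mul_val, mul_one]; simp only [mul_assoc]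
    _ = _ := by
        rw [vec_mul_self, ← Algebra.commutes, mul_assoc, val_mul_reverse, mul_one]

theorem bil_act (s : SpinGrp w) (x y : Fin (n + 1) → ℝ) :
    bil w (act s x) (act s y) = bil w x y := by
  have h1 := form_act s (x + y)
  have h2 := form_act s x
  have h3 := form_act s y
  rw [map_add] at h1
  rw [form_eq_bil, form_eq_bil] at h1 h2 h3
  rw [bil_add_left, bil_add_right, bil_add_right, bil_add_left, bil_add_right, bil_add_right,
    bil_comm (act s y) (act s x), bil_comm y x] at h1
  linarith

/-- For even `M` conjugation by `e_0` changes the sign exactly when `0 ∈ M`, which is also when the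
product of the weights is negative. It therefore turns the indefinite trace form into a definite
one. -/
theorem genProd_conj_zero {M : Finset (Fin (n + 1))} (hM : Even M.card) :
    gen w 0 * genProd w M * gen w 0 = (if 0 ∈ M then -w 0 else w 0) • genProd w M := by
  rw [gen_mul_genProd_comm, pow_add, hM.neg_one_pow, one_mul, smul_mul_assoc, mul_assoc,
    gen_mul_self, ← Algebra.commutes, ← Algebra.smul_def, smul_smul]
  split_ifs <;> simp

theorem abs_wprod (h : IsLorentz w) (M : Finset (Fin (n + 1))) :
    |wprod w M| = if 0 ∈ M then - wprod w M else wprod w M := by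
  have h1 : ∀ N : Finset (Fin (n + 1)), 0 ∉ N → 0 < wprod w N := fun N hN =>
    Finset.prod_pos fun i hi => h.2 i (by rintro rfl; exact hN hi)
  split_ifs with h0
  · refine abs_of_neg ?_
    rw [wprod, ← Finset.insert_erase h0, Finset.prod_insert (Finset.notMem_erase _ _)]
    exact mul_neg_of_neg_of_pos h.1 (h1 _ (Finset.notMem_erase _ _))
  · exact abs_of_pos (h1 _ h0)

/-- The left side is the real part of `e_0 s e_0 s*`; the signs from the conjugation by `e_0`
replace each weight product by its absolute value. Displacement of the base point is thereby a
positive definite norm of `s`. -/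
theorem bil_single_zero_act (h : IsLorentz w) (s : SpinGrp w) :
    bil w (Pi.single 0 1) (act s (Pi.single 0 1)) = w 0 * ∑ M, coef w M s.val ^ 2 * |wprod w M| := by
  rw [← realPart_vec_mul_vec h.ne_zero, vec_act, ← mul_assoc]
  change realPart w (gen w 0 * (s.val * gen w 0) * _) = _
  rw [← mul_assoc (gen w 0), realPart_mul_reverse h.ne_zero, Finset.mul_sum]
  refine Finset.sum_congr rfl fun M _ => ?_
  have h1 : coef w M (gen w 0 * s.val * gen w 0)
      = coef w M s.val * (if 0 ∈ M then -w 0 else w 0) := by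
    conv_lhs => rw [← sum_coef_smul h.ne_zero s.val]
    rw [Finset.mul_sum, Finset.sum_mul, map_sum, Finset.sum_eq_single M]
    · by_cases hM : Even M.card
      · rw [mul_smul_comm, smul_mul_assoc, genProd_conj_zero hM, map_smul, map_smul,
          coef_genProd h.ne_zero, if_pos rfl, smul_eq_mul, smul_eq_mul, mul_one]
      · rw [coef_eq_zero_of_even h.ne_zero s.isSpin.1 hM]; simp
    · intro N _ hN
      by_cases hM : Even N.card
      · rw [mul_smul_comm, smul_mul_assoc, genProd_conj_zero hM, map_smul, map_smul,
          coef_genProd h.ne_zero, if_neg hN, smul_zero, smul_zero]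
      · rw [coef_eq_zero_of_even h.ne_zero s.isSpin.1 hM]; simp
    · simp
  rw [h1, abs_wprod h]
  split_ifs <;> ring

theorem sum_coef_sq (h : IsLorentz w) (s : SpinGrp w) :
    ∑ M, coef w M s.val ^ 2 * wprod w M = 1 := by
  have := realPart_mul_reverse h.ne_zero s.val s.val
  rw [val_mul_reverse, realPart_one] at this
  rw [this]
  exact Finset.sum_congr rfl fun M _ => by ring

/-- The point `e_0 / √|w_0|` of hyperbolic space. -/
def basePt (h : IsLorentz w) : Hyp w :=
  ⟨(√(-w 0))⁻¹ • Pi.single 0 1, by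
    have hp : 0 < -w 0 := by linarith [h.1]
    have h1 : form w (Pi.single 0 1) = w 0 := by
      rw [form_apply, Finset.sum_eq_single 0] <;> simp +contextual
    rw [QuadraticMap.map_smul, h1, ← mul_inv, Real.mul_self_sqrt hp.le, smul_eq_mul]
    have := h.1.ne
    field_simp, by
    have hp : 0 < -w 0 := by linarith [h.1]
    simpa using Real.sqrt_pos.2 hp⟩

theorem bil_basePt (h : IsLorentz w) (x : Fin (n + 1) → ℝ) :
    bil w (basePt h).1 x = -√(-w 0) * x 0 := by
  have hp : 0 < -w 0 := by linarith [h.1]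
  have hs := Real.mul_self_sqrt hp.le
  have hs0 := (Real.sqrt_pos.2 hp).ne'
  have h1 : bil w (Pi.single 0 1) x = w 0 * x 0 := by
    rw [bil, Finset.sum_eq_single 0] <;> simp +contextual
  rw [basePt, bil_smul_left, h1]
  field_simp
  rw [sq, hs]; ring

theorem neg_bil_basePt_act (h : IsLorentz w) (s : SpinGrp w) :
    -bil w (basePt h).1 (act s (basePt h).1) = ∑ M, coef w M s.val ^ 2 * |wprod w M| := by
  have hp : 0 < -w 0 := by linarith [h.1]
  have hs := Real.mul_self_sqrt hp.le
  have hs0 := (Real.sqrt_pos.2 hp).ne'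
  rw [basePt, map_smul, bil_smul_left, bil_smul_right, bil_single_zero_act h]
  field_simp
  rw [sq, hs, neg_mul]

/-- The positive sum for the displacement of the base point keeps that point on its sheet; any other
point follows because its product with the base point is preserved and negative. -/
theorem act_zero_pos (h : IsLorentz w) (s : SpinGrp w) {x : Fin (n + 1) → ℝ}
    (hx : form w x = -1) (hx0 : 0 < x 0) : 0 < act s x 0 := by
  have hb : 0 < act s (basePt h).1 0 := by
    have h1 := neg_bil_basePt_act h s
    rw [bil_basePt] at h1
    have h2 : 0 ≤ ∑ M, coef w M s.val ^ 2 * |wprod w M| :=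
      Finset.sum_nonneg fun M _ => mul_nonneg (sq_nonneg _) (abs_nonneg _)
    have hf : form w (act s (basePt h).1) < 0 := by
      rw [form_act, (basePt h).2.1]; norm_num
    have h3 := zero_ne_of_form_neg h hf
    have hp : 0 < √(-w 0) := Real.sqrt_pos.2 (by linarith [h.1])
    have h4 : 0 ≤ √(-w 0) * act s (basePt h).1 0 := by linarith
    exact lt_of_le_of_ne (nonneg_of_mul_nonneg_right h4 hp) h3.symm
  have hf : form w (act s x) < 0 := by rw [form_act, hx]; norm_num
  by_contra hcon
  have h1 : act s x 0 < 0 := lt_of_le_of_ne (not_lt.1 hcon) (zero_ne_of_form_neg h hf)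
  have h2 := bil_neg_of_pos h (x := -act s x) (y := act s (basePt h).1)
    (by rw [QuadraticMap.map_neg]; exact hf) (by rw [form_act, (basePt h).2.1]; norm_num)
    (by simpa using h1) hb
  have h3 := bil_neg_of_pos h (by rw [hx]; norm_num) (by rw [(basePt h).2.1]; norm_num) hx0
    (basePt h).2.2
  rw [bil_neg_left, bil_act] at h2
  linarith

/-- The action of the spin group on hyperbolic space. -/
def actHyp (h : IsLorentz w) (s : SpinGrp w) (x : Hyp w) : Hyp w :=
  ⟨act s x.1, by rw [form_act, x.2.1], act_zero_pos h s x.2.1 x.2.2⟩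

theorem act_inv_act (s : SpinGrp w) (x : Fin (n + 1) → ℝ) : act s⁻¹ (act s x) = x := by
  rw [← act_mul, inv_mul_cancel, act_one]

theorem act_act_inv (s : SpinGrp w) (x : Fin (n + 1) → ℝ) : act s (act s⁻¹ x) = x := by
  rw [← act_mul, mul_inv_cancel, act_one]

theorem finiteDimensional_cl : FiniteDimensional ℝ (Cl w) := by
  classical
  exact Module.finite_def.2 ⟨Finset.univ.image (genProd w), by
    rw [Finset.coe_image, Finset.coe_univ, Set.image_univ, span_genProd]⟩

/-- An element satisfying the spin conditions, as an element of the spin group. -/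
def IsSpin.toSpinGrp {c : Cl w} (hc : IsSpin w c) : SpinGrp w :=
  ⟨⟨c, CliffordAlgebra.reverse c, hc.2.2, by
    have := finiteDimensional_cl (w := w)
    -- In finite dimension a right inverse is a two-sided inverse: left multiplication by `c` is
    -- onto, hence injective.
    have h1 : Function.Surjective (LinearMap.mulLeft ℝ c) := fun y =>
      ⟨CliffordAlgebra.reverse c * y, by
        rw [LinearMap.mulLeft_apply, ← mul_assoc, hc.2.2, one_mul]⟩
    refine LinearMap.injective_iff_surjective.2 h1 ?_
    rw [LinearMap.mulLeft_apply, LinearMap.mulLeft_apply, ← mul_assoc, hc.2.2, one_mul,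
      mul_one]⟩, hc⟩

theorem IsSpin.val_toSpinGrp {c : Cl w} (hc : IsSpin w c) : hc.toSpinGrp.val = c := rfl

theorem vec_mul_vec_mul_vec (a v : Fin (n + 1) → ℝ) :
    vec w a * vec w v * vec w a = vec w ((2 * bil w a v) • a - form w a • v) := by
  have h := vec_mul_add_swap (w := w) a v
  have h1 : vec w a * vec w v = algebraMap ℝ _ (2 * bil w a v) - vec w v * vec w a := by
    rw [← h, add_sub_cancel_right]
  rw [h1, sub_mul, mul_assoc, vec_mul_self, map_sub, map_smul, map_smul, ← Algebra.commutes,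
    ← Algebra.smul_def, ← Algebra.smul_def]

theorem IsSpin.vec_mul_vec {a b : Fin (n + 1) → ℝ} (ha : form w a = -1) (hb : form w b = -1) :
    IsSpin w (vec w a * vec w b) := by
  have hr : CliffordAlgebra.reverse (vec w a * vec w b) = vec w b * vec w a := by
    rw [CliffordAlgebra.reverse.map_mul, CliffordAlgebra.reverse_ι, CliffordAlgebra.reverse_ι]
  refine ⟨CliffordAlgebra.ι_mul_ι_mem_evenOdd_zero _ _ _, fun x => ?_, ?_⟩
  · obtain ⟨y, hy⟩ : ∃ y, y = (2 * bil w b x) • b - form w b • x := ⟨_, rfl⟩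
    refine ⟨(2 * bil w a y) • a - form w a • y, ?_⟩
    rw [hr]
    calc _ = vec w a * (vec w b * vec w x * vec w b) * vec w a := by simp only [mul_assoc]
      _ = _ := by rw [vec_mul_vec_mul_vec, ← hy, vec_mul_vec_mul_vec]
  · rw [hr]
    calc _ = vec w a * (vec w b * vec w b) * vec w a := by simp only [mul_assoc]
      _ = 1 := by
        rw [vec_mul_self, hb, ← Algebra.commutes, mul_assoc, vec_mul_self, ha, ← map_mul]
        norm_num

theorem exists_act_eq (h : IsLorentz w) (x y : Hyp w) : ∃ s : SpinGrp w, act s x.1 = y.1 := by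
  have hb := one_le_neg_bil h x y
  set c := -bil w x.1 y.1 with hc
  have hp : 0 < 2 * (1 + c) := by linarith
  set r := √(2 * (1 + c)) with hr
  have hr2 : r * r = 2 * (1 + c) := Real.mul_self_sqrt hp.le
  have hr0 : r ≠ 0 := (Real.sqrt_pos.2 hp).ne'
  -- The normalised midpoint of `x` and `y`. The element `a x` works: conjugation by `x` sends `x`
  -- to `-x`, and conjugation by `a` sends `-x` to `y`.
  set a := r⁻¹ • (x.1 + y.1) with ha
  have hxy : bil w x.1 y.1 = -c := by rw [hc, neg_neg]
  have fa : form w a = -1 := by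
    rw [ha, form_eq_bil, bil_smul_left, bil_smul_right, bil_add_left, bil_add_right,
      bil_add_right, bil_comm y.1 x.1, hxy, ← form_eq_bil, ← form_eq_bil, x.2.1, y.2.1]
    field_simp
    rw [sq, hr2]; ring
  refine ⟨(IsSpin.vec_mul_vec fa x.2.1).toSpinGrp, vec_injective w ?_⟩
  rw [vec_act, IsSpin.val_toSpinGrp, CliffordAlgebra.reverse.map_mul, CliffordAlgebra.reverse_ι,
    CliffordAlgebra.reverse_ι]
  calc _ = vec w a * (vec w x.1 * vec w x.1 * vec w x.1) * vec w a := by simp only [mul_assoc]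
    _ = vec w a * (- vec w x.1) * vec w a := by
      rw [vec_mul_self, x.2.1, map_neg, map_one, neg_one_mul]
    _ = - vec w ((2 * bil w a x.1) • a - form w a • x.1) := by
      rw [mul_neg, neg_mul, vec_mul_vec_mul_vec]
    _ = _ := by
      rw [← map_neg]
      congr 1
      rw [fa, ha, bil_smul_left, bil_add_left, bil_comm y.1, hxy, ← form_eq_bil, x.2.1,
        smul_smul]
      have e : 2 * (r⁻¹ * (-1 + -c)) * r⁻¹ = -1 := by
        field_simp
        rw [sq, hr2]; ring
      rw [e]
      module

theorem realPart_conj (hw : ∀ i, w i ≠ 0) (s t : SpinGrp w) :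
    realPart w (t⁻¹ * s * t).val = realPart w s.val := by
  rw [SpinGrp.val_mul, realPart_mul_comm hw, ← SpinGrp.val_mul]
  congr 2
  group

/-- The real part bounds the displacement from below. -/
theorem two_mul_realPart_sq_le (h : IsLorentz w) (s : SpinGrp w) (x : Hyp w) :
    2 * realPart w s.val ^ 2 ≤ 1 - bil w x.1 (act s x.1) := by
  obtain ⟨t, ht⟩ := exists_act_eq h (basePt h) x
  have h1 : bil w x.1 (act s x.1)
      = bil w (basePt h).1 (act (t⁻¹ * s * t) (basePt h).1) := by
    rw [← bil_act t (basePt h).1, ← act_mul, ← ht, ← act_mul]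
    congr 2
    group
  rw [← realPart_conj h.ne_zero s t, h1, sub_eq_add_neg, neg_bil_basePt_act h,
    ← sum_coef_sq h (t⁻¹ * s * t), ← Finset.sum_add_distrib]
  -- After moving `x` to the base point, the `1` is rewritten by the norm equation and added to the
  -- displacement sum. The terms become `c_M² (w_M + |w_M|) ≥ 0`, and the one at `M = ∅` is twice
  -- the square of the real part.
  have hnn : ∀ M ∈ Finset.univ, 0 ≤ coef w M (t⁻¹ * s * t).val ^ 2 * wprod w M
      + coef w M (t⁻¹ * s * t).val ^ 2 * |wprod w M| := by
    intro M _
    rw [← mul_add]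
    exact mul_nonneg (sq_nonneg _) (by linarith [neg_abs_le (wprod w M)])
  refine le_trans (le_of_eq ?_) (Finset.single_le_sum hnn (Finset.mem_univ ∅))
  rw [coef_empty]
  simp [wprod]
  ring

/-- Elements that fix a point of hyperbolic space have real part at most one. -/
theorem abs_realPart_le_one (h : IsLorentz w) {s : SpinGrp w} {x : Hyp w}
    (hx : act s x.1 = x.1) : |realPart w s.val| ≤ 1 := by
  have := two_mul_realPart_sq_le h s x
  rw [hx, ← form_eq_bil, x.2.1] at this
  rw [← sq_le_one_iff_abs_le_one]
  linarith

/-- The doubling formula for `cosh`: the real part plays the role of `cosh (d / 2)`. -/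
theorem arcosh_two_mul_sq_sub_one {T : ℝ} (hT : 1 ≤ T) :
    Real.arcosh (2 * T ^ 2 - 1) = 2 * Real.arcosh T := by
  have h := Real.cosh_arcosh hT
  rw [← Real.arcosh_cosh (x := 2 * Real.arcosh T) (by linarith [Real.arcosh_nonneg hT]),
    Real.cosh_two_mul, Real.sinh_sq, h]
  congr 1; ring

theorem two_arcosh_le_hdist (h : IsLorentz w) {s : SpinGrp w} {T : ℝ} (hT : 1 ≤ T)
    (hs : T ≤ |realPart w s.val|) (x : Hyp w) :
    2 * Real.arcosh T ≤ hdist w x.1 (act s x.1) := by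
  have h1 := two_mul_realPart_sq_le h s x
  have h2 : T ^ 2 ≤ realPart w s.val ^ 2 := by
    rw [← sq_abs (realPart w s.val)]; gcongr
  rw [← arcosh_two_mul_sq_sub_one hT, hdist, Real.arcosh_le_arcosh (by nlinarith) (by nlinarith)]
  linarith

theorem two_arcosh_le_translationLength (h : IsLorentz w) {s : SpinGrp w} {T : ℝ} (hT : 1 ≤ T)
    (hs : T ≤ |realPart w s.val|) : 2 * Real.arcosh T ≤ translationLength s := by
  have : Nonempty (Hyp w) := ⟨basePt h⟩
  exact le_ciInf fun x => two_arcosh_le_hdist h hT hs x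

theorem translationLength_eq (h : IsLorentz w) {s : SpinGrp w} {T : ℝ} (hT : 1 ≤ T)
    (hs : T ≤ |realPart w s.val|) {x : Hyp w}
    (hx : hdist w x.1 (act s x.1) = 2 * Real.arcosh T) :
    translationLength s = 2 * Real.arcosh T := by
  refine le_antisymm ?_ (two_arcosh_le_translationLength h hT hs)
  rw [← hx]
  refine ciInf_le ⟨0, ?_⟩ x
  rintro _ ⟨y, rfl⟩
  exact Real.arcosh_nonneg (one_le_neg_bil h y (actHyp h s y))

/-- Closing up at time `0` yields an element of `G` carrying the lift at time `0` to the lift at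
time `r`, a distance `r` away; positivity of `r` rules out the identity. -/
theorem le_of_mem_closedGeodesicLengths (h : IsLorentz w) {G : Subgroup (SpinGrp w)} {T : ℝ}
    (hT : 1 ≤ T) (hG : ∀ s ∈ G, s ≠ 1 → T ≤ |realPart w s.val|) {r : ℝ}
    (hr : r ∈ closedGeodesicLengths G) : 2 * Real.arcosh T ≤ r := by
  obtain ⟨hr0, c, ⟨g, hg, hc⟩, hper⟩ := hr
  have h1 := hper 0
  rw [zero_add, hc, hc] at h1
  obtain ⟨s, hs, hsx⟩ := Quotient.exact h1.symm
  have h2 := hg 0 r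
  rw [← hsx, zero_sub, abs_neg, abs_of_pos hr0] at h2
  rw [← h2]
  refine two_arcosh_le_hdist h hT (hG s hs ?_) _
  rintro rfl
  rw [act_one, hdist, ← form_eq_bil, (g 0).2.1, neg_neg, Real.arcosh_zero] at h2
  exact hr0.ne h2

end Lorentz

/-! ### Axes of loxodromic elements -/

section Axis

variable {n : ℕ} {w : Fin (n + 1) → ℝ}

/-- The element `s` translates by `r` along the geodesic through `x` with unit tangent `u`. -/
structure IsAxis (s : SpinGrp w) (x : Hyp w) (u : Fin (n + 1) → ℝ) (r : ℝ) : Prop where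
  form_eq : form w u = 1
  bil_eq : bil w x.1 u = 0
  act_pt : act s x.1 = Real.cosh r • x.1 + Real.sinh r • u
  act_dir : act s u = Real.sinh r • x.1 + Real.cosh r • u

/-- The sign of the product with a fixed point of `ℍⁿ` detects the sheet. -/
theorem pos_of_bil_neg (h : IsLorentz w) (x : Hyp w) {y : Fin (n + 1) → ℝ} (hy : form w y < 0)
    (hxy : bil w x.1 y < 0) : 0 < y 0 := by
  by_contra hcon
  have h1 : y 0 < 0 := lt_of_le_of_ne (not_lt.1 hcon) (zero_ne_of_form_neg h hy)
  have h2 := bil_neg_of_pos h (x := x.1) (y := -y) (by rw [x.2.1]; norm_num)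
    (by rw [QuadraticMap.map_neg]; exact hy) x.2.2 (by simpa using h1)
  rw [bil_neg_right] at h2
  linarith

theorem bil_line {x u : Fin (n + 1) → ℝ} (hx : form w x = -1) (hu : form w u = 1)
    (hxu : bil w x u = 0) (a b c d : ℝ) :
    bil w (a • x + b • u) (c • x + d • u) = b * d - a * c := by
  rw [form_eq_bil] at hx hu
  rw [bil_add_left, bil_add_right, bil_add_right, bil_smul_left, bil_smul_left, bil_smul_left,
    bil_smul_left, bil_smul_right, bil_smul_right, bil_smul_right, bil_smul_right,
    bil_comm u x, hx, hu, hxu]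
  ring

/-- The geodesic through `x` with unit tangent vector `u`. -/
def geodLine (h : IsLorentz w) (x : Hyp w) (u : Fin (n + 1) → ℝ) (hu : form w u = 1)
    (hxu : bil w x.1 u = 0) (t : ℝ) : Hyp w :=
  ⟨Real.cosh t • x.1 + Real.sinh t • u, by
    rw [form_eq_bil, bil_line x.2.1 hu hxu]
    nlinarith [Real.cosh_sq t], by
    have h1 : form w (Real.cosh t • x.1 + Real.sinh t • u) = -1 := by
      rw [form_eq_bil, bil_line x.2.1 hu hxu]
      nlinarith [Real.cosh_sq t]
    refine pos_of_bil_neg h x (by rw [h1]; norm_num) ?_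
    have := bil_line x.2.1 hu hxu 1 0 (Real.cosh t) (Real.sinh t)
    rw [one_smul, zero_smul, add_zero] at this
    rw [this]
    linarith [Real.cosh_pos t]⟩

theorem bil_geodLine (h : IsLorentz w) (x : Hyp w) (u : Fin (n + 1) → ℝ) (hu : form w u = 1)
    (hxu : bil w x.1 u = 0) (s t : ℝ) :
    -bil w (geodLine h x u hu hxu s).1 (geodLine h x u hu hxu t).1 = Real.cosh (s - t) := by
  rw [geodLine, geodLine, bil_line x.2.1 hu hxu, Real.cosh_sub]
  ring

theorem isGeodesicLine_geodLine (h : IsLorentz w) (x : Hyp w) (u : Fin (n + 1) → ℝ)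
    (hu : form w u = 1) (hxu : bil w x.1 u = 0) : IsGeodesicLine (geodLine h x u hu hxu) := by
  intro s t
  rw [hdist, bil_geodLine, ← Real.cosh_abs, Real.arcosh_cosh (abs_nonneg _)]

theorem geodLine_zero (h : IsLorentz w) (x : Hyp w) (u : Fin (n + 1) → ℝ)
    (hu : form w u = 1) (hxu : bil w x.1 u = 0) : geodLine h x u hu hxu 0 = x :=
  Subtype.ext (by simp [geodLine])

theorem IsAxis.act_geodLine (h : IsLorentz w) {s : SpinGrp w} {x : Hyp w}
    {u : Fin (n + 1) → ℝ} {r : ℝ} (hs : IsAxis s x u r) (t : ℝ) :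
    act s (geodLine h x u hs.form_eq hs.bil_eq t).1
      = (geodLine h x u hs.form_eq hs.bil_eq (t + r)).1 := by
  change act s (Real.cosh t • x.1 + Real.sinh t • u)
    = Real.cosh (t + r) • x.1 + Real.sinh (t + r) • u
  rw [map_add, map_smul, map_smul, hs.act_pt, hs.act_dir, Real.cosh_add, Real.sinh_add]
  module

theorem IsAxis.hdist_eq (h : IsLorentz w) {s : SpinGrp w} {x : Hyp w}
    {u : Fin (n + 1) → ℝ} {r : ℝ} (hs : IsAxis s x u r) (hr : 0 ≤ r) :
    hdist w x.1 (act s x.1) = r := by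
  have h1 := hs.act_geodLine h 0
  have h2 := isGeodesicLine_geodLine h x u hs.form_eq hs.bil_eq 0 r
  rw [zero_add, geodLine_zero] at h1
  rw [geodLine_zero, zero_sub, abs_neg, abs_of_nonneg hr] at h2
  rw [h1, h2]

theorem IsAxis.mem_closedGeodesicLengths (h : IsLorentz w) {s : SpinGrp w} {x : Hyp w}
    {u : Fin (n + 1) → ℝ} {r : ℝ} (hs : IsAxis s x u r) (hr : 0 < r)
    {G : Subgroup (SpinGrp w)} (hG : s ∈ G) : r ∈ closedGeodesicLengths G := by
  refine ⟨hr, fun t => Quotient.mk _ (geodLine h x u hs.form_eq hs.bil_eq t),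
    ⟨_, isGeodesicLine_geodLine h x u hs.form_eq hs.bil_eq, fun t => rfl⟩, fun t => ?_⟩
  exact (Quotient.sound (s := orbitSetoid G) ⟨s, hG, hs.act_geodLine h t⟩).symm

/-- The difference is isotropic with vanishing zeroth coordinate, and the form is definite on such
vectors. -/
theorem eq_of_null_of_bil_eq_zero (h : IsLorentz w) {y z : Fin (n + 1) → ℝ} (hy : form w y = 0)
    (hz : form w z = 0) (hyz : bil w y z = 0) (h0 : y 0 = z 0) : y = z := by
  refine sub_eq_zero.1 (eq_zero_of_form_nonpos h (le_of_eq ?_) (by simp [h0]))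
  rw [form_eq_bil, bil_sub_left, bil_sub_right, bil_sub_right, ← form_eq_bil, ← form_eq_bil, hy,
    hz, hyz, bil_comm, hyz]
  simp

/-- The vectors `x + u` and `x - u` are isotropic eigenvectors with eigenvalues `exp r` and `exp
(-r)`. An isotropic eigenvector with eigenvalue `c` that is orthogonal to neither would satisfy `c
exp r = 1 = c exp (-r)`; orthogonality to one makes it proportional to that one. Fixed points in the
interior are excluded by the real part. -/
theorem IsAxis.isLoxodromic (h : IsLorentz w) {s : SpinGrp w} {x : Hyp w}
    {u : Fin (n + 1) → ℝ} {r : ℝ} (hs : IsAxis s x u r) (hr : 0 < r)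
    (hT : 1 < |realPart w s.val|) : IsLoxodromic s := by
  refine ⟨fun y hy => absurd (abs_realPart_le_one h hy) (not_le.2 hT), ?_⟩
  have hx1 := x.2.1
  have hu1 := hs.form_eq
  have line := bil_line hx1 hu1 hs.bil_eq
  have e1 : ∀ ε : ℝ, x.1 + ε • u = (1 : ℝ) • x.1 + ε • u := fun ε => by rw [one_smul]
  have fnull : ∀ ε : ℝ, ε = 1 ∨ ε = -1 → form w (x.1 + ε • u) = 0 := by
    intro ε hε
    rw [form_eq_bil, e1, line]
    rcases hε with rfl | rfl <;> norm_num
  have hne : ∀ ε : ℝ, ε = 1 ∨ ε = -1 → (x.1 + ε • u) 0 ≠ 0 := by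
    intro ε hε h0
    have h1 := eq_zero_of_form_nonpos h (fnull ε hε).le h0
    have h2 := line 1 0 1 ε
    rw [← e1 ε, h1] at h2
    simp [bil] at h2
  have hact : ∀ ε : ℝ, ε = 1 ∨ ε = -1 →
      act s (x.1 + ε • u) = Real.exp (ε * r) • (x.1 + ε • u) := by
    intro ε hε
    rw [map_add, map_smul, hs.act_pt, hs.act_dir]
    rcases hε with rfl | rfl
    · rw [one_mul, ← Real.cosh_add_sinh]; module
    · rw [neg_one_mul, ← Real.cosh_sub_sinh]; module
  set p : ℝ → Fin (n + 1) → ℝ := fun ε => ((x.1 + ε • u) 0)⁻¹ • (x.1 + ε • u) with hp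
  have pnull : ∀ ε : ℝ, ε = 1 ∨ ε = -1 → form w (p ε) = 0 := fun ε hε => by
    rw [hp, QuadraticMap.map_smul, fnull ε hε, smul_zero]
  have p0 : ∀ ε : ℝ, ε = 1 ∨ ε = -1 → p ε 0 = 1 := fun ε hε => by
    change ((x.1 + ε • u) 0)⁻¹ * (x.1 + ε • u) 0 = 1
    exact inv_mul_cancel₀ (hne ε hε)
  have pact : ∀ ε : ℝ, ε = 1 ∨ ε = -1 → act s (p ε) = Real.exp (ε * r) • p ε := fun ε hε => by
    simp only [hp]
    rw [map_smul, hact ε hε, smul_comm]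
  have hpm : bil w (p 1) (p (-1)) ≠ 0 := by
    simp only [hp]
    rw [bil_smul_left, bil_smul_right, e1 1, e1 (-1), line]
    have a1 := hne 1 (Or.inl rfl)
    have a2 := hne (-1) (Or.inr rfl)
    rw [e1] at a1 a2
    have a3 : (1 * -1 - 1 * 1 : ℝ) ≠ 0 := by norm_num
    exact mul_ne_zero (inv_ne_zero a1) (mul_ne_zero (inv_ne_zero a2) a3)
  have hset : boundaryFixed s = {p 1, p (-1)} := by
    ext z
    constructor
    · rintro ⟨hz0, hzf, c, hc⟩
      have key : ∀ ε : ℝ, ε = 1 ∨ ε = -1 →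
          c * Real.exp (ε * r) * bil w z (p ε) = bil w z (p ε) := by
        intro ε hε
        conv_rhs => rw [← bil_act s, hc, pact ε hε, bil_smul_left, bil_smul_right]
        ring
      by_cases h1 : bil w z (p 1) = 0
      · exact Or.inl (eq_of_null_of_bil_eq_zero h hzf (pnull 1 (Or.inl rfl)) h1
          (by rw [hz0, p0 1 (Or.inl rfl)]))
      by_cases h2 : bil w z (p (-1)) = 0
      · exact Or.inr (eq_of_null_of_bil_eq_zero h hzf (pnull (-1) (Or.inr rfl)) h2
          (by rw [hz0, p0 (-1) (Or.inr rfl)]))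
      exfalso
      have k1 := mul_right_cancel₀ h1 ((key 1 (Or.inl rfl)).trans (one_mul _).symm)
      have k2 := mul_right_cancel₀ h2 ((key (-1) (Or.inr rfl)).trans (one_mul _).symm)
      have hc0 : c ≠ 0 := by rintro rfl; simp at k1
      have k3 := mul_left_cancel₀ hc0 (k1.trans k2.symm)
      have := Real.exp_injective k3
      linarith
    · rintro (rfl | rfl)
      · exact ⟨p0 1 (Or.inl rfl), pnull 1 (Or.inl rfl), _, pact 1 (Or.inl rfl)⟩
      · exact ⟨p0 (-1) (Or.inr rfl), pnull (-1) (Or.inr rfl), _, pact (-1) (Or.inr rfl)⟩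
  rw [hset]
  refine Set.ncard_pair fun heq => hpm ?_
  rw [← heq, ← form_eq_bil, pnull 1 (Or.inl rfl)]

theorem IsAxis.spinIncl {d : ℕ} (hd : d ≤ n) {s : SpinGrp (restr hd w)}
    {x : Hyp (restr hd w)} {u : Fin (d + 1) → ℝ} {r : ℝ} (hs : IsAxis s x u r) :
    IsAxis (HypArith.spinIncl hd w s) (hypIncl hd w x) (coordIncl hd u) r where
  form_eq := by rw [form_eq_bil, bil_coordIncl, ← form_eq_bil, hs.form_eq]
  bil_eq := (bil_coordIncl hd w x.1 u).trans hs.bil_eq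
  act_pt := by
    change act _ (coordIncl hd x.1) = Real.cosh r • coordIncl hd x.1 + _
    rw [act_spinIncl, hs.act_pt, map_add, map_smul, map_smul]
  act_dir := by
    change _ = Real.sinh r • coordIncl hd x.1 + _
    rw [act_spinIncl, hs.act_dir, map_add, map_smul, map_smul]

end Axis

/-! ### Axes in the hyperbolic plane -/

section Plane

variable {w : Fin (2 + 1) → ℝ}

theorem sum_finset_fin_three {β : Type*} [AddCommMonoid β] (f : Finset (Fin 3) → β) :
    ∑ M, f M = f ∅ + f {0} + f {1} + f {2} + f {0, 1} + f {0, 2} + f {1, 2} + f {0, 1, 2} := by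
  have : (Finset.univ : Finset (Finset (Fin 3)))
      = {∅, {0}, {1}, {2}, {0, 1}, {0, 2}, {1, 2}, {0, 1, 2}} := by decide
  rw [this, Finset.sum_insert (by decide), Finset.sum_insert (by decide),
    Finset.sum_insert (by decide), Finset.sum_insert (by decide), Finset.sum_insert (by decide),
    Finset.sum_insert (by decide), Finset.sum_insert (by decide), Finset.sum_singleton]
  simp only [add_assoc]

theorem vec_three (x : Fin 3 → ℝ) :
    vec w x = x 0 • gen w 0 + x 1 • gen w 1 + x 2 • gen w 2 := by
  rw [vec_eq_sum, Fin.sum_univ_three]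

/-- The product of a bivector and a vector in dimension three. -/
theorem bivector_mul_vec (a b c : ℝ) (x : Fin 3 → ℝ) (hx : a * x 2 - b * x 1 + c * x 0 = 0) :
    (a • (gen w 0 * gen w 1) + b • (gen w 0 * gen w 2) + c • (gen w 1 * gen w 2)) * vec w x
      = vec w ![a * w 1 * x 1 + b * w 2 * x 2, -(a * w 0 * x 0) + c * w 2 * x 2,
          -(b * w 0 * x 0) - c * w 1 * x 1] := by
  have h01 : gen w 1 * gen w 0 = -(gen w 0 * gen w 1) := gen_mul_gen w (by decide)
  have h02 : gen w 2 * gen w 0 = -(gen w 0 * gen w 2) := gen_mul_gen w (by decide)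
  have h12 : gen w 2 * gen w 1 = -(gen w 1 * gen w 2) := gen_mul_gen w (by decide)
  have sq : ∀ (i : Fin 3) (y : Cl w), gen w i * (gen w i * y) = w i • y := fun i y => by
    rw [← mul_assoc, gen_mul_self, Algebra.smul_def]
  have sq' : ∀ (i : Fin 3), gen w i * gen w i = w i • (1 : Cl w) := fun i => by
    rw [gen_mul_self, Algebra.smul_def, mul_one]
  have m010 : gen w 0 * (gen w 1 * gen w 0) = -(w 0 • gen w 1) := by
    rw [h01, mul_neg, sq]
  have m020 : gen w 0 * (gen w 2 * gen w 0) = -(w 0 • gen w 2) := by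
    rw [h02, mul_neg, sq]
  have m121 : gen w 1 * (gen w 2 * gen w 1) = -(w 1 • gen w 2) := by
    rw [h12, mul_neg, sq]
  have m021 : gen w 0 * (gen w 2 * gen w 1) = -(gen w 0 * (gen w 1 * gen w 2)) := by
    rw [h12, mul_neg]
  have m120 : gen w 1 * (gen w 2 * gen w 0) = gen w 0 * (gen w 1 * gen w 2) := by
    rw [h02, mul_neg, ← mul_assoc, h01, neg_mul, neg_neg, mul_assoc]
  rw [vec_three, vec_three]
  simp only [add_mul, mul_add, smul_mul_assoc, mul_smul_comm, mul_assoc, m010, m020, m121, m021,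
    m120, sq', mul_one]
  simp only [Matrix.cons_val]
  -- The trivector component of the product, which the hypothesis on `x` removes.
  have e : (a * x 2 - b * x 1 + c * x 0) • (gen w 0 * (gen w 1 * gen w 2)) = 0 := by
    rw [hx, zero_smul]
  rw [← sub_eq_zero, ← e]
  module

/-- In three dimensions `s = T + v` with a bivector `v`, and `s s* = 1` gives `v² = T² - 1`. Vectors
`x` in the plane of `v` anticommute with `v`, and left multiplication by `v` preserves this plane,
so `s` acts on it by `(T + v)² = (2T² - 1) + 2T v`. This is a translation by `r` with `cosh r = 2T²
- 1`. -/
theorem exists_isAxis (h : IsLorentz w) (s : SpinGrp w) {T : ℝ} (hT : 1 < T)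
    (hs : realPart w s.val = T) : ∃ x u, IsAxis s x u (2 * Real.arcosh T) := by
  set a := coef w {0, 1} s.val with ha
  set b := coef w {0, 2} s.val with hb
  set c := coef w {1, 2} s.val with hc
  have odd : ∀ M : Finset (Fin (2 + 1)), ¬ Even M.card → coef w M s.val = 0 := fun M hM =>
    coef_eq_zero_of_even h.ne_zero s.isSpin.1 hM
  have o0 := odd {0} (by decide)
  have o1 := odd {1} (by decide)
  have o2 := odd {2} (by decide)
  have o3 := odd {0, 1, 2} (by decide)
  have g01 : genProd w {0, 1} = gen w 0 * gen w 1 := by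
    rw [genProd_insert_of_lt w (by decide), genProd_singleton]
  have g02 : genProd w {0, 2} = gen w 0 * gen w 2 := by
    rw [genProd_insert_of_lt w (by decide), genProd_singleton]
  have g12 : genProd w {1, 2} = gen w 1 * gen w 2 := by
    rw [genProd_insert_of_lt w (by decide), genProd_singleton]
  obtain ⟨v, hv⟩ : ∃ v, v = a • (gen w 0 * gen w 1) + b • (gen w 0 * gen w 2)
    + c • (gen w 1 * gen w 2) := ⟨_, rfl⟩
  have hsv : s.val = algebraMap ℝ _ T + v := by
    rw [hv, Algebra.algebraMap_eq_smul_one]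
    conv_lhs => rw [← sum_coef_smul h.ne_zero s.val, sum_finset_fin_three]
    rw [o0, o1, o2, o3, coef_empty, hs, g01, g02, g12, genProd_empty]
    simp only [zero_smul, add_zero]
    abel
  have hrev : CliffordAlgebra.reverse v = -v := by
    have hr : ∀ i, CliffordAlgebra.reverse (gen w i) = gen w i := fun i =>
      CliffordAlgebra.reverse_ι _
    rw [hv]
    simp only [map_add, map_smul, CliffordAlgebra.reverse.map_mul, hr]
    rw [gen_mul_gen w (show (1 : Fin 3) ≠ 0 by decide),
      gen_mul_gen w (show (2 : Fin 3) ≠ 0 by decide),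
      gen_mul_gen w (show (2 : Fin 3) ≠ 1 by decide)]
    module
  have hsr : CliffordAlgebra.reverse s.val = algebraMap ℝ _ T - v := by
    rw [hsv, map_add, hrev, CliffordAlgebra.reverse.commutes, sub_eq_add_neg]
  have hvv : v * v = algebraMap ℝ _ (T ^ 2 - 1) := by
    have h1 := val_mul_reverse s
    rw [hsv] at h1
    rw [map_add, hrev, CliffordAlgebra.reverse.commutes, add_mul, mul_add, mul_add, mul_neg,
      mul_neg, Algebra.commutes T v] at h1
    rw [map_sub, map_one, ← h1, sq, map_mul]
    abel
  have hnorm : a ^ 2 * (w 0 * w 1) + b ^ 2 * (w 0 * w 2) + c ^ 2 * (w 1 * w 2) = 1 - T ^ 2 := by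
    have h1 := sum_coef_sq h s
    rw [sum_finset_fin_three, o0, o1, o2, o3, coef_empty, hs] at h1
    have p0 : wprod w ∅ = 1 := by simp [wprod]
    have p1 : wprod w {0, 1} = w 0 * w 1 := Finset.prod_pair (by decide)
    have p2 : wprod w {0, 2} = w 0 * w 2 := Finset.prod_pair (by decide)
    have p3 : wprod w {1, 2} = w 1 * w 2 := Finset.prod_pair (by decide)
    rw [p0, p1, p2, p3] at h1
    linarith
  have w0 := h.1
  have w1 := h.2 1 (by decide)
  have w2 := h.2 2 (by decide)
  have hT2 : 0 < T ^ 2 - 1 := by nlinarith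
  -- Positivity of `D` comes from the norm equation: since `T > 1`, the negative weight `w 0` must
  -- contribute.
  set D := b ^ 2 * w 2 + a ^ 2 * w 1 with hD
  have hwD : w 0 * D + c ^ 2 * (w 1 * w 2) = -(T ^ 2 - 1) := by rw [hD]; linarith
  have hDpos : 0 < D := by
    have : 0 ≤ c ^ 2 * (w 1 * w 2) := by positivity
    by_contra hcon
    push Not at hcon
    nlinarith
  have hN : 0 < D * (T ^ 2 - 1) := mul_pos hDpos hT2
  set r := √(D * (T ^ 2 - 1)) with hr
  have hr0 : 0 < r := Real.sqrt_pos.2 hN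
  have hrr : r * r = D * (T ^ 2 - 1) := Real.mul_self_sqrt hN.le
  -- A multiple of the orthogonal projection of `e_0` to the plane of the bivector; before scaling
  -- its form is `-D (T² - 1)`, whence the factor `r⁻¹`.
  obtain ⟨x, hx⟩ : ∃ x : Fin 3 → ℝ, x = r⁻¹ • ![D, c * b * w 2, -(c * a * w 1)] := ⟨_, rfl⟩
  have x0 : x 0 = r⁻¹ * D := by rw [hx]; rfl
  have x1 : x 1 = r⁻¹ * (c * b * w 2) := by rw [hx]; rfl
  have x2 : x 2 = r⁻¹ * -(c * a * w 1) := by rw [hx]; rfl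
  have fx : form w x = -1 := by
    rw [form_apply, Fin.sum_univ_three, x0, x1, x2]
    have e1 : w 0 * D ^ 2 + w 1 * (c * b * w 2) ^ 2 + w 2 * (c * a * w 1) ^ 2 = - (r * r) := by
      rw [hrr]
      have : w 1 * (c * b * w 2) ^ 2 + w 2 * (c * a * w 1) ^ 2 = c ^ 2 * (w 1 * w 2) * D := by
        rw [hD]; ring
      rw [add_assoc, this]
      linear_combination D * hwD
    field_simp
    linear_combination e1
  have hlin : a * x 2 - b * x 1 + c * x 0 = 0 := by
    rw [x0, x1, x2, hD]; ring
  obtain ⟨y, hy⟩ : ∃ y, v * vec w x = vec w y := ⟨_, by rw [hv]; exact bivector_mul_vec a b c x hlin⟩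
  have hxv : vec w x * v = - vec w y := by
    have := congrArg CliffordAlgebra.reverse hy
    rw [CliffordAlgebra.reverse.map_mul, hrev, CliffordAlgebra.reverse_ι,
      CliffordAlgebra.reverse_ι, mul_neg] at this
    rw [← this, neg_neg]
  have hvy : v * vec w y = (T ^ 2 - 1) • vec w x := by
    rw [← hy, ← mul_assoc, hvv, ← Algebra.smul_def]
  have actx : act s x = (2 * T ^ 2 - 1) • x + (2 * T) • y := by
    apply vec_injective w
    rw [vec_act, hsv, map_add, hrev, CliffordAlgebra.reverse.commutes, map_add, map_smul, map_smul,
      add_mul, add_mul, mul_add, mul_add, ← Algebra.smul_def, hy]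
    have e1 : vec w y * -v = v * vec w y := by rw [mul_neg, ← neg_mul, ← hxv, mul_assoc, hvv, ← Algebra.commutes, ← Algebra.smul_def, hvy]
    rw [e1, hvy, mul_neg, smul_mul_assoc, smul_mul_assoc, hxv, ← Algebra.commutes, ← Algebra.commutes,
      ← Algebra.smul_def, ← Algebra.smul_def]
    module
  have acty : act s y = (2 * T * (T ^ 2 - 1)) • x + (2 * T ^ 2 - 1) • y := by
    apply vec_injective w
    have hcomm : s.val * v = v * s.val := by
      rw [hsv, mul_add, add_mul, Algebra.commutes]
    rw [vec_act, ← hy, ← mul_assoc, hcomm, mul_assoc, mul_assoc, ← mul_assoc s.val, ← vec_act, actx,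
      map_add, map_add, map_smul, map_smul, map_smul, map_smul, mul_add, mul_smul_comm,
      mul_smul_comm, hy, hvy]
    module
  have fy : form w y = T ^ 2 - 1 := by
    apply algebraMap_cl_injective (w := w)
    rw [← vec_mul_self]
    calc vec w y * vec w y = v * (vec w x * v) * vec w x := by
          rw [← hy]; simp only [mul_assoc]
      _ = -(v * vec w y * vec w x) := by rw [hxv]; simp only [mul_neg, neg_mul]
      _ = _ := by
        rw [hvy, smul_mul_assoc, vec_mul_self, fx, Algebra.smul_def, ← map_mul, ← map_neg]
        congr 1; ring
  have bxy : bil w x y = 0 := by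
    have h1 := vec_mul_add_swap (w := w) x y
    have h2 : vec w x * vec w y + vec w y * vec w x = 0 := by
      rw [← hy, ← mul_assoc, hxv, ← hy]; simp
    rw [h2] at h1
    have h3 : (0 : ℝ) = 2 * bil w x y :=
      algebraMap_cl_injective (w := w) (by rw [map_zero]; exact h1)
    linarith
  obtain ⟨q, hq⟩ : ∃ q, q = √(T ^ 2 - 1) := ⟨_, rfl⟩
  have hq0 : q ≠ 0 := by rw [hq]; exact (Real.sqrt_pos.2 hT2).ne'
  have hqq : q * q = T ^ 2 - 1 := by rw [hq]; exact Real.mul_self_sqrt hT2.le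
  have hch : Real.cosh (2 * Real.arcosh T) = 2 * T ^ 2 - 1 := by
    rw [Real.cosh_two_mul, Real.sinh_sq, Real.cosh_arcosh hT.le]; ring
  have hsh : Real.sinh (2 * Real.arcosh T) = 2 * T * q := by
    rw [Real.sinh_two_mul, Real.sinh_arcosh hT.le, Real.cosh_arcosh hT.le, hq]; ring
  refine ⟨⟨x, fx, ?_⟩, q⁻¹ • y, ?_, ?_, ?_, ?_⟩
  · rw [x0]; positivity
  · rw [QuadraticMap.map_smul, fy, ← hqq, smul_eq_mul]; field_simp
  · rw [bil_smul_right, bxy, mul_zero]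
  · change act s x = _ • x + _
    rw [actx, hch, hsh, smul_smul, mul_assoc (2 * T), mul_inv_cancel₀ hq0, mul_one]
  · change _ = _ • x + _
    rw [map_smul, acty, hch, hsh, smul_add, smul_smul, smul_smul, smul_smul, ← hqq]
    congr 2
    · field_simp
    · ring

end Plane

/-! ### Real quadratic fields -/

section Quadratic

variable {k : IntermediateField ℚ ℝ}

/-- A quadratic extension of `ℚ` is Galois, and its nontrivial automorphism is composed with the
inclusion in `ℝ`. -/
theorem exists_embedding_ne (hk : Module.finrank ℚ k = 2) :
    ∃ σ : k →+* ℝ, σ ≠ algebraMap k ℝ := by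
  have : Algebra.IsQuadraticExtension ℚ k := { finrank_eq_two' := hk }
  have : FiniteDimensional ℚ k := Module.finite_of_finrank_pos (by omega)
  have hcard := IsGalois.card_aut_eq_finrank ℚ k
  rw [hk] at hcard
  have : Nontrivial (Gal(k/ℚ)) := by
    have : Finite (Gal(k/ℚ)) := Nat.finite_of_card_ne_zero (by omega)
    exact Finite.one_lt_card_iff_nontrivial.1 (by omega)
  obtain ⟨g, hg⟩ := exists_ne (1 : Gal(k/ℚ))
  refine ⟨(algebraMap k ℝ).comp (g : k →+* k), fun h => hg ?_⟩
  ext x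
  have := RingHom.congr_fun h x
  exact this

theorem mem_span_one_pair (hk : Module.finrank ℚ k = 2) {σ : k →+* ℝ} {y : k}
    (hy : σ y ≠ algebraMap k ℝ y) (x : k) : ∃ p q : ℚ, x = p + q * y := by
  have hli : LinearIndependent ℚ ![(1 : k), y] := by
    rw [LinearIndependent.pair_iff]
    intro p q hpq
    by_cases hq : q = 0
    · subst hq
      simpa using hpq
    · exfalso
      have h1 : y = ((-p / q : ℚ) : k) := by
        rw [Algebra.smul_def, Algebra.smul_def, mul_one] at hpq
        have hq' : (q : k) ≠ 0 := by exact_mod_cast hq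
        push_cast
        field_simp
        have : (p : k) + q * y = 0 := hpq
        linear_combination this
      rw [h1, map_ratCast, map_ratCast] at hy
      exact hy rfl
  have hspan := hli.span_eq_top_of_card_eq_finrank (by simp [hk])
  have hx : x ∈ Submodule.span ℚ (Set.range ![(1 : k), y]) := by rw [hspan]; trivial
  rw [Matrix.range_cons, Matrix.range_cons, Matrix.range_empty, Set.union_empty,
    Set.singleton_union, Submodule.mem_span_pair] at hx
  obtain ⟨p, q, h⟩ := hx
  refine ⟨p, q, ?_⟩
  rw [← h, Algebra.smul_def, Algebra.smul_def, mul_one]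
  rfl

/-- With respect to a basis `1, y`, where `y² = b + a y`, the conjugate of `y` must be the other
root `a - y`; trace and norm are then explicit rational expressions. -/
theorem exists_rat_trace_norm (hk : Module.finrank ℚ k = 2) {σ : k →+* ℝ}
    (hσ : σ ≠ algebraMap k ℝ) (x : k) :
    (∃ q : ℚ, (x : ℝ) + σ x = q) ∧ ∃ q : ℚ, (x : ℝ) * σ x = q := by
  obtain ⟨y, hy⟩ : ∃ y, σ y ≠ algebraMap k ℝ y := by
    by_contra hcon
    push Not at hcon
    exact hσ (RingHom.ext hcon)
  obtain ⟨b, a, hab⟩ := mem_span_one_pair hk hy (y ^ 2)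
  have h1 : σ y ^ 2 = b + a * σ y := by
    rw [← map_pow, hab, map_add, map_mul, map_ratCast, map_ratCast]
  have h2 : (y : ℝ) ^ 2 = b + a * (y : ℝ) := by
    have := congrArg (algebraMap k ℝ) hab
    rw [map_pow, map_add, map_mul, map_ratCast, map_ratCast] at this
    exact this
  have h3 : σ y = a - y := by
    have h4 : (σ y - y) * (σ y + y - a) = 0 := by linear_combination h1 - h2
    rcases mul_eq_zero.1 h4 with h | h
    · exact absurd (sub_eq_zero.1 h) hy
    · linarith
  obtain ⟨p, q, rfl⟩ := mem_span_one_pair hk hy x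
  have e1 : ((p + q * y : k) : ℝ) = p + q * y := by
    have := map_add (algebraMap k ℝ) (p : k) (q * y)
    rw [map_mul, map_ratCast, map_ratCast] at this
    exact this
  have e2 : σ (p + q * y) = p + q * (a - y) := by
    rw [map_add, map_mul, map_ratCast, map_ratCast, h3]
  rw [e1, e2]
  refine ⟨⟨2 * p + q * a, by push_cast; ring⟩, ⟨p ^ 2 + p * q * a - q ^ 2 * b, ?_⟩⟩
  push_cast
  linear_combination -(q : ℝ) ^ 2 * h2

theorem coe_ringOfIntegers_real (x : 𝓞 k) : algebraMap (𝓞 k) ℝ x = ((x : k) : ℝ) := rfl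

theorem exists_int_of_isIntegral {r : ℝ} {q : ℚ} (hr : IsIntegral ℤ r) (hq : r = q) :
    ∃ m : ℤ, r = m := by
  have h1 : IsIntegral ℤ (algebraMap ℚ ℝ q) := by
    have : algebraMap ℚ ℝ q = r := by rw [hq]; rfl
    rwa [this]
  rw [isIntegral_algebraMap_iff (algebraMap ℚ ℝ).injective, IsIntegrallyClosed.isIntegral_iff] at h1
  obtain ⟨m, hm⟩ := h1
  refine ⟨m, ?_⟩
  rw [hq, ← hm]
  simp

theorem isIntegral_conj (σ : k →+* ℝ) (x : 𝓞 k) : IsIntegral ℤ (σ (x : k)) :=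
  map_isIntegral_int σ x.2

theorem isIntegral_coe (x : 𝓞 k) : IsIntegral ℤ (algebraMap (𝓞 k) ℝ x) :=
  map_isIntegral_int (algebraMap k ℝ) x.2

theorem exists_int_trace_norm (hk : Module.finrank ℚ k = 2) {σ : k →+* ℝ}
    (hσ : σ ≠ algebraMap k ℝ) (x : 𝓞 k) :
    (∃ m : ℤ, algebraMap (𝓞 k) ℝ x + σ (x : k) = m) ∧
      ∃ m : ℤ, algebraMap (𝓞 k) ℝ x * σ (x : k) = m := by
  obtain ⟨⟨p, hp⟩, ⟨q, hq⟩⟩ := exists_rat_trace_norm hk hσ (x : k)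
  exact ⟨exists_int_of_isIntegral ((isIntegral_coe x).add (isIntegral_conj σ x)) hp,
    exists_int_of_isIntegral ((isIntegral_coe x).mul (isIntegral_conj σ x)) hq⟩

theorem algebraMap_ringOfIntegers_injective : Function.Injective (algebraMap (𝓞 k) ℝ) :=
  fun _ _ h => NumberField.RingOfIntegers.ext ((algebraMap k ℝ).injective h)

theorem conj_eq_zero {σ : k →+* ℝ} {x : 𝓞 k} : σ (x : k) = 0 ↔ x = 0 := by
  rw [map_eq_zero]
  exact NumberField.RingOfIntegers.coe_eq_zero_iff

/-- The norm is a nonzero rational integer. This is the arithmetic input behind all lower bounds: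
small at one place means large at the other. -/
theorem one_le_abs_mul_abs_conj (hk : Module.finrank ℚ k = 2) {σ : k →+* ℝ}
    (hσ : σ ≠ algebraMap k ℝ) {x : 𝓞 k} (hx : x ≠ 0) :
    1 ≤ |algebraMap (𝓞 k) ℝ x| * |σ (x : k)| := by
  obtain ⟨m, hm⟩ := (exists_int_trace_norm hk hσ x).2
  rw [← abs_mul, hm]
  have hm0 : m ≠ 0 := by
    rintro rfl
    rw [Int.cast_zero, mul_eq_zero] at hm
    rcases hm with h | h
    · exact hx (algebraMap_ringOfIntegers_injective (by rw [h, map_zero]))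
    · exact hx (conj_eq_zero.1 h)
  exact_mod_cast Int.one_le_abs hm0

/-- Each complex embedding takes `x` to a root of its quadratic equation, that is, to `x` or `σ x`,
so every conjugate is bounded. -/
theorem finite_setOf_abs_le (hk : Module.finrank ℚ k = 2) {σ : k →+* ℝ}
    (hσ : σ ≠ algebraMap k ℝ) (R : ℝ) :
    {x : 𝓞 k | |algebraMap (𝓞 k) ℝ x| ≤ R ∧ |σ (x : k)| ≤ R}.Finite := by
  have : FiniteDimensional ℚ k := Module.finite_of_finrank_pos (by omega)
  have : NumberField k := { to_charZero := inferInstance, to_finiteDimensional := this }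
  refine ((NumberField.Embeddings.finite_of_norm_le k ℂ R).preimage
    (f := fun x : 𝓞 k => (x : k)) (NumberField.RingOfIntegers.coe_injective.injOn)).subset ?_
  rintro x ⟨h1, h2⟩
  refine ⟨x.2, fun φ => ?_⟩
  obtain ⟨⟨p, hp⟩, ⟨q, hq⟩⟩ := exists_rat_trace_norm hk hσ (x : k)
  have e0 : ((x : k) : ℝ) ^ 2 - p * ((x : k) : ℝ) + q = 0 := by rw [← hp, ← hq]; ring
  have e1 : (x : k) ^ 2 - p * (x : k) + q = 0 := by
    apply (algebraMap k ℝ).injective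
    rw [map_zero, map_add, map_sub, map_mul, map_pow, map_ratCast, map_ratCast]
    exact e0
  have e2 := congrArg φ e1
  rw [map_zero, map_add, map_sub, map_mul, map_pow, map_ratCast, map_ratCast] at e2
  have e3 : (φ (x : k) - (algebraMap (𝓞 k) ℝ x : ℂ)) * (φ (x : k) - (σ (x : k) : ℂ)) = 0 := by
    have hp' : (((x : k) : ℝ) : ℂ) + (σ (x : k) : ℂ) = p := by exact_mod_cast congrArg ((↑) : ℝ → ℂ) hp
    have hq' : (((x : k) : ℝ) : ℂ) * (σ (x : k) : ℂ) = q := by exact_mod_cast congrArg ((↑) : ℝ → ℂ) hq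
    rw [coe_ringOfIntegers_real]
    linear_combination e2 - φ (x : k) * hp' + hq'
  rcases mul_eq_zero.1 e3 with h | h
  · rw [sub_eq_zero.1 h, Complex.norm_real]; exact h1
  · rw [sub_eq_zero.1 h, Complex.norm_real]; exact h2

theorem conj_mem_pair {σ σ' : k →+* ℝ} (hk : Module.finrank ℚ k = 2) (hσ : σ ≠ algebraMap k ℝ)
    (x : k) : σ' x = algebraMap k ℝ x ∨ σ' x = σ x := by
  obtain ⟨⟨p, hp⟩, ⟨q, hq⟩⟩ := exists_rat_trace_norm hk hσ x
  have e0 : (x : ℝ) ^ 2 - p * (x : ℝ) + q = 0 := by rw [← hp, ← hq]; ring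
  have e1 : x ^ 2 - p * x + q = 0 := by
    apply (algebraMap k ℝ).injective
    rw [map_zero, map_add, map_sub, map_mul, map_pow, map_ratCast, map_ratCast]
    exact e0
  have e2 := congrArg σ' e1
  rw [map_zero, map_add, map_sub, map_mul, map_pow, map_ratCast, map_ratCast] at e2
  have e3 : (σ' x - x) * (σ' x - σ x) = 0 := by linear_combination e2 - σ' x * hp + hq
  rcases mul_eq_zero.1 e3 with h | h
  · exact Or.inl (sub_eq_zero.1 h)
  · exact Or.inr (sub_eq_zero.1 h)

theorem embedding_unique (hk : Module.finrank ℚ k = 2) {σ σ' : k →+* ℝ}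
    (hσ : σ ≠ algebraMap k ℝ) (hσ' : σ' ≠ algebraMap k ℝ) : σ' = σ := by
  obtain ⟨y, hy⟩ : ∃ y, σ' y ≠ algebraMap k ℝ y := by
    by_contra hcon
    push Not at hcon
    exact hσ' (RingHom.ext hcon)
  have hy' := (conj_mem_pair (σ' := σ') hk hσ y).resolve_left hy
  ext x
  obtain ⟨p, q, rfl⟩ := mem_span_one_pair hk hy x
  rw [map_add, map_add, map_mul, map_mul, map_ratCast, map_ratCast, map_ratCast, map_ratCast, hy']

open Classical in
/-- The conjugate of a real quadratic irrationality over `ℚ` (and `0` for other numbers). -/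
def quadConj (t : ℝ) : ℝ :=
  if h : ∃ t' : ℝ, t' ≠ t ∧ (∃ q : ℚ, t + t' = q) ∧ ∃ q : ℚ, t * t' = q then h.choose else 0

/-- Two different candidates for the conjugate would differ by a nonzero rational whose product with
`x` is rational, so `x` would be rational. Hence the conjugate, and with it the choice of exponent,
depends on the real number alone and not on `k`. -/
theorem quadConj_eq (hk : Module.finrank ℚ k = 2) {σ : k →+* ℝ} (hσ : σ ≠ algebraMap k ℝ)
    {x : k} (hx : σ x ≠ (x : ℝ)) : quadConj (x : ℝ) = σ x := by
  have hex : ∃ t' : ℝ, t' ≠ (x : ℝ) ∧ (∃ q : ℚ, (x : ℝ) + t' = q) ∧ ∃ q : ℚ, (x : ℝ) * t' = q :=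
    ⟨σ x, hx, exists_rat_trace_norm hk hσ x⟩
  rw [quadConj, dif_pos hex]
  obtain ⟨-, ⟨a, ha⟩, ⟨b, hb⟩⟩ := hex.choose_spec
  set t' := hex.choose
  obtain ⟨⟨p, hp⟩, ⟨q, hq⟩⟩ := exists_rat_trace_norm hk hσ x
  by_contra hne
  have h1 : t' - σ x = ((a - p : ℚ) : ℝ) := by push_cast; rw [← ha, ← hp]; ring
  have h2 : (x : ℝ) * ((a - p : ℚ) : ℝ) = ((b - q : ℚ) : ℝ) := by
    rw [← h1]; push_cast; rw [← hb, ← hq]; ring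
  have h3 : ((a - p : ℚ) : ℝ) ≠ 0 := by rw [← h1]; exact sub_ne_zero.2 hne
  have h4 : (x : ℝ) = (((b - q) / (a - p) : ℚ) : ℝ) := by
    rw [Rat.cast_div, eq_div_iff h3, h2]
  have h5 : x = (((b - q) / (a - p) : ℚ) : k) := by
    apply (algebraMap k ℝ).injective
    rw [map_ratCast]; exact h4
  refine hx ?_
  rw [h4, h5, map_ratCast]

end Quadratic

/-! ### Integral elements of the spin group -/

section Integral

variable {k : IntermediateField ℚ ℝ} {n : ℕ} {w : Fin (n + 1) → 𝓞 k}

theorem IsAdmissible.isLorentz (h : IsAdmissible k w) : IsLorentz (realW k w) := ⟨h.1, h.2.1⟩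

theorem IsAdmissible.restr {d : ℕ} (hd : d ≤ n) (h : IsAdmissible k w) :
    IsAdmissible k (restr hd w) := by
  refine ⟨h.1, fun i hi => h.2.1 _ fun h0 => hi ?_, fun σ hσ => ?_⟩
  · exact Fin.castLE_injective (Nat.add_le_add_right hd 1) h0
  · rcases h.2.2 σ hσ with h | h
    · exact Or.inl fun i => h _
    · exact Or.inr fun i => h _

theorem mem_coeffIn_iff (hw : ∀ i, realW k w i ≠ 0) {I : Ideal (𝓞 k)} {c : Cl (realW k w)} :
    c ∈ coeffIn k w I ↔ (∀ M, ∃ a ∈ I, coef (realW k w) M c = algebraMap (𝓞 k) ℝ a) ∧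
      ∀ M, ¬ Even M.card → coef (realW k w) M c = 0 := by
  constructor
  · intro hc
    induction hc using AddSubgroup.closure_induction with
    | mem x hx =>
      obtain ⟨a, ha, N, hN, rfl⟩ := hx
      refine ⟨fun M => ?_, fun M hM => ?_⟩
      · rw [map_smul, coef_genProd hw]
        split_ifs
        · exact ⟨a, ha, by simp⟩
        · exact ⟨0, zero_mem _, by simp⟩
      · rw [map_smul, coef_genProd hw, if_neg, smul_zero]
        rintro rfl
        exact hM hN
    | zero => exact ⟨fun M => ⟨0, zero_mem _, by simp⟩, fun M _ => map_zero _⟩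
    | add x y _ _ hx hy =>
      refine ⟨fun M => ?_, fun M hM => by rw [map_add, hx.2 M hM, hy.2 M hM, add_zero]⟩
      obtain ⟨a, ha, h1⟩ := hx.1 M
      obtain ⟨b, hb, h2⟩ := hy.1 M
      exact ⟨a + b, add_mem ha hb, by rw [map_add, h1, h2, map_add]⟩
    | neg x _ hx =>
      refine ⟨fun M => ?_, fun M hM => by rw [map_neg, hx.2 M hM, neg_zero]⟩
      obtain ⟨a, ha, h1⟩ := hx.1 M
      exact ⟨-a, neg_mem ha, by rw [map_neg, h1, map_neg]⟩
  · rintro ⟨h1, h2⟩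
    rw [← sum_coef_smul hw c]
    refine sum_mem fun M _ => ?_
    by_cases hM : Even M.card
    · obtain ⟨a, ha, h⟩ := h1 M
      rw [h]
      exact coeffIn_mem k w ha hM
    · rw [h2 M hM, zero_smul]; exact zero_mem _

theorem exists_realPart_eq (hw : ∀ i, realW k w i ≠ 0) {I : Ideal (𝓞 k)} {c : Cl (realW k w)}
    (hc : c ∈ coeffIn k w I) : ∃ a ∈ I, realPart (realW k w) c = algebraMap (𝓞 k) ℝ a := by
  have := ((mem_coeffIn_iff hw).1 hc).1 ∅
  rwa [coef_empty] at this

theorem coeffIn_mono {I J : Ideal (𝓞 k)} (h : I ≤ J) : coeffIn k w I ≤ coeffIn k w J :=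
  AddSubgroup.closure_mono fun _ ⟨a, ha, M, hM, hc⟩ => ⟨a, h ha, M, hM, hc⟩

theorem coeffIn_le_order (I : Ideal (𝓞 k)) : coeffIn k w I ≤ order k w := coeffIn_mono le_top

theorem exists_smul_of_mem_coeffIn_span {α : 𝓞 k} {c : Cl (realW k w)}
    (hc : c ∈ coeffIn k w (Ideal.span {α})) :
    ∃ x ∈ order k w, c = algebraMap (𝓞 k) ℝ α • x := by
  induction hc using AddSubgroup.closure_induction with
  | mem x hx =>
    obtain ⟨a, ha, N, hN, rfl⟩ := hx
    obtain ⟨b, rfl⟩ := Ideal.mem_span_singleton'.1 ha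
    exact ⟨_, coeffIn_mem k w (Submodule.mem_top (x := b)) hN, by
      rw [smul_smul, ← map_mul, mul_comm]⟩
  | zero => exact ⟨0, zero_mem _, by simp⟩
  | add x y _ _ hx hy =>
    obtain ⟨a, ha, rfl⟩ := hx
    obtain ⟨b, hb, rfl⟩ := hy
    exact ⟨a + b, add_mem ha hb, by rw [smul_add]⟩
  | neg x _ hx =>
    obtain ⟨a, ha, rfl⟩ := hx
    exact ⟨-a, neg_mem ha, by rw [smul_neg]⟩

theorem smul_mem_coeffIn_span {α : 𝓞 k} {x : Cl (realW k w)} (hx : x ∈ order k w) :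
    algebraMap (𝓞 k) ℝ α • x ∈ coeffIn k w (Ideal.span {α}) :=
  smul_mem_coeffIn k w (Ideal.mem_span_singleton_self α) hx

theorem wprod_realW (M : Finset (Fin (n + 1))) :
    wprod (realW k w) M = algebraMap (𝓞 k) ℝ (∏ i ∈ M, w i) := by
  rw [wprod, map_prod]

/-- The conjugate form may be definite of either sign; an even number of factors makes the sign
disappear. -/
theorem conj_wprod_pos (h : IsAdmissible k w) {σ : k →+* ℝ} (hσ : σ ≠ algebraMap k ℝ)
    {M : Finset (Fin (n + 1))} (hM : Even M.card) : 0 < σ ((∏ i ∈ M, w i : 𝓞 k) : k) := by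
  have e : σ ((∏ i ∈ M, w i : 𝓞 k) : k) = ∏ i ∈ M, σ (w i : k) := by
    have h1 : ((∏ i ∈ M, w i : 𝓞 k) : k) = ∏ i ∈ M, (w i : k) :=
      map_prod (algebraMap (𝓞 k) k) _ _
    rw [h1, map_prod]
  rw [e]
  rcases h.2.2 σ hσ with h | h
  · exact Finset.prod_pos fun i _ => h i
  · have h1 : ∏ i ∈ M, σ (w i : k) = ∏ i ∈ M, -σ (w i : k) := by
      rw [Finset.prod_neg, hM.neg_one_pow, one_mul]
    rw [h1]
    exact Finset.prod_pos fun i _ => neg_pos.2 (h i)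

/-- The integral coefficients of an element of `Γ`, and their norm equation at the other real
place. -/
theorem exists_coef_conj (h : IsAdmissible k w) (σ : k →+* ℝ) {s : SpinGrp (realW k w)}
    (hs : s ∈ Gam k w) : ∃ a : Finset (Fin (n + 1)) → 𝓞 k,
      (∀ M, coef (realW k w) M s.val = algebraMap (𝓞 k) ℝ (a M)) ∧
      (∀ M, ¬ Even M.card → a M = 0) ∧
      ∑ M, σ (a M : k) ^ 2 * σ ((∏ i ∈ M, w i : 𝓞 k) : k) = 1 := by
  have hs' := (mem_coeffIn_iff h.isLorentz.ne_zero).1 hs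
  choose a _ ha using hs'.1
  refine ⟨a, ha, fun M hM => ?_, ?_⟩
  · have := hs'.2 M hM
    rw [ha] at this
    exact algebraMap_ringOfIntegers_injective (by rw [this, map_zero])
  · have h1 : ∑ M, a M ^ 2 * ∏ i ∈ M, w i = 1 := by
      apply algebraMap_ringOfIntegers_injective
      rw [map_one, ← sum_coef_sq h.isLorentz s, map_sum]
      refine Finset.sum_congr rfl fun M _ => ?_
      rw [map_mul, map_pow, ← ha, wprod_realW]
    have h2 := congrArg (σ.comp (algebraMap (𝓞 k) k)) h1
    rw [map_sum, map_one] at h2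
    rw [← h2]
    exact Finset.sum_congr rfl fun M _ => by rw [map_mul, map_pow]; rfl

/-- At the other place the norm equation is a sum of nonnegative terms equal to `1`, and the term at
`∅` is the square of the conjugate real part. -/
theorem abs_conj_realPart_le (h : IsAdmissible k w) {σ : k →+* ℝ} (hσ : σ ≠ algebraMap k ℝ)
    {s : SpinGrp (realW k w)} (hs : s ∈ Gam k w) {x : 𝓞 k}
    (hx : realPart (realW k w) s.val = algebraMap (𝓞 k) ℝ x) : |σ (x : k)| ≤ 1 := by
  obtain ⟨a, ha, hodd, hsum⟩ := exists_coef_conj h σ hs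
  have e : a ∅ = x := algebraMap_ringOfIntegers_injective (by rw [← ha, coef_empty, hx])
  have h1 : σ (a ∅ : k) ^ 2 * σ ((∏ i ∈ (∅ : Finset (Fin (n + 1))), w i : 𝓞 k) : k) ≤ 1 := by
    rw [← hsum]
    refine Finset.single_le_sum (f := fun M => σ (a M : k) ^ 2 * σ ((∏ i ∈ M, w i : 𝓞 k) : k))
      (fun M _ => ?_) (Finset.mem_univ ∅)
    by_cases hM : Even M.card
    · exact mul_nonneg (sq_nonneg _) (conj_wprod_pos h hσ hM).le
    · rw [hodd M hM]; simp
  rw [e] at h1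
  rw [← sq_le_one_iff_abs_le_one]
  simpa using h1

/-- The term at `∅` then exhausts the conjugate norm equation, so all other coefficients have
conjugate zero and vanish. -/
theorem eq_one_of_realPart_eq_one (h : IsAdmissible k w) {σ : k →+* ℝ}
    (hσ : σ ≠ algebraMap k ℝ) {s : SpinGrp (realW k w)} (hs : s ∈ Gam k w)
    (hx : realPart (realW k w) s.val = 1) : s = 1 := by
  obtain ⟨a, ha, hodd, hsum⟩ := exists_coef_conj h σ hs
  have e : a ∅ = 1 := algebraMap_ringOfIntegers_injective (by rw [← ha, coef_empty, hx, map_one])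
  have hnn : ∀ M : Finset (Fin (n + 1)),
      0 ≤ σ (a M : k) ^ 2 * σ ((∏ i ∈ M, w i : 𝓞 k) : k) := by
    intro M
    by_cases hM : Even M.card
    · exact mul_nonneg (sq_nonneg _) (conj_wprod_pos h hσ hM).le
    · rw [hodd M hM]; simp
  rw [← Finset.add_sum_erase _ _ (Finset.mem_univ ∅), e] at hsum
  have h2 : ∑ M ∈ Finset.univ.erase ∅, σ (a M : k) ^ 2 * σ ((∏ i ∈ M, w i : 𝓞 k) : k) = 0 := by
    simpa using hsum
  rw [Finset.sum_eq_zero_iff_of_nonneg fun M _ => hnn M] at h2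
  apply SpinGrp.val_injective
  refine ext_coef h.isLorentz.ne_zero fun M => ?_
  rw [SpinGrp.val_one, ← genProd_empty, coef_genProd h.isLorentz.ne_zero]
  split_ifs with hM
  · rw [← hM, coef_empty, hx]
  · by_cases hM' : Even M.card
    · have h3 := h2 M (by simp [Ne.symm hM])
      rcases mul_eq_zero.1 h3 with h4 | h4
      · rw [ha, conj_eq_zero.1 (pow_eq_zero_iff two_ne_zero |>.1 h4), map_zero]
      · exact absurd h4 (conj_wprod_pos h hσ hM').ne'
    · rw [ha, hodd M hM', map_zero]

/-- Discreteness of `Γ`: the coefficients are integers of `k`, bounded at the given place by `R` and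
at the other place by the definite norm equation. -/
theorem finite_setOf_sum_coef_le (hk : Module.finrank ℚ k = 2) (h : IsAdmissible k w) (R : ℝ) :
    {s : SpinGrp (realW k w) | s ∈ Gam k w ∧
      ∑ M, coef (realW k w) M s.val ^ 2 * |wprod (realW k w) M| ≤ R}.Finite := by
  obtain ⟨σ, hσ⟩ := exists_embedding_ne hk
  set B : ℝ := 1 + ∑ M : Finset (Fin (n + 1)), (|R| / |wprod (realW k w) M|
    + 1 / |σ ((∏ i ∈ M, w i : 𝓞 k) : k)|) with hB
  have hBM : ∀ M : Finset (Fin (n + 1)), 1 + |R| / |wprod (realW k w) M| ≤ B ∧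
      1 + 1 / |σ ((∏ i ∈ M, w i : 𝓞 k) : k)| ≤ B := by
    intro M
    have h1 := Finset.single_le_sum (f := fun M : Finset (Fin (n + 1)) =>
      |R| / |wprod (realW k w) M| + 1 / |σ ((∏ i ∈ M, w i : 𝓞 k) : k)|)
      (fun M _ => by positivity) (Finset.mem_univ M)
    have h2 : 0 ≤ |R| / |wprod (realW k w) M| := by positivity
    have h3 : 0 ≤ 1 / |σ ((∏ i ∈ M, w i : 𝓞 k) : k)| := by positivity
    constructor <;> linarith
  have hfin := (Set.Finite.pi' (fun _ : Finset (Fin (n + 1)) => finite_setOf_abs_le hk hσ B))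
  refine Set.Finite.of_finite_image
    (f := fun (s : SpinGrp (realW k w)) (M : Finset (Fin (n + 1))) => coef (realW k w) M s.val)
    ((hfin.image fun a M => algebraMap (𝓞 k) ℝ (a M)).subset ?_) ?_
  · rintro _ ⟨s, ⟨hs, hsR⟩, rfl⟩
    obtain ⟨a, ha, hodd, hsum⟩ := exists_coef_conj h σ hs
    refine ⟨a, fun M => ⟨?_, ?_⟩, ?_⟩
    · refine le_trans ?_ (hBM M).1
      have h1 : coef (realW k w) M s.val ^ 2 * |wprod (realW k w) M| ≤ |R| :=
        (Finset.single_le_sum (f := fun M => coef (realW k w) M s.val ^ 2 *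
          |wprod (realW k w) M|) (fun M _ => by positivity) (Finset.mem_univ M)).trans
          (hsR.trans (le_abs_self R))
      rw [← le_div_iff₀ (abs_pos.2 (wprod_ne_zero h.isLorentz.ne_zero M)), ha] at h1
      have h2 := sq_abs (algebraMap (𝓞 k) ℝ (a M))
      nlinarith [sq_nonneg (|algebraMap (𝓞 k) ℝ (a M)| - 1)]
    · by_cases hM : Even M.card
      · refine le_trans ?_ (hBM M).2
        have hp := conj_wprod_pos h hσ hM
        have h1 : σ (a M : k) ^ 2 * σ ((∏ i ∈ M, w i : 𝓞 k) : k) ≤ 1 := by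
          rw [← hsum]
          refine Finset.single_le_sum
            (f := fun M => σ (a M : k) ^ 2 * σ ((∏ i ∈ M, w i : 𝓞 k) : k))
            (fun M _ => ?_) (Finset.mem_univ M)
          by_cases hM : Even M.card
          · exact mul_nonneg (sq_nonneg _) (conj_wprod_pos h hσ hM).le
          · rw [hodd M hM]; simp
        rw [← le_div_iff₀ hp] at h1
        rw [abs_of_pos hp]
        have h2 := sq_abs (σ (a M : k))
        nlinarith [sq_nonneg (|σ (a M : k)| - 1)]
      · rw [hodd M hM]
        have h3 : 0 ≤ 1 / |σ ((∏ i ∈ M, w i : 𝓞 k) : k)| := by positivity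
        have := (hBM M).2
        simp only [map_zero, abs_zero]
        linarith
    · funext M
      exact (ha M).symm
  · intro s _ t _ hst
    exact SpinGrp.val_injective (ext_coef h.isLorentz.ne_zero fun M => congrFun hst M)

/-! ### Real parts of the elements of congruence subgroups -/

theorem scalar_add_mul_scalar_add {A : Type*} [Ring A] [Algebra ℝ A] (p a : ℝ) (x y : A) :
    (algebraMap ℝ A p + a • x) * (algebraMap ℝ A p + a • y)
      = (p * p) • (1 : A) + (a * p) • y + ((a * p) • x + (a * a) • (x * y)) := by
  rw [Algebra.algebraMap_eq_smul_one]
  simp only [add_mul, mul_add, smul_mul_assoc, mul_smul_comm, one_mul, mul_one]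
  module

/-- Write `r = P + α x`. The real part of `r r* = 1` reads `P² + 2αP x_ℝ + α² (x x*)_ℝ = 1`; modulo
`α²` this leaves `2αP x_ℝ ≡ 0`, and `P` is invertible there because `P² ≡ 1`. The congruence modulo
`α` is thus doubled in strength, up to the factor `2`. -/
theorem two_mul_realPart_sub_mem (hw : ∀ i, realW k w i ≠ 0) {α P R : 𝓞 k} (hα : α ≠ 0)
    (hP : α ^ 2 ∣ P ^ 2 - 1) {r : SpinGrp (realW k w)}
    (hr : r.val - scal k w P ∈ coeffIn k w (Ideal.span {α}))
    (hR : realPart (realW k w) r.val = algebraMap (𝓞 k) ℝ R) : α ^ 2 ∣ 2 * (R - P) := by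
  obtain ⟨x, hx, hrx⟩ := exists_smul_of_mem_coeffIn_span hr
  obtain ⟨X, -, hX⟩ := exists_realPart_eq hw hx
  have hxx : x * CliffordAlgebra.reverse x ∈ order k w :=
    mul_mem_coeffIn k w hx (reverse_mem_coeffIn k w hx)
  obtain ⟨Y, -, hY⟩ := exists_realPart_eq hw hxx
  have hrv : r.val = scal k w P + algebraMap (𝓞 k) ℝ α • x := by rw [← hrx]; abel
  have h1 : (algebraMap (𝓞 k) ℝ P * algebraMap (𝓞 k) ℝ P) • (1 : Cl (realW k w))
      + (algebraMap (𝓞 k) ℝ α * algebraMap (𝓞 k) ℝ P) • CliffordAlgebra.reverse x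
      + ((algebraMap (𝓞 k) ℝ α * algebraMap (𝓞 k) ℝ P) • x
        + (algebraMap (𝓞 k) ℝ α * algebraMap (𝓞 k) ℝ α) • (x * CliffordAlgebra.reverse x))
      = 1 := by
    refine Eq.trans ?_ (val_mul_reverse r)
    rw [hrv, map_add, map_smul, scal, CliffordAlgebra.reverse.commutes,
      scalar_add_mul_scalar_add]
  have h2 := congrArg (realPartLin (realW k w)) h1
  simp only [map_add, map_smul, realPartLin_apply, realPart_reverse hw, hX, hY, realPart_one,
    smul_eq_mul, mul_one] at h2
  have h3 : P * P + α * P * X + (α * P * X + α * α * Y) = 1 :=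
    algebraMap_ringOfIntegers_injective (by simp only [map_add, map_mul, map_one]; exact h2)
  have hRX : R = P + α * X := by
    apply algebraMap_ringOfIntegers_injective
    rw [← hR, hrv, ← realPartLin_apply, map_add, map_smul, realPartLin_apply, realPartLin_apply,
      realPart_algebraMap, hX, map_add, map_mul, smul_eq_mul]
  obtain ⟨z, hz⟩ := hP
  have h4 : 2 * P * X = -(α * (Y + z)) := by
    apply mul_left_cancel₀ hα
    linear_combination h3 - hz
  -- Obtained by multiplying `h4` by `α P` and replacing `P²` by `1 + α² z`.
  refine ⟨-(P * (Y + z)) - 2 * z * α * X, ?_⟩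
  rw [hRX]
  linear_combination α * P * h4 - 2 * α * X * hz

/-- In `2 (R - P) = α² z` the left side is at most `4` at `σ`, and `|σ(α)| ≥ 1`, so `|σ(z)| ≤ 4`.
The norm of `z ≠ 0` then forces `|z| ≥ 1/4`. -/
theorem le_abs_sub_of_dvd (hk : Module.finrank ℚ k = 2) {σ : k →+* ℝ} (hσ : σ ≠ algebraMap k ℝ)
    {α P R : 𝓞 k} (hα : 1 ≤ |σ (α : k)|) (h : α ^ 2 ∣ 2 * (R - P)) (hne : R ≠ P)
    (hR : |σ (R : k)| ≤ 1) (hP : |σ (P : k)| ≤ 1) :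
    algebraMap (𝓞 k) ℝ α ^ 2 / 8 ≤ |algebraMap (𝓞 k) ℝ R - algebraMap (𝓞 k) ℝ P| := by
  obtain ⟨z, hz⟩ := h
  have hz0 : z ≠ 0 := by
    rintro rfl
    rw [mul_zero, mul_eq_zero] at hz
    exact hz.elim (fun h => two_ne_zero h) fun h => hne (sub_eq_zero.1 h)
  have h1 := one_le_abs_mul_abs_conj hk hσ hz0
  have h2 : 2 * (σ (R : k) - σ (P : k)) = σ (α : k) ^ 2 * σ (z : k) := by
    have := congrArg (σ.comp (algebraMap (𝓞 k) k)) hz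
    simp only [map_sub, map_mul, map_pow, map_ofNat] at this
    exact this
  have h3 : 2 * (algebraMap (𝓞 k) ℝ R - algebraMap (𝓞 k) ℝ P)
      = algebraMap (𝓞 k) ℝ α ^ 2 * algebraMap (𝓞 k) ℝ z := by
    have := congrArg (algebraMap (𝓞 k) ℝ) hz
    simp only [map_sub, map_mul, map_pow, map_ofNat] at this
    exact this
  have h4 : |σ (z : k)| ≤ 4 := by
    have e1 : |σ (α : k) ^ 2 * σ (z : k)| ≤ 4 := by
      rw [← h2, abs_mul, abs_two]
      have := abs_sub (σ (R : k)) (σ (P : k))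
      linarith
    rw [abs_mul, abs_pow] at e1
    have e2 : 1 ≤ |σ (α : k)| ^ 2 := one_le_pow₀ hα
    nlinarith [abs_nonneg (σ (z : k))]
  have h5 : 1 / 4 ≤ |algebraMap (𝓞 k) ℝ z| := by
    by_contra hcon
    push Not at hcon
    nlinarith [abs_nonneg (algebraMap (𝓞 k) ℝ z), abs_nonneg (σ (z : k))]
  have h6 : 2 * |algebraMap (𝓞 k) ℝ R - algebraMap (𝓞 k) ℝ P|
      = algebraMap (𝓞 k) ℝ α ^ 2 * |algebraMap (𝓞 k) ℝ z| := by
    rw [← abs_two, ← abs_mul, h3, abs_mul, abs_of_nonneg (sq_nonneg _)]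
  nlinarith [sq_nonneg (algebraMap (𝓞 k) ℝ α)]

/-- The gap grows like `2T⁴`, whereas `Q` and the target are at most `4T³`; from `T = 10` on the gap
wins comfortably. -/
theorem le_abs_of_sq_div_le {T R Q : ℝ} (hT : 10 ≤ T) (hQ : Q = 1 ∨ Q = 4 * T ^ 3 - 3 * T)
    (h : (4 * T ^ 2 - 1) ^ 2 / 8 ≤ |R - Q|) : 4 * T ^ 3 - 3 * T ≤ |R| := by
  have h1 : |R - Q| ≤ |R| + |Q| := abs_sub R Q
  have hT3 : 0 ≤ T ^ 3 * (T - 10) := by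
    have : 0 ≤ T - 10 := by linarith
    positivity
  have hT2 : 0 ≤ T ^ 2 * (T - 10) := by
    have : 0 ≤ T - 10 := by linarith
    positivity
  have hT1 : 0 ≤ T * (T - 10) := by
    have : 0 ≤ T - 10 := by linarith
    positivity
  rcases hQ with rfl | rfl
  · rw [abs_one] at h1
    nlinarith
  · rw [abs_of_nonneg (by nlinarith : (0 : ℝ) ≤ 4 * T ^ 3 - 3 * T)] at h1
    nlinarith

/-- The nontrivial elements of `Γ_τ(α)` have large real part. -/
theorem le_abs_realPart_of_mem_GamTau (hk : Module.finrank ℚ k = 2) (h : IsAdmissible k w)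
    {σ : k →+* ℝ} (hσ : σ ≠ algebraMap k ℝ) {D : CongruenceLevel k} {T : 𝓞 k}
    (hT : 10 ≤ algebraMap (𝓞 k) ℝ T) (hσT : |σ (T : k)| ≤ 1)
    (hα : D.α = 4 * T ^ 2 - 1) (hσα : 1 ≤ |σ (D.α : k)|)
    (hτ : Ideal.Quotient.mk (Ideal.span {D.α}) (4 * T ^ 3 - 3 * T) = D.τ)
    {r : SpinGrp (realW k w)} (hr : r ∈ GamTau k w D) (hr1 : r ≠ 1) :
    4 * algebraMap (𝓞 k) ℝ T ^ 3 - 3 * algebraMap (𝓞 k) ℝ T ≤ |realPart (realW k w) r.val| := by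
  obtain ⟨hrG, hr⟩ := hr
  have hα0 : D.α ≠ 0 := by
    intro h0
    rw [h0] at hσα
    simp at hσα
    norm_num at hσα
  obtain ⟨R, -, hR⟩ := exists_realPart_eq h.isLorentz.ne_zero hrG
  have hRσ := abs_conj_realPart_le h hσ hrG hR
  rw [hR]
  have hραeq : algebraMap (𝓞 k) ℝ D.α = 4 * algebraMap (𝓞 k) ℝ T ^ 2 - 1 := by
    rw [hα, map_sub, map_mul, map_pow, map_ofNat, map_one]
  have hσP : |σ ((4 * T ^ 3 - 3 * T : 𝓞 k) : k)| ≤ 1 := by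
    have e : σ ((4 * T ^ 3 - 3 * T : 𝓞 k) : k) = 4 * σ (T : k) ^ 3 - 3 * σ (T : k) := by
      change (σ.comp (algebraMap (𝓞 k) k)) (4 * T ^ 3 - 3 * T) = _
      simp only [map_sub, map_mul, map_pow, map_ofNat]
      rfl
    rw [e, ← sq_le_one_iff_abs_le_one]
    have hT1 := (sq_le_one_iff_abs_le_one _).2 hσT
    have e2 : 1 - (4 * σ (T : k) ^ 3 - 3 * σ (T : k)) ^ 2
        = (1 - σ (T : k) ^ 2) * (4 * σ (T : k) ^ 2 - 1) ^ 2 := by ring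
    have := mul_nonneg (sub_nonneg.2 hT1) (sq_nonneg (4 * σ (T : k) ^ 2 - 1))
    linarith
  have hρP : algebraMap (𝓞 k) ℝ (4 * T ^ 3 - 3 * T)
      = 4 * algebraMap (𝓞 k) ℝ T ^ 3 - 3 * algebraMap (𝓞 k) ℝ T := by
    simp only [map_sub, map_mul, map_pow, map_ofNat]
  rcases hr with hr | ⟨t', ht', hr⟩
  · have h1 : r.val - scal k w 1 ∈ coeffIn k w (Ideal.span {D.α}) := by
      rw [scal, map_one, map_one]; exact hr.2
    have h2 := two_mul_realPart_sub_mem h.isLorentz.ne_zero hα0 (P := 1)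
      ⟨0, by ring⟩ h1 hR
    have hne : R ≠ 1 := by
      rintro rfl
      exact hr1 (eq_one_of_realPart_eq_one h hσ hrG (by rw [hR, map_one]))
    have h3 := le_abs_sub_of_dvd hk hσ hσα h2 hne hRσ (by simp)
    rw [hραeq, map_one] at h3
    exact le_abs_of_sq_div_le hT (Or.inl rfl) h3
  · have h1 := congr_change k w hr (ht'.trans hτ.symm)
    -- The witness is the Pell identity `(4T³ - 3T)² - 1 = (T² - 1)(4T² - 1)²` for Chebyshev
    -- polynomials.
    have h2 := two_mul_realPart_sub_mem h.isLorentz.ne_zero hα0 (P := 4 * T ^ 3 - 3 * T)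
      ⟨T ^ 2 - 1, by rw [hα]; ring⟩ h1 hR
    by_cases hne : R = 4 * T ^ 3 - 3 * T
    · rw [hne, hρP]; exact le_abs_self _
    · have h3 := le_abs_sub_of_dvd hk hσ hσα h2 hne hRσ hσP
      rw [hραeq, hρP] at h3
      exact le_abs_of_sq_div_le hT (Or.inr rfl) h3

/-- With `α = 3` the divisibility reads `2 (R - 1) = 9 z`. If `R` were bounded by one at both
places, then `|z| ≤ 4/9` at both, which is impossible for `z ≠ 0`. This makes `Γ(3)` act freely. -/
theorem eq_one_of_mem_GamI_three (hk : Module.finrank ℚ k = 2) (h : IsAdmissible k w)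
    {r : SpinGrp (realW k w)} (hr : r ∈ GamI k w (Ideal.span {3}))
    (hr1 : |realPart (realW k w) r.val| ≤ 1) : r = 1 := by
  obtain ⟨σ, hσ⟩ := exists_embedding_ne hk
  obtain ⟨R, -, hR⟩ := exists_realPart_eq h.isLorentz.ne_zero hr.1
  have hRσ := abs_conj_realPart_le h hσ hr.1 hR
  have h1 : r.val - scal k w 1 ∈ coeffIn k w (Ideal.span {3}) := by
    rw [scal, map_one, map_one]; exact hr.2
  have h2 := two_mul_realPart_sub_mem h.isLorentz.ne_zero (α := 3) (by norm_num) (P := 1)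
      ⟨0, by ring⟩ h1 hR
  by_contra hne
  have hne' : R ≠ 1 := by
    rintro rfl
    exact hne (eq_one_of_realPart_eq_one h hσ hr.1 (by rw [hR, map_one]))
  rw [hR] at hr1
  obtain ⟨z, hz⟩ := h2
  have hz0 : z ≠ 0 := by
    rintro rfl
    rw [mul_zero, mul_eq_zero] at hz
    exact hz.elim (fun h => two_ne_zero h) fun h => hne' (sub_eq_zero.1 h)
  have h4 := one_le_abs_mul_abs_conj hk hσ hz0
  have h5 : 2 * (σ (R : k) - 1) = 3 ^ 2 * σ (z : k) := by
    have := congrArg (σ.comp (algebraMap (𝓞 k) k)) hz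
    simp only [map_sub, map_mul, map_pow, map_ofNat, map_one] at this
    exact this
  have h6 : 2 * (algebraMap (𝓞 k) ℝ R - 1) = 3 ^ 2 * algebraMap (𝓞 k) ℝ z := by
    have := congrArg (algebraMap (𝓞 k) ℝ) hz
    simp only [map_sub, map_mul, map_pow, map_ofNat, map_one] at this
    exact this
  rw [abs_le] at hr1 hRσ
  have h7 : |algebraMap (𝓞 k) ℝ z| ≤ 1 / 2 := by rw [abs_le]; constructor <;> linarith
  have h8 : |σ (z : k)| ≤ 1 / 2 := by rw [abs_le]; constructor <;> linarith
  nlinarith [abs_nonneg (algebraMap (𝓞 k) ℝ z), abs_nonneg (σ (z : k))]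

/-- The pair `(α, τ)` attached to an integer `T` that is large at one real place and small at the
other. -/
theorem exists_congruenceLevel (hk : Module.finrank ℚ k = 2)
    {σ : k →+* ℝ} (hσ : σ ≠ algebraMap k ℝ) {T : 𝓞 k}
    (hT : 10 ≤ algebraMap (𝓞 k) ℝ T) (hσT : |σ (T : k)| ≤ 1)
    (hσα : 1 ≤ |σ ((4 * T ^ 2 - 1 : 𝓞 k) : k)|) :
    ∃ D : CongruenceLevel k, D.α = 4 * T ^ 2 - 1 ∧
      Ideal.Quotient.mk (Ideal.span {D.α}) (4 * T ^ 3 - 3 * T) = D.τ := by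
  have hsq : Ideal.Quotient.mk (Ideal.span {4 * T ^ 2 - 1}) (4 * T ^ 3 - 3 * T)
      * Ideal.Quotient.mk (Ideal.span {4 * T ^ 2 - 1}) (4 * T ^ 3 - 3 * T) = 1 := by
    rw [← map_mul, ← map_one (Ideal.Quotient.mk _), Ideal.Quotient.eq, Ideal.mem_span_singleton]
    exact ⟨(4 * T ^ 2 - 1) * (T ^ 2 - 1), by ring⟩
  refine ⟨⟨4 * T ^ 2 - 1, ⟨_, _, hsq, hsq⟩, ?_⟩, rfl, rfl⟩
  refine orderOf_eq_prime ((pow_two _).trans (Units.ext hsq)) fun h1 => ?_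
  have h2 := congrArg Units.val h1
  change Ideal.Quotient.mk (Ideal.span {4 * T ^ 2 - 1}) (4 * T ^ 3 - 3 * T) = 1 at h2
  rw [← map_one (Ideal.Quotient.mk _), Ideal.Quotient.eq, Ideal.mem_span_singleton] at h2
  obtain ⟨z, hz⟩ := h2
  -- If the class were trivial, cancelling `2T + 1` would make `2T - 1` a unit. It is at least `19`
  -- at the given place, so it would be tiny at `σ`; but `|σ(α)| ≥ 1` with `|2σ(T) + 1| ≤ 3` keeps
  -- it at least `1/3`.
  have h3 : (2 * T + 1) * ((2 * T - 1) * (T - z)) = 2 * T + 1 := by linear_combination hz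
  have h4 : 2 * T + 1 ≠ 0 := by
    intro h0
    have := congrArg (algebraMap (𝓞 k) ℝ) h0
    simp only [map_add, map_mul, map_one, map_ofNat, map_zero] at this
    linarith
  have h5 : (2 * T - 1) * (T - z) = 1 := mul_left_cancel₀ h4 (h3.trans (mul_one _).symm)
  have h6 : T - z ≠ 0 := by
    intro h0
    rw [h0, mul_zero] at h5
    exact zero_ne_one h5
  have h7 := one_le_abs_mul_abs_conj hk hσ h6
  have e1 : (2 * algebraMap (𝓞 k) ℝ T - 1) * algebraMap (𝓞 k) ℝ (T - z) = 1 := by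
    have := congrArg (algebraMap (𝓞 k) ℝ) h5
    rwa [map_mul, map_sub, map_mul, map_one, map_ofNat] at this
  have e2 : (2 * σ (T : k) - 1) * σ ((T - z : 𝓞 k) : k) = 1 := by
    have := congrArg (σ.comp (algebraMap (𝓞 k) k)) h5
    rwa [map_mul, map_sub, map_mul, map_one, map_ofNat] at this
  have e3 : σ ((4 * T ^ 2 - 1 : 𝓞 k) : k) = (2 * σ (T : k) - 1) * (2 * σ (T : k) + 1) := by
    have : σ ((4 * T ^ 2 - 1 : 𝓞 k) : k) = 4 * σ (T : k) ^ 2 - 1 := by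
      change (σ.comp (algebraMap (𝓞 k) k)) (4 * T ^ 2 - 1) = _
      simp only [map_sub, map_mul, map_pow, map_ofNat, map_one]
      rfl
    rw [this]; ring
  rw [e3, abs_mul] at hσα
  have e4 : |2 * σ (T : k) + 1| ≤ 3 := by
    rw [abs_le] at hσT ⊢; constructor <;> linarith
  have e5 : 1 / 3 ≤ |2 * σ (T : k) - 1| := by
    by_contra hcon
    push Not at hcon
    nlinarith [abs_nonneg (2 * σ (T : k) - 1), abs_nonneg (2 * σ (T : k) + 1)]
  have e6 : |2 * algebraMap (𝓞 k) ℝ T - 1| * |algebraMap (𝓞 k) ℝ (T - z)| = 1 := by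
    rw [← abs_mul, e1, abs_one]
  have e7 : |2 * σ (T : k) - 1| * |σ ((T - z : 𝓞 k) : k)| = 1 := by
    rw [← abs_mul, e2, abs_one]
  have e8 : 19 ≤ |2 * algebraMap (𝓞 k) ℝ T - 1| := by
    rw [abs_of_nonneg (by linarith)]; linarith
  have e9 : |σ ((T - z : 𝓞 k) : k)| ≤ 3 := by
    by_contra hcon
    push Not at hcon
    nlinarith
  have e10 : |algebraMap (𝓞 k) ℝ (T - z)| ≤ 1 / 19 := by
    by_contra hcon
    push Not at hcon
    nlinarith
  nlinarith [abs_nonneg (algebraMap (𝓞 k) ℝ (T - z)), abs_nonneg (σ ((T - z : 𝓞 k) : k))]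

end Integral

/-! ### Minkowski's theorem for linear forms and bounded spanning sets -/

section Minkowski

variable {ι : Type*} [Fintype ι] [DecidableEq ι]

/-- Minkowski's theorem on linear forms. -/
theorem exists_int_vec_abs_lt (M : Matrix ι ι ℝ) (hM : M.det ≠ 0) (s : ι → ℝ)
    (hs : ∀ i, 0 < s i) (h : |M.det| < ∏ i, s i) :
    ∃ m : ι → ℤ, m ≠ 0 ∧ ∀ i, |M.mulVec (fun j => (m j : ℝ)) i| < s i := by
  set B : Set (ι → ℝ) := Set.pi Set.univ fun i => Set.Ioo (-s i) (s i) with hB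
  set f : (ι → ℝ) →ₗ[ℝ] (ι → ℝ) := Matrix.toLin' M with hf
  have hdet : LinearMap.det f = M.det := LinearMap.det_toLin' M
  -- The box pulled back by `M` has volume `2^d ∏ s_i / |det M|`, which exceeds `2^d` times the
  -- covolume of the integer lattice.
  have hvol : MeasureTheory.volume (f ⁻¹' B)
      = ENNReal.ofReal (|M.det|⁻¹ * (2 ^ Fintype.card ι * ∏ i, s i)) := by
    rw [MeasureTheory.Measure.addHaar_preimage_linearMap _ (by rwa [hdet]), hB,
      Real.volume_pi_Ioo, ← ENNReal.ofReal_prod_of_nonneg (fun i _ => by linarith [hs i]),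
      ← ENNReal.ofReal_mul (abs_nonneg _), hdet, abs_inv]
    congr 2
    rw [← Finset.card_univ, ← Finset.prod_const, ← Finset.prod_mul_distrib]
    exact Finset.prod_congr rfl fun i _ => by ring
  have fund := ZSpan.isAddFundamentalDomain' (Pi.basisFun ℝ ι) MeasureTheory.volume
  have hfv : MeasureTheory.volume (ZSpan.fundamentalDomain (Pi.basisFun ℝ ι)) = 1 := by
    rw [ZSpan.fundamentalDomain_pi_basisFun, MeasureTheory.volume_pi, MeasureTheory.Measure.pi_pi]
    simp
  have hconv : Convex ℝ (f ⁻¹' B) :=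
    (convex_pi fun i _ => convex_Ioo _ _).linear_preimage f
  have hsymm : ∀ x ∈ f ⁻¹' B, -x ∈ f ⁻¹' B := by
    intro x hx i hi
    have := hx i hi
    rw [map_neg]
    exact ⟨by have := this.2; simp only [Pi.neg_apply]; linarith,
      by have := this.1; simp only [Pi.neg_apply]; linarith⟩
  have hlt : MeasureTheory.volume (ZSpan.fundamentalDomain (Pi.basisFun ℝ ι))
      * 2 ^ Module.finrank ℝ (ι → ℝ) < MeasureTheory.volume (f ⁻¹' B) := by
    rw [hfv, hvol, one_mul, Module.finrank_fintype_fun_eq_card,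
      show (2 : ENNReal) ^ Fintype.card ι = ENNReal.ofReal (2 ^ Fintype.card ι) by
        rw [ENNReal.ofReal_pow (by norm_num)]; norm_num]
    have h0 : 0 < |M.det| := abs_pos.2 hM
    have h2 : (0 : ℝ) < 2 ^ Fintype.card ι := by positivity
    refine (ENNReal.ofReal_lt_ofReal_iff_of_nonneg h2.le).2 ?_
    rw [inv_mul_eq_div, lt_div_iff₀ h0]
    exact mul_lt_mul_of_pos_left h h2
  have : Countable (Submodule.span ℤ (Set.range (Pi.basisFun ℝ ι))).toAddSubgroup :=
    inferInstanceAs (Countable (Submodule.span ℤ (Set.range (Pi.basisFun ℝ ι))))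
  obtain ⟨x, hx0, hx⟩ :=
    MeasureTheory.exists_ne_zero_mem_lattice_of_measure_mul_two_pow_lt_measure fund hsymm hconv hlt
  have hxm : (x : ι → ℝ) ∈ Submodule.span ℤ (Set.range (Pi.basisFun ℝ ι)) := x.2
  rw [Module.Basis.mem_span_iff_repr_mem] at hxm
  choose m hm using hxm
  have hxe : (x : ι → ℝ) = fun j => (m j : ℝ) := by
    funext j
    have := hm j
    simpa using this.symm
  refine ⟨m, ?_, fun i => ?_⟩
  · rintro rfl
    apply hx0
    ext j
    rw [hxe]; simp
  · have := hx i (Set.mem_univ i)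
    rw [hf, Matrix.toLin'_apply, hxe] at this
    exact abs_lt.2 this

/-- If the lattice `M ℤ^ι` has no short vectors, then its vectors of bounded length span, with a
bound that depends on `M` only through its determinant. -/
theorem exists_bound_span_eq_top (r D : ℝ) (hr : 0 < r) (hD : 0 < D) : ∃ R : ℝ, 0 ≤ R ∧
    ∀ M : Matrix ι ι ℝ, |M.det| = D →
      (∀ m : ι → ℤ, (∀ i, |M.mulVec (fun j => (m j : ℝ)) i| < r) → m = 0) →
      Submodule.span ℝ {y : ι → ℝ | ∃ m : ι → ℤ, y = M.mulVec (fun j => (m j : ℝ)) ∧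
        ∀ i, |y i| ≤ R} = ⊤ := by
  set d : ℝ := (Fintype.card ι : ℝ) with hd
  have hd0 : 0 ≤ d := by positivity
  -- Small enough that `d` coordinates of size `e` sum to less than `r`.
  set e : ℝ := r / (d + 1) with he
  have he0 : 0 < e := by positivity
  -- Chosen so that the box with one side `S` and the others `e` has side product `D + 1 > |det M|`.
  set S : ℝ := (D + 1) / e ^ (Fintype.card ι - 1) with hS
  have hS0 : 0 < S := by positivity
  refine ⟨S + r, by positivity, fun M hM hshort => ?_⟩
  by_contra hne
  set U := Submodule.span ℝ {y : ι → ℝ | ∃ m : ι → ℤ, y = M.mulVec (fun j => (m j : ℝ)) ∧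
        ∀ i, |y i| ≤ S + r} with hU
  -- If the bounded vectors lie in a hyperplane `φ = 0`, scale `φ` so that its largest coefficient
  -- is `1`, at `i0`, and use `φ` in place of that coordinate. Minkowski's theorem gives a nonzero
  -- lattice vector with all other coordinates below `e`; it is bounded, so `φ` vanishes on it, and
  -- the coordinate at `i0` is a combination of the small ones. The vector is then short, a
  -- contradiction.
  obtain ⟨φ, hφ0, hφ⟩ := Submodule.exists_le_ker_of_lt_top U (lt_top_iff_ne_top.2 hne)
  set c : ι → ℝ := fun i => φ (Pi.single i 1) with hc
  have hφc : ∀ y, φ y = ∑ i, c i * y i := by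
    intro y
    rw [LinearMap.pi_apply_eq_sum_univ φ y]
    exact Finset.sum_congr rfl fun i _ => by
      rw [smul_eq_mul, mul_comm]
      congr 2
      funext j
      simp [Pi.single_apply, eq_comm]
  obtain ⟨i1, hi1⟩ : ∃ i, c i ≠ 0 := by
    by_contra hcon
    push Not at hcon
    apply hφ0
    ext y
    simp [hφc, hcon]
  have : Nonempty ι := ⟨i1⟩
  obtain ⟨i0, hi0⟩ := Finite.exists_max fun i => |c i|
  have hci0 : 0 < |c i0| := (abs_pos.2 hi1).trans_le (hi0 i1)
  have hci0' : c i0 ≠ 0 := abs_pos.1 hci0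
  set c' : ι → ℝ := fun i => c i / c i0 with hc'
  have hc'le : ∀ i, |c' i| ≤ 1 := fun i => by
    rw [hc', abs_div, div_le_one hci0]; exact hi0 i
  have hc'0 : c' i0 = 1 := div_self hci0'
  set E : Matrix ι ι ℝ := (1 : Matrix ι ι ℝ).updateRow i0 c' with hE
  have hEdet : E.det = 1 := by
    have h1 : c' = ∑ i, c' i • (1 : Matrix ι ι ℝ) i := by
      funext j
      simp [Matrix.one_apply]
    rw [hE, h1, Matrix.det_updateRow_sum, hc'0, one_smul, Matrix.det_one]
  have hEi0 : ∀ y, E.mulVec y i0 = ∑ i, c' i * y i := fun y => by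
    rw [hE, Matrix.mulVec, Matrix.updateRow_self]; rfl
  have hEi : ∀ y i, i ≠ i0 → E.mulVec y i = y i := fun y i hi => by
    have : E.mulVec y i = (1 : Matrix ι ι ℝ).mulVec y i := by
      rw [Matrix.mulVec, Matrix.mulVec, hE, Matrix.updateRow_ne hi]
    rw [this, Matrix.one_mulVec]
  set s : ι → ℝ := fun i => if i = i0 then S else e with hs
  have hprod : ∏ i, s i = D + 1 := by
    rw [← Finset.mul_prod_erase Finset.univ s (Finset.mem_univ i0)]
    have : ∏ i ∈ Finset.univ.erase i0, s i = e ^ (Fintype.card ι - 1) := by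
      rw [Finset.prod_congr rfl (g := fun _ => e) (fun i hi => by
        simp [hs, Finset.ne_of_mem_erase hi]), Finset.prod_const,
        Finset.card_erase_of_mem (Finset.mem_univ _), Finset.card_univ]
    rw [this]
    simp only [hs, if_true, hS]
    field_simp
  have hdetEM : |(E * M).det| = D := by rw [Matrix.det_mul, hEdet, one_mul, hM]
  obtain ⟨m, hm0, hm⟩ := exists_int_vec_abs_lt (E * M)
    (by intro h0; rw [h0, abs_zero] at hdetEM; linarith) s
    (fun i => by simp only [hs]; split_ifs <;> assumption)
    (by rw [hdetEM, hprod]; linarith)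
  set y := M.mulVec (fun j => (m j : ℝ)) with hy
  have hyE : ∀ i, |E.mulVec y i| < s i := fun i => by
    rw [hy, Matrix.mulVec_mulVec]; exact hm i
  have hyi : ∀ i, i ≠ i0 → |y i| < e := fun i hi => by
    have := hyE i
    rw [hEi y i hi] at this
    simpa [hs, hi] using this
  have hed : d * e < r := by
    rw [he, ← mul_div_assoc, div_lt_iff₀ (by positivity)]
    nlinarith
  have her : e ≤ r := by
    rw [he, div_le_iff₀ (by positivity)]; nlinarith
  have hsplit : ∑ i, c' i * y i = y i0 + ∑ i ∈ Finset.univ.erase i0, c' i * y i := by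
    rw [← Finset.add_sum_erase _ _ (Finset.mem_univ i0), hc'0, one_mul]
  have hrest : |∑ i ∈ Finset.univ.erase i0, c' i * y i| < r := by
    refine lt_of_le_of_lt ?_ hed
    calc _ ≤ ∑ i ∈ Finset.univ.erase i0, |c' i * y i| := Finset.abs_sum_le_sum_abs _ _
      _ ≤ ∑ i ∈ Finset.univ.erase i0, e := Finset.sum_le_sum fun i hi => by
          rw [abs_mul]
          calc |c' i| * |y i| ≤ 1 * e := by
                gcongr
                · exact hc'le i
                · exact (hyi i (Finset.ne_of_mem_erase hi)).le
            _ = e := one_mul e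
      _ ≤ d * e := by
          rw [Finset.sum_const, nsmul_eq_mul]
          gcongr
          rw [hd, ← Finset.card_univ]
          exact_mod_cast Finset.card_erase_le
  have hy0 : |y i0| ≤ S + r := by
    have h1 := hyE i0
    rw [hEi0, hsplit] at h1
    simp only [hs, if_true] at h1
    rw [abs_lt] at h1 hrest
    rw [abs_le]
    constructor <;> linarith
  have hyU : y ∈ U := Submodule.subset_span ⟨m, rfl, fun i => by
    by_cases hi : i = i0
    · rw [hi]; exact hy0
    · exact ((hyi i hi).le.trans her).trans (by linarith)⟩
  have hφy : ∑ i, c' i * y i = 0 := by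
    have h1 : φ y = 0 := hφ hyU
    rw [hφc] at h1
    have : ∑ i, c' i * y i = (∑ i, c i * y i) / c i0 := by
      rw [Finset.sum_div]
      exact Finset.sum_congr rfl fun i _ => by rw [hc']; ring
    rw [this, h1, zero_div]
  refine hm0 (hshort m fun i => ?_)
  by_cases hi : i = i0
  · rw [hi]
    rw [hsplit] at hφy
    have : y i0 = - ∑ i ∈ Finset.univ.erase i0, c' i * y i := by linarith
    rw [← hy, this, abs_neg]
    exact hrest
  · exact (hyi i hi).trans_le her

end Minkowski

/-! ### Invariant forms on the Clifford algebra -/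

section InvariantForms

variable {n : ℕ} {w : Fin (n + 1) → ℝ}

/-- The elements `e_M` as a basis of the Clifford algebra. -/
def clBasis (hw : ∀ i, w i ≠ 0) : Module.Basis (Finset (Fin (n + 1))) ℝ (Cl w) :=
  Module.Basis.ofEquivFun
    { toFun := fun c M => coef w M c
      map_add' := fun c d => by funext M; exact map_add _ c d
      map_smul' := fun r c => by funext M; exact map_smul _ r c
      invFun := fun a => ∑ M, a M • genProd w M
      left_inv := fun c => sum_coef_smul hw c
      right_inv := fun a => by
        funext M
        have := coef_sum_smul hw Finset.univ a M
        simpa using this }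

theorem clBasis_apply (hw : ∀ i, w i ≠ 0) (M : Finset (Fin (n + 1))) :
    clBasis hw M = genProd w M := by
  apply ext_coef hw
  intro N
  rw [coef_genProd hw, clBasis, Module.Basis.coe_ofEquivFun]
  have := coef_sum_smul hw Finset.univ (Function.update (fun _ => (0 : ℝ)) M 1) N
  refine this.trans ?_
  simp [Function.update_apply, eq_comm]

/-- The trace form `(x, y) ↦ Re (x y^*)`. -/
def trForm (w : Fin (n + 1) → ℝ) : Cl w →ₗ[ℝ] Cl w →ₗ[ℝ] ℝ :=
  LinearMap.mk₂ ℝ (fun x y => realPart w (x * CliffordAlgebra.reverse y))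
    (fun x x' y => by rw [add_mul, ← realPartLin_apply, map_add]; rfl)
    (fun r x y => by rw [smul_mul_assoc, ← realPartLin_apply, map_smul]; rfl)
    (fun x y y' => by rw [map_add, mul_add, ← realPartLin_apply, map_add]; rfl)
    (fun r x y => by rw [map_smul, mul_smul_comm, ← realPartLin_apply, map_smul]; rfl)

theorem trForm_apply (x y : Cl w) :
    trForm w x y = realPart w (x * CliffordAlgebra.reverse y) := rfl

theorem trForm_eq_sum (hw : ∀ i, w i ≠ 0) (x y : Cl w) :
    trForm w x y = ∑ M, coef w M x * coef w M y * wprod w M := realPart_mul_reverse hw x y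

theorem trForm_genProd_right (hw : ∀ i, w i ≠ 0) (x : Cl w) (M : Finset (Fin (n + 1))) :
    trForm w x (genProd w M) = coef w M x * wprod w M := by
  simp [trForm_eq_sum hw, coef_genProd hw]

theorem eq_of_trForm_eq (hw : ∀ i, w i ≠ 0) {x y : Cl w} (h : ∀ z, trForm w x z = trForm w y z) :
    x = y :=
  ext_coef hw fun M => by
    have := h (genProd w M)
    rw [trForm_genProd_right hw, trForm_genProd_right hw] at this
    exact mul_right_cancel₀ (wprod_ne_zero hw M) this

theorem eq_of_trForm_eq_left (hw : ∀ i, w i ≠ 0) {x y : Cl w}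
    (h : ∀ z, trForm w z x = trForm w z y) : x = y :=
  eq_of_trForm_eq hw fun z => by
    have := h z
    rw [trForm_eq_sum hw, trForm_eq_sum hw] at this ⊢
    simpa only [mul_comm (coef w _ z)] using this

/-- The vector part, in terms of coordinates. -/
def vecCoef (w : Fin (n + 1) → ℝ) : Cl w →ₗ[ℝ] (Fin (n + 1) → ℝ) :=
  LinearMap.pi fun i => coef w {i}

theorem vecCoef_apply (c : Cl w) (i : Fin (n + 1)) : vecCoef w c i = coef w {i} c := rfl

theorem vecCoef_vec (hw : ∀ i, w i ≠ 0) (v : Fin (n + 1) → ℝ) : vecCoef w (vec w v) = v := by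
  funext i
  rw [vecCoef_apply, vec_eq_sum w v, map_sum, Finset.sum_eq_single i]
  · rw [map_smul, ← genProd_singleton, coef_genProd hw]; simp
  · intro j _ hj
    rw [map_smul, ← genProd_singleton, coef_genProd hw]; simp [hj]
  · simp

/-- The vector part is the adjoint of the inclusion of `E` with respect to the trace form. -/
theorem bil_vecCoef (hw : ∀ i, w i ≠ 0) (c : Cl w) (v : Fin (n + 1) → ℝ) :
    bil w v (vecCoef w c) = realPart w (c * vec w v) := by
  have h1 : realPart w (c * vec w v) = trForm w c (vec w v) := by
    rw [trForm_apply, CliffordAlgebra.reverse_ι]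
  rw [h1]
  conv_rhs => rw [vec_eq_sum w v]
  rw [map_sum]
  refine Finset.sum_congr rfl fun i _ => ?_
  rw [map_smul, ← genProd_singleton, trForm_genProd_right hw, vecCoef_apply, smul_eq_mul,
    wprod, Finset.prod_singleton]
  ring

theorem eq_of_bil_eq (hw : ∀ i, w i ≠ 0) {x y : Fin (n + 1) → ℝ}
    (h : ∀ v, bil w v x = bil w v y) : x = y := by
  funext i
  have := h (Pi.single i 1)
  simp only [bil, Pi.single_apply] at this
  simpa [hw i] using this

/-- Equivariance passes from the inclusion of `E` to its adjoint, because conjugation preserves the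
trace form. -/
theorem vecCoef_conj (hw : ∀ i, w i ≠ 0) (h : SpinGrp w) (c : Cl w) :
    vecCoef w (h.val * c * CliffordAlgebra.reverse h.val) = act h (vecCoef w c) := by
  refine eq_of_bil_eq hw fun v => ?_
  rw [← act_act_inv h v, bil_act, bil_vecCoef hw, bil_vecCoef hw, vec_act]
  have e : h.val * c * CliffordAlgebra.reverse h.val
      * (h.val * vec w (act h⁻¹ v) * CliffordAlgebra.reverse h.val)
      = h.val * (c * ((CliffordAlgebra.reverse h.val * h.val) * vec w (act h⁻¹ v))
        * CliffordAlgebra.reverse h.val) := by simp only [mul_assoc]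
  rw [e, realPart_mul_comm hw, reverse_mul_val, one_mul, mul_assoc, reverse_mul_val, mul_one]

theorem coef_involute (hw : ∀ i, w i ≠ 0) (M : Finset (Fin (n + 1))) (c : Cl w) :
    coef w M (CliffordAlgebra.involute c) = (-1) ^ M.card * coef w M c := by
  have key : ∀ N : Finset (Fin (n + 1)), CliffordAlgebra.involute (genProd w N)
      = (-1 : ℝ) ^ N.card • genProd w N := by
    intro N
    have : ∀ l : List (Fin (n + 1)), CliffordAlgebra.involute ((l.map (gen w)).prod)
        = (-1 : ℝ) ^ l.length • (l.map (gen w)).prod := by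
      intro l
      induction l with
      | nil => simp
      | cons a l ih =>
        rw [List.map_cons, List.prod_cons, map_mul, ih, gen, CliffordAlgebra.involute_ι,
          List.length_cons, pow_succ, mul_smul_comm, neg_mul, mul_neg_one, smul_neg, neg_smul]
    rw [genProd, this, Finset.length_sort]
  conv_lhs => rw [← sum_coef_smul hw c]
  rw [map_sum, map_sum, Finset.sum_eq_single M]
  · rw [map_smul, key, map_smul, map_smul, coef_genProd hw]
    simp [mul_comm]
  · intro N _ hN
    rw [map_smul, key, map_smul, map_smul, coef_genProd hw]
    simp [hN]
  · simp

/-- The trace form twisted by the grade involution. -/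
def twForm (w : Fin (n + 1) → ℝ) : Cl w →ₗ[ℝ] Cl w →ₗ[ℝ] ℝ :=
  (trForm w).compl₂ (CliffordAlgebra.involute (Q := form w)).toLinearMap

theorem twForm_apply (x y : Cl w) : twForm w x y = trForm w x (CliffordAlgebra.involute y) := rfl

/-- The trace form twisted by the right multiplication by a generator. -/
def genForm (w : Fin (n + 1) → ℝ) (i : Fin (n + 1)) : Cl w →ₗ[ℝ] Cl w →ₗ[ℝ] ℝ :=
  (trForm w).compl₂ (LinearMap.mulRight ℝ (gen w i))

theorem genForm_apply (i : Fin (n + 1)) (x y : Cl w) :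
    genForm w i x y = trForm w x (y * gen w i) := rfl

/-- The vector part of `x y^*`. -/
def vecForm (w : Fin (n + 1) → ℝ) : Cl w →ₗ[ℝ] Cl w →ₗ[ℝ] (Fin (n + 1) → ℝ) :=
  LinearMap.mk₂ ℝ (fun x y => vecCoef w (x * CliffordAlgebra.reverse y))
    (fun x x' y => by rw [add_mul, map_add])
    (fun r x y => by rw [smul_mul_assoc, map_smul])
    (fun x y y' => by rw [map_add, mul_add, map_add])
    (fun r x y => by rw [map_smul, mul_smul_comm, map_smul])

theorem vecForm_apply (x y : Cl w) :
    vecForm w x y = vecCoef w (x * CliffordAlgebra.reverse y) := rfl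

/-- The bilinear form of `E` as a linear map. -/
def bilLin (w : Fin (n + 1) → ℝ) : (Fin (n + 1) → ℝ) →ₗ[ℝ] (Fin (n + 1) → ℝ) →ₗ[ℝ] ℝ :=
  LinearMap.mk₂ ℝ (bil w) (fun x y z => bil_add_left x y z) (fun a x z => bil_smul_left a x z)
    (fun z x y => bil_add_right x y z) (fun a z x => bil_smul_right a x z)

theorem trForm_val_mul (hw : ∀ i, w i ≠ 0) (h : SpinGrp w) (x y : Cl w) :
    trForm w (h.val * x) (h.val * y) = trForm w x y := by
  rw [trForm_apply, trForm_apply, CliffordAlgebra.reverse.map_mul, mul_assoc,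
    realPart_mul_comm hw, mul_assoc, mul_assoc, reverse_mul_val, mul_one]

theorem twForm_val_mul (hw : ∀ i, w i ≠ 0) (h : SpinGrp w) (x y : Cl w) :
    twForm w (h.val * x) (h.val * y) = twForm w x y := by
  rw [twForm_apply, twForm_apply, map_mul CliffordAlgebra.involute h.val, CliffordAlgebra.involute_eq_of_mem_even h.isSpin.1,
    trForm_val_mul hw]

theorem genForm_val_mul (hw : ∀ i, w i ≠ 0) (h : SpinGrp w) (i : Fin (n + 1)) (x y : Cl w) :
    genForm w i (h.val * x) (h.val * y) = genForm w i x y := by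
  rw [genForm_apply, genForm_apply, mul_assoc, trForm_val_mul hw]

theorem bil_vecForm_val_mul (hw : ∀ i, w i ≠ 0) (h : SpinGrp w) (x y x' y' : Cl w) :
    bil w (vecForm w (h.val * x) (h.val * y)) (vecForm w (h.val * x') (h.val * y'))
      = bil w (vecForm w x y) (vecForm w x' y') := by
  have e : ∀ x y, vecForm w (h.val * x) (h.val * y) = act h (vecForm w x y) := fun x y => by
    rw [vecForm_apply, vecForm_apply, ← vecCoef_conj hw, CliffordAlgebra.reverse.map_mul]
    simp only [mul_assoc]
  rw [e, e, bil_act]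

/-- A linear map that commutes with right multiplication by the generators commutes with all right
multiplications, so its value at `1` determines it. -/
theorem mul_eq_of_gen_mul {g : Cl w →ₗ[ℝ] Cl w}
    (h : ∀ y i, g (y * gen w i) = g y * gen w i) (y : Cl w) : g y = g 1 * y := by
  have key : ∀ l : List (Fin (n + 1)), ∀ y, g (y * (l.map (gen w)).prod)
      = g y * (l.map (gen w)).prod := by
    intro l
    induction l with
    | nil => simp
    | cons a l ih =>
      intro y
      rw [List.map_cons, List.prod_cons, ← mul_assoc, ih, h, mul_assoc]
  have hy : y ∈ Submodule.span ℝ (Set.range (genProd w)) := by rw [span_genProd]; trivial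
  induction hy using Submodule.span_induction with
  | mem x hx =>
    obtain ⟨M, rfl⟩ := hx
    have := key (M.sort (· ≤ ·)) 1
    rwa [one_mul] at this
  | zero => simp
  | add a b _ _ ha hb => rw [map_add, ha, hb, mul_add]
  | smul r a _ ha => rw [map_smul, ha, mul_smul_comm]

/-- Two bases with the same invariants differ by an element of the spin group. -/
theorem exists_spin_mul_eq (hw : ∀ i, w i ≠ 0) {J : Type*} (b b' : Module.Basis J ℝ (Cl w))
    (h1 : ∀ i j, trForm w (b i) (b j) = trForm w (b' i) (b' j))
    (h2 : ∀ i j, twForm w (b i) (b j) = twForm w (b' i) (b' j))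
    (h3 : ∀ a i j, genForm w a (b i) (b j) = genForm w a (b' i) (b' j))
    (h4 : ∀ i j p q, bil w (vecForm w (b i) (b j)) (vecForm w (b p) (b q))
      = bil w (vecForm w (b' i) (b' j)) (vecForm w (b' p) (b' q))) :
    ∃ u : SpinGrp w, ∀ j, u.val * b j = b' j := by
  -- The linear map carrying one basis to the other preserves each of the four kinds of invariants,
  -- by multilinearity. These are chosen so that together they characterise left multiplication by
  -- an element of the spin group.
  set g : Cl w ≃ₗ[ℝ] Cl w := b.equiv b' (Equiv.refl J) with hg
  have hgb : ∀ j, g (b j) = b' j := fun j => by simp [hg]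
  have ext2 : ∀ β : Cl w →ₗ[ℝ] Cl w →ₗ[ℝ] ℝ, (∀ i j, β (b i) (b j) = β (b' i) (b' j)) →
      ∀ x y, β x y = β (g x) (g y) := by
    intro β hβ x y
    have : β = β.compl₁₂ g.toLinearMap g.toLinearMap :=
      LinearMap.ext_basis b b fun i j => by
        rw [LinearMap.compl₁₂_apply]
        simp only [LinearEquiv.coe_coe, hgb]
        exact hβ i j
    exact congrArg (fun γ : Cl w →ₗ[ℝ] Cl w →ₗ[ℝ] ℝ => γ x y) this
  have g1 := ext2 _ h1
  have g2 := ext2 _ h2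
  have g3 := fun a => ext2 _ (h3 a)
  have g4 : ∀ x y x' y', bil w (vecForm w x y) (vecForm w x' y')
      = bil w (vecForm w (g x) (g y)) (vecForm w (g x') (g y')) := by
    have s1 : ∀ i j x' y', bil w (vecForm w (b i) (b j)) (vecForm w x' y')
        = bil w (vecForm w (b' i) (b' j)) (vecForm w (g x') (g y')) := by
      intro i j x' y'
      have : (vecForm w).compr₂ (bilLin w (vecForm w (b i) (b j)))
          = ((vecForm w).compr₂ (bilLin w (vecForm w (b' i) (b' j)))).compl₁₂
            g.toLinearMap g.toLinearMap := by
        refine LinearMap.ext_basis b b fun p q => ?_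
        rw [LinearMap.compl₁₂_apply]
        simp only [LinearEquiv.coe_coe, hgb]
        exact h4 i j p q
      exact congrArg (fun γ : Cl w →ₗ[ℝ] Cl w →ₗ[ℝ] ℝ => γ x' y') this
    intro x y x' y'
    have : (vecForm w).compr₂ ((bilLin w).flip (vecForm w x' y'))
        = ((vecForm w).compr₂ ((bilLin w).flip (vecForm w (g x') (g y')))).compl₁₂
            g.toLinearMap g.toLinearMap := by
      refine LinearMap.ext_basis b b fun p q => ?_
      rw [LinearMap.compl₁₂_apply]
      simp only [LinearEquiv.coe_coe, hgb]
      exact s1 p q x' y'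
    exact congrArg (fun γ : Cl w →ₗ[ℝ] Cl w →ₗ[ℝ] ℝ => γ x y) this
  -- Preserving both `trForm` and `genForm` makes `g (y e_i)` and `g y · e_i` have the same trace
  -- products with all `g z`, so they agree by nondegeneracy.
  have hmul : ∀ y, g y = g 1 * y := by
    refine mul_eq_of_gen_mul (g := g.toLinearMap) fun y i => eq_of_trForm_eq_left hw fun z => ?_
    obtain ⟨z, rfl⟩ := g.surjective z
    have e1 := g1 z (y * gen w i)
    have e2 := g3 i z y
    rw [genForm_apply, genForm_apply] at e2
    exact e1.symm.trans e2
  set u := g 1 with hu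
  have hru : CliffordAlgebra.reverse u * u = 1 := by
    refine eq_of_trForm_eq hw fun z => ?_
    have := g1 1 z
    rw [hmul 1, hmul z, trForm_apply, trForm_apply, CliffordAlgebra.reverse.map_mul, mul_one] at this
    rw [trForm_apply, trForm_apply, this, mul_assoc, realPart_mul_comm hw, mul_assoc]
  have hur : u * CliffordAlgebra.reverse u = 1 := by
    obtain ⟨c, hc⟩ := g.surjective 1
    rw [hmul] at hc
    have : CliffordAlgebra.reverse u = c := by
      rw [← mul_one (CliffordAlgebra.reverse u), ← hc, ← mul_assoc, hru, one_mul]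
    rw [this, hc]
  -- Preservation of the twisted trace form is what detects evenness of `u`.
  have hinv : CliffordAlgebra.involute u = u := by
    refine eq_of_trForm_eq_left hw fun z => ?_
    obtain ⟨z, rfl⟩ := g.surjective z
    have := g2 z 1
    rw [twForm_apply, twForm_apply, map_one, g1, ← hu] at this
    exact this.symm
  have heven : u ∈ CliffordAlgebra.evenOdd (form w) 0 := by
    rw [mem_even_iff hw]
    intro M hM
    have h5 := coef_involute hw M u
    rw [hinv, (Nat.not_even_iff_odd.1 hM).neg_one_pow] at h5
    linarith
  have hvec : ∀ x, ∃ y, u * vec w x * CliffordAlgebra.reverse u = vec w y := by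
    -- Since `φ` is an isometry on vector parts, `u* d u` has no vector part when `d` has none. By
    -- the trace property `u x u*` is then orthogonal to every element without vector part, hence is
    -- itself a vector.
    set φ : Cl w → Cl w := fun c => u * c * CliffordAlgebra.reverse u with hφ
    have hQ : ∀ c c', bil w (vecCoef w (φ c)) (vecCoef w (φ c')) = bil w (vecCoef w c) (vecCoef w c') := by
      intro c c'
      have := g4 c 1 c' 1
      simp only [hmul c, hmul c', ← hu, vecForm_apply, CliffordAlgebra.reverse.map_one,
        mul_one] at this
      exact this.symm
    have hφinv : ∀ d, φ (CliffordAlgebra.reverse u * d * u) = d := fun d => by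
      simp only [hφ]
      calc _ = (u * CliffordAlgebra.reverse u) * d * (u * CliffordAlgebra.reverse u) := by
            simp only [mul_assoc]
        _ = d := by rw [hur, one_mul, mul_one]
    set A : (Fin (n + 1) → ℝ) →ₗ[ℝ] (Fin (n + 1) → ℝ) := vecCoef w ∘ₗ
      LinearMap.mulRight ℝ (CliffordAlgebra.reverse u) ∘ₗ LinearMap.mulLeft ℝ u ∘ₗ vec w with hA
    have hAx : ∀ x, A x = vecCoef w (φ (vec w x)) := fun x => rfl
    have hAinj : Function.Injective A := by
      intro x y hxy
      refine eq_of_bil_eq hw fun v => ?_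
      have e1 := hQ (vec w v) (vec w x)
      have e2 := hQ (vec w v) (vec w y)
      rw [vecCoef_vec hw, vecCoef_vec hw] at e1 e2
      rw [← e1, ← e2, ← hAx x, ← hAx y, hxy]
    have hker : ∀ d, vecCoef w d = 0 → vecCoef w (CliffordAlgebra.reverse u * d * u) = 0 := by
      intro d hd
      refine eq_of_bil_eq hw fun v => ?_
      have e1 := hQ (vec w v) (CliffordAlgebra.reverse u * d * u)
      rw [hφinv, hd, vecCoef_vec hw] at e1
      rw [← e1]
      simp [bil]
    intro x
    refine ⟨A x, eq_of_trForm_eq_left hw fun z => ?_⟩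
    set z' := z - vec w (vecCoef w z) with hz'
    have hz'0 : vecCoef w z' = 0 := by rw [hz', map_sub, vecCoef_vec hw, sub_self]
    have e0 : ∀ v : Fin (n + 1) → ℝ, CliffordAlgebra.reverse (u * vec w v * CliffordAlgebra.reverse u)
        = u * vec w v * CliffordAlgebra.reverse u := fun v => by
      rw [CliffordAlgebra.reverse.map_mul, CliffordAlgebra.reverse.map_mul,
        CliffordAlgebra.reverse_reverse, CliffordAlgebra.reverse_ι, mul_assoc]
    have e1 : trForm w z' (u * vec w x * CliffordAlgebra.reverse u) = 0 := by
      have h5 := bil_vecCoef hw (CliffordAlgebra.reverse u * z' * u) x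
      rw [hker z' hz'0] at h5
      rw [trForm_apply, e0]
      have e3 : z' * (u * vec w x * CliffordAlgebra.reverse u)
        = (z' * u * vec w x) * CliffordAlgebra.reverse u := by simp only [mul_assoc]
      rw [e3, realPart_mul_comm hw]
      have e4 : CliffordAlgebra.reverse u * (z' * u * vec w x)
        = CliffordAlgebra.reverse u * z' * u * vec w x := by simp only [mul_assoc]
      rw [e4, ← h5]
      simp [bil]
    have e2 : trForm w z' (vec w (A x)) = 0 := by
      have h5 := bil_vecCoef hw z' (A x)
      rw [hz'0] at h5
      rw [trForm_apply, CliffordAlgebra.reverse_ι, ← h5]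
      simp [bil]
    have e3 : ∀ v, trForm w (vec w v) (u * vec w x * CliffordAlgebra.reverse u)
        = trForm w (vec w v) (vec w (A x)) := by
      intro v
      rw [trForm_apply, trForm_apply, e0, CliffordAlgebra.reverse_ι, realPart_mul_comm hw,
        ← bil_vecCoef hw, realPart_mul_comm hw, ← bil_vecCoef hw, vecCoef_vec hw, hAx]
    have hz : z = z' + vec w (vecCoef w z) := by rw [hz']; abel
    rw [hz, map_add, LinearMap.add_apply, LinearMap.add_apply, e1, e2, e3]
  have hspin : IsSpin w u := ⟨heven, hvec, hur⟩
  exact ⟨hspin.toSpinGrp, fun j => by rw [IsSpin.val_toSpinGrp, ← hmul, hgb]⟩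

end InvariantForms

/-! ### Bounded bases of the translates of the integral lattice -/

section BoundedBasis

variable {k : IntermediateField ℚ ℝ} {n : ℕ} {w : Fin (n + 1) → 𝓞 k}

/-- The element of the Clifford algebra with given integral coefficients. -/
def ofInt (w : Fin (n + 1) → 𝓞 k) (a : Finset (Fin (n + 1)) → 𝓞 k) : Cl (realW k w) :=
  ∑ M, algebraMap (𝓞 k) ℝ (a M) • genProd (realW k w) M

theorem coef_ofInt (hw : ∀ i, realW k w i ≠ 0) (a : Finset (Fin (n + 1)) → 𝓞 k)
    (M : Finset (Fin (n + 1))) :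
    coef (realW k w) M (ofInt w a) = algebraMap (𝓞 k) ℝ (a M) := by
  have := coef_sum_smul hw Finset.univ (fun M => algebraMap (𝓞 k) ℝ (a M)) M
  rwa [if_pos (Finset.mem_univ M)] at this

theorem twForm_eq_sum {w : Fin (n + 1) → ℝ} (hw : ∀ i, w i ≠ 0) (x y : Cl w) :
    twForm w x y = ∑ M, coef w M x * ((-1) ^ M.card * coef w M y) * wprod w M := by
  rw [twForm_apply, trForm_eq_sum hw]
  exact Finset.sum_congr rfl fun M _ => by rw [coef_involute hw]

theorem exists_conj_ne (hk : Module.finrank ℚ k = 2) {σ : k →+* ℝ} (hσ : σ ≠ algebraMap k ℝ) :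
    ∃ ω : 𝓞 k, σ (ω : k) ≠ algebraMap (𝓞 k) ℝ ω := by
  by_contra hcon
  push Not at hcon
  have : FiniteDimensional ℚ k := Module.finite_of_finrank_pos (by omega)
  have : NumberField k := { to_charZero := inferInstance, to_finiteDimensional := this }
  apply hσ
  refine IsLocalization.ringHom_ext (nonZeroDivisors (𝓞 k)) (RingHom.ext fun x => ?_)
  exact hcon x

/-- The sign that makes the conjugate of the form definite. -/
theorem exists_sign (h : IsAdmissible k w) {σ : k →+* ℝ} (hσ : σ ≠ algebraMap k ℝ) :
    ∃ η : Finset (Fin (n + 1)) → ℤ, (∀ M, |(η M : ℝ)| ≤ 1) ∧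
      (∀ M, 0 < (η M : ℝ) * σ ((∏ i ∈ M, w i : 𝓞 k) : k)) ∧
      ∀ (s : SpinGrp (realW k w)) (x : Cl (realW k w)),
        ∑ M, (η M : ℝ) * coef (realW k w) M (s.val * x) ^ 2 * wprod (realW k w) M
          = ∑ M, (η M : ℝ) * coef (realW k w) M x ^ 2 * wprod (realW k w) M := by
  have hw := h.isLorentz.ne_zero
  have e : ∀ M : Finset (Fin (n + 1)),
      σ ((∏ i ∈ M, w i : 𝓞 k) : k) = ∏ i ∈ M, σ (w i : k) := fun M => by
    have h1 : ((∏ i ∈ M, w i : 𝓞 k) : k) = ∏ i ∈ M, (w i : k) :=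
      map_prod (algebraMap (𝓞 k) k) _ _
    rw [h1, map_prod]
  -- If the conjugate form is positive, the trace form serves; if it is negative, the twist by the
  -- grade involution cancels the signs `(-1)^|M|`. Both are invariant under the spin group.
  rcases h.2.2 σ hσ with hp | hm
  · refine ⟨fun _ => 1, by simp, fun M => ?_, fun s x => ?_⟩
    · rw [e, Int.cast_one, one_mul]
      exact Finset.prod_pos fun i _ => hp i
    · have := trForm_val_mul hw s x x
      rw [trForm_eq_sum hw, trForm_eq_sum hw] at this
      simpa [pow_two] using this
  · refine ⟨fun M => (-1) ^ M.card, fun M => ?_, fun M => ?_, fun s x => ?_⟩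
    · push_cast
      rw [abs_pow, abs_neg, abs_one, one_pow]
    · rw [Int.cast_pow, Int.cast_neg, Int.cast_one, e, ← Finset.prod_neg]
      exact Finset.prod_pos fun i _ => neg_pos.2 (hm i)
    · have := twForm_val_mul hw s x x
      rw [twForm_eq_sum hw, twForm_eq_sum hw] at this
      push_cast
      refine Eq.trans (Finset.sum_congr rfl fun M _ => ?_) (this.trans
        (Finset.sum_congr rfl fun M _ => ?_)) <;> ring

/-- The translates of the integral lattice by the spin group have no short vectors. -/
theorem exists_no_short_vectors (hk : Module.finrank ℚ k = 2) (h : IsAdmissible k w)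
    {σ : k →+* ℝ} (hσ : σ ≠ algebraMap k ℝ) : ∃ r : ℝ, 0 < r ∧
      ∀ (s : SpinGrp (realW k w)) (a : Finset (Fin (n + 1)) → 𝓞 k),
        (∀ M, |coef (realW k w) M (s.val * ofInt w a)| < r) → (∀ M, |σ (a M : k)| < r) →
          a = 0 := by
  have hw := h.isLorentz.ne_zero
  obtain ⟨η, hη1, hη, hinv⟩ := exists_sign h hσ
  set A : ℝ := ∑ M : Finset (Fin (n + 1)), |wprod (realW k w) M| with hA
  set B : ℝ := ∑ M : Finset (Fin (n + 1)), |σ ((∏ i ∈ M, w i : 𝓞 k) : k)| with hB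
  have hA0 : 0 ≤ A := Finset.sum_nonneg fun _ _ => abs_nonneg _
  have hB0 : 0 ≤ B := Finset.sum_nonneg fun _ _ => abs_nonneg _
  set r : ℝ := 1 / (1 + A + B) with hr
  have hr0 : 0 < r := by positivity
  -- With this `r` the quadratic form is less than `1` in absolute value at either place on vectors
  -- with coordinates below `r`.
  have hr1 : r * (1 + A + B) = 1 := by rw [hr]; field_simp
  have hsmall : ∀ (f g : Finset (Fin (n + 1)) → ℝ) (c : ℝ), 0 ≤ c → (∀ M, |f M| < r) →
      (∑ M, |g M| = c) → c ≤ A + B →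
      |∑ M, (η M : ℝ) * f M ^ 2 * g M| < 1 := by
    intro f g c hc0 hf hg hc
    have h1 : |∑ M, (η M : ℝ) * f M ^ 2 * g M| ≤ r ^ 2 * c := by
      rw [← hg, Finset.mul_sum]
      refine (Finset.abs_sum_le_sum_abs _ _).trans (Finset.sum_le_sum fun M _ => ?_)
      rw [abs_mul, abs_mul, abs_pow]
      gcongr
      calc |(η M : ℝ)| * |f M| ^ 2 ≤ 1 * r ^ 2 := by
            gcongr
            · exact hη1 M
            · exact (hf M).le
        _ = r ^ 2 := one_mul _
    have h2 : r ≤ 1 := by nlinarith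
    have h3 : r * c < 1 := by nlinarith
    have h4 : r ^ 2 * c ≤ r * c := by
      have := mul_nonneg hr0.le hc0
      nlinarith
    linarith
  refine ⟨r, hr0, fun s a h1 h2 => ?_⟩
  -- The value of the invariant quadratic form is an integer of `k` that is less than `1` at both
  -- places, hence zero. The form is definite at `σ`, so the vector vanishes.
  set f : 𝓞 k := ∑ M, (η M : 𝓞 k) * a M ^ 2 * ∏ i ∈ M, w i with hf
  have hρf : algebraMap (𝓞 k) ℝ f
      = ∑ M, (η M : ℝ) * coef (realW k w) M (s.val * ofInt w a) ^ 2 * wprod (realW k w) M := by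
    rw [hinv, hf, map_sum]
    refine Finset.sum_congr rfl fun M _ => ?_
    rw [map_mul, map_mul, map_pow, map_intCast, coef_ofInt hw, wprod_realW]
  have hσf : σ (f : k)
      = ∑ M, (η M : ℝ) * σ (a M : k) ^ 2 * σ ((∏ i ∈ M, w i : 𝓞 k) : k) := by
    change (σ.comp (algebraMap (𝓞 k) k)) f = _
    rw [hf, map_sum]
    refine Finset.sum_congr rfl fun M _ => ?_
    rw [map_mul, map_mul, map_pow, map_intCast]
    rfl
  have hf0 : f = 0 := by
    by_contra hne
    have h3 := one_le_abs_mul_abs_conj hk hσ hne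
    have h4 : |algebraMap (𝓞 k) ℝ f| < 1 := by
      rw [hρf]; exact hsmall _ _ A hA0 h1 rfl (by linarith)
    have h5 : |σ (f : k)| < 1 := by
      rw [hσf]; exact hsmall _ _ B hB0 h2 rfl (by linarith)
    nlinarith [abs_nonneg (algebraMap (𝓞 k) ℝ f), abs_nonneg (σ (f : k))]
  have h0 : ∑ M, ((η M : ℝ) * σ ((∏ i ∈ M, w i : 𝓞 k) : k)) * σ (a M : k) ^ 2 = 0 := by
    have : σ (f : k) = 0 := conj_eq_zero.2 hf0
    rw [← this, hσf]
    exact Finset.sum_congr rfl fun M _ => by ring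
  funext M
  have := (Finset.sum_eq_zero_iff_of_nonneg
    (fun M _ => mul_nonneg (hη M).le (sq_nonneg _))).1 h0 M (Finset.mem_univ M)
  have := (mul_eq_zero.1 this).resolve_left (hη M).ne'
  exact conj_eq_zero.1 (pow_eq_zero_iff two_ne_zero |>.1 this)

/-- The matrix of the left multiplication by `s`. -/
def leftMatrix {w : Fin (n + 1) → ℝ} (s : SpinGrp w) :
    Matrix (Finset (Fin (n + 1))) (Finset (Fin (n + 1))) ℝ :=
  Matrix.of fun M N => coef w M (s.val * genProd w N)

theorem leftMatrix_mulVec {w : Fin (n + 1) → ℝ} (s : SpinGrp w)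
    (v : Finset (Fin (n + 1)) → ℝ) (M : Finset (Fin (n + 1))) :
    (leftMatrix s).mulVec v M = coef w M (s.val * ∑ N, v N • genProd w N) := by
  rw [Finset.mul_sum, map_sum, Matrix.mulVec, dotProduct]
  refine Finset.sum_congr rfl fun N _ => ?_
  rw [mul_smul_comm, map_smul, smul_eq_mul, mul_comm]
  rfl

/-- Left multiplication preserves the nondegenerate trace form, so the square of its determinant is
`1`. The covolumes of the translated lattices therefore do not depend on `s`. -/
theorem abs_det_leftMatrix {w : Fin (n + 1) → ℝ} (hw : ∀ i, w i ≠ 0) (s : SpinGrp w) :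
    |(leftMatrix s).det| = 1 := by
  have e : (leftMatrix s).transpose * Matrix.diagonal (wprod w) * leftMatrix s
      = Matrix.diagonal (wprod w) := by
    ext N N'
    have h1 := trForm_val_mul hw s (genProd w N) (genProd w N')
    rw [trForm_eq_sum hw, trForm_genProd_right hw, coef_genProd hw] at h1
    rw [Matrix.mul_apply, Matrix.diagonal_apply]
    refine Eq.trans (Finset.sum_congr rfl fun M _ => ?_) (h1.trans ?_)
    · rw [Matrix.mul_diagonal]
      simp only [leftMatrix, Matrix.transpose_apply, Matrix.of_apply]
      ring
    · split_ifs with h2 <;> simp [h2]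
  have e2 := congrArg Matrix.det e
  rw [Matrix.det_mul, Matrix.det_mul, Matrix.det_transpose, Matrix.det_diagonal] at e2
  have h0 : ∏ M, wprod w M ≠ 0 := Finset.prod_ne_zero_iff.2 fun M _ => wprod_ne_zero hw M
  have e3 : (leftMatrix s).det ^ 2 = 1 := by
    apply mul_right_cancel₀ h0
    rw [one_mul]
    linear_combination e2
  rw [← sq_abs] at e3
  exact (pow_eq_one_iff_of_nonneg (abs_nonneg _) two_ne_zero).1 e3

/-- Each translate of the integral lattice has a basis consisting of vectors that are bounded at
both real places. -/
theorem exists_bounded_basis (hk : Module.finrank ℚ k = 2) (h : IsAdmissible k w)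
    {σ : k →+* ℝ} (hσ : σ ≠ algebraMap k ℝ) : ∃ R : ℝ, 0 ≤ R ∧
      ∀ s : SpinGrp (realW k w),
        ∃ (a : Finset (Fin (n + 1)) → Finset (Fin (n + 1)) → 𝓞 k)
          (b : Module.Basis (Finset (Fin (n + 1))) ℝ (Cl (realW k w))),
          (∀ j, b j = ofInt w (a j)) ∧
          (∀ j M, |coef (realW k w) M (s.val * ofInt w (a j))| ≤ R) ∧
          ∀ j M, |σ (a j M : k)| ≤ R := by
  have hw := h.isLorentz.ne_zero
  obtain ⟨ω, hω⟩ := exists_conj_ne hk hσ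
  obtain ⟨r, hr, hshort⟩ := exists_no_short_vectors hk h hσ
  set D : ℝ := |(σ (ω : k) - algebraMap (𝓞 k) ℝ ω) ^ Fintype.card (Finset (Fin (n + 1)))| with hD
  have hD0 : 0 < D := abs_pos.2 (pow_ne_zero _ (sub_ne_zero.2 hω))
  obtain ⟨R, hR0, hR⟩ := exists_bound_span_eq_top
    (ι := Finset (Fin (n + 1)) ⊕ Finset (Fin (n + 1))) r D hr hD0
  refine ⟨R, hR0, fun s => ?_⟩
  -- `B` sends integers `(m, m')` to the two real embeddings of `m + ω m'`, and `A` then applies `s`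
  -- at the given place only. The determinant of `A B` is up to sign a power of `σ(ω) - ω`.
  set B : Matrix (Finset (Fin (n + 1)) ⊕ Finset (Fin (n + 1)))
      (Finset (Fin (n + 1)) ⊕ Finset (Fin (n + 1))) ℝ :=
    Matrix.fromBlocks 1 (algebraMap (𝓞 k) ℝ ω • 1) 1 (σ (ω : k) • 1) with hB
  set A : Matrix (Finset (Fin (n + 1)) ⊕ Finset (Fin (n + 1)))
      (Finset (Fin (n + 1)) ⊕ Finset (Fin (n + 1))) ℝ :=
    Matrix.fromBlocks (leftMatrix s) 0 0 1 with hA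
  have hdet : |(A * B).det| = D := by
    rw [Matrix.det_mul, abs_mul, hA, Matrix.det_fromBlocks_zero₂₁, Matrix.det_one, mul_one,
      abs_det_leftMatrix hw, one_mul, hB, Matrix.det_fromBlocks_one₁₁, Matrix.one_mul, ← sub_smul,
      Matrix.det_smul, Matrix.det_one, mul_one]
  set c : (Finset (Fin (n + 1)) ⊕ Finset (Fin (n + 1)) → ℤ) → Finset (Fin (n + 1)) → 𝓞 k :=
    fun m M => m (Sum.inl M) + ω * m (Sum.inr M) with hc
  have hv1 : ∀ m M, (A * B).mulVec (fun j => (m j : ℝ)) (Sum.inl M)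
      = coef (realW k w) M (s.val * ofInt w (c m)) := by
    intro m M
    rw [← Matrix.mulVec_mulVec, hA, hB, Matrix.fromBlocks_mulVec, Matrix.fromBlocks_mulVec]
    simp only [Sum.elim_inl, Matrix.zero_mulVec, add_zero, Matrix.one_mulVec,
      Matrix.smul_mulVec, Sum.elim_comp_inl]
    rw [leftMatrix_mulVec]
    congr 3
  have hv2 : ∀ m M, (A * B).mulVec (fun j => (m j : ℝ)) (Sum.inr M) = σ (c m M : k) := by
    intro m M
    have e : σ (c m M : k) = m (Sum.inl M) + σ (ω : k) * m (Sum.inr M) := by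
      change (σ.comp (algebraMap (𝓞 k) k)) (c m M) = _
      rw [hc, map_add, map_mul, map_intCast, map_intCast]
      rfl
    rw [← Matrix.mulVec_mulVec, hA, hB, Matrix.fromBlocks_mulVec, Matrix.fromBlocks_mulVec, e]
    simp [Matrix.smul_mulVec]
  have hc0 : ∀ m, c m = 0 → m = 0 := by
    intro m hm
    have key : ∀ M, m (Sum.inl M) = 0 ∧ m (Sum.inr M) = 0 := by
      intro M
      have e0 : c m M = 0 := congrFun hm M
      have e1 := congrArg (algebraMap (𝓞 k) ℝ) e0
      have e2 := congrArg (σ.comp (algebraMap (𝓞 k) k)) e0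
      rw [hc, map_add, map_mul, map_intCast, map_intCast, map_zero] at e1 e2
      change (m (Sum.inl M) : ℝ) + σ (ω : k) * m (Sum.inr M) = 0 at e2
      have e3 : (σ (ω : k) - algebraMap (𝓞 k) ℝ ω) * (m (Sum.inr M) : ℝ) = 0 := by
        linear_combination e2 - e1
      have e4 : (m (Sum.inr M) : ℝ) = 0 :=
        (mul_eq_zero.1 e3).resolve_left (sub_ne_zero.2 hω)
      rw [e4, mul_zero, add_zero] at e1
      exact ⟨by exact_mod_cast e1, by exact_mod_cast e4⟩
    funext i
    rcases i with M | M
    · exact (key M).1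
    · exact (key M).2
  have hspan := hR (A * B) hdet fun m hm => hc0 m (hshort s (c m)
    (fun M => by rw [← hv1]; exact hm _) fun M => by rw [← hv2]; exact hm _)
  set T : Set (Cl (realW k w)) := {x | ∃ a : Finset (Fin (n + 1)) → 𝓞 k, x = ofInt w a ∧
    (∀ M, |coef (realW k w) M (s.val * ofInt w a)| ≤ R) ∧ ∀ M, |σ (a M : k)| ≤ R} with hT
  -- Forget the coordinates at `σ` and undo the translation by `s`: this linear surjection carries
  -- the spanning set of bounded vectors to a spanning set of the Clifford algebra, from which a
  -- basis is extracted.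
  set π : (Finset (Fin (n + 1)) ⊕ Finset (Fin (n + 1)) → ℝ) →ₗ[ℝ] Cl (realW k w) :=
    LinearMap.mulLeft ℝ (CliffordAlgebra.reverse s.val) ∘ₗ
      (clBasis hw).equivFun.symm.toLinearMap ∘ₗ LinearMap.funLeft ℝ ℝ Sum.inl with hπ
  have hπa : ∀ y, π y = CliffordAlgebra.reverse s.val *
      ∑ M, y (Sum.inl M) • genProd (realW k w) M := by
    intro y
    simp only [hπ, LinearMap.comp_apply, LinearMap.mulLeft_apply, LinearEquiv.coe_coe,
      Module.Basis.equivFun_symm_apply, clBasis_apply, LinearMap.funLeft_apply]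
  have hTspan : Submodule.span ℝ T = ⊤ := by
    rw [eq_top_iff]
    intro x _
    have hx : x = π (Sum.elim (fun M => coef (realW k w) M (s.val * x)) 0) := by
      rw [hπa]
      simp only [Sum.elim_inl]
      rw [sum_coef_smul hw, ← mul_assoc, reverse_mul_val, one_mul]
    rw [hx]
    have hmem : (Sum.elim (fun M => coef (realW k w) M (s.val * x)) 0 :
        Finset (Fin (n + 1)) ⊕ Finset (Fin (n + 1)) → ℝ) ∈ (⊤ : Submodule ℝ _) := trivial
    rw [← hspan] at hmem
    have := Submodule.mem_map_of_mem (f := π) hmem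
    rw [Submodule.map_span] at this
    refine Submodule.span_mono ?_ this
    rintro _ ⟨_, ⟨m, rfl, hm⟩, rfl⟩
    refine ⟨c m, ?_, fun M => by rw [← hv1]; exact hm _, fun M => by rw [← hv2]; exact hm _⟩
    rw [hπa]
    simp only [hv1]
    rw [sum_coef_smul hw, ← mul_assoc, reverse_mul_val, one_mul]
  obtain ⟨S, hST, hSspan, hSli⟩ := exists_linearIndependent ℝ T
  have hfd := finiteDimensional_cl (w := realW k w)
  set bS : Module.Basis S ℝ (Cl (realW k w)) :=
    Module.Basis.mk hSli (by rw [Subtype.range_coe, hSspan, hTspan]) with hbS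
  have e : S ≃ Finset (Fin (n + 1)) := bS.indexEquiv (clBasis hw)
  have hmem : ∀ j, ∃ a : Finset (Fin (n + 1)) → 𝓞 k, bS.reindex e j = ofInt w a ∧
    (∀ M, |coef (realW k w) M (s.val * ofInt w a)| ≤ R) ∧ ∀ M, |σ (a M : k)| ≤ R := by
    intro j
    have : bS.reindex e j = (e.symm j : Cl (realW k w)) := by
      rw [Module.Basis.reindex_apply, hbS, Module.Basis.mk_apply]
    rw [this]
    exact hST (e.symm j).2
  choose a ha1 ha2 ha3 using hmem
  exact ⟨a, bS.reindex e, ha1, ha2, ha3⟩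

end BoundedBasis

/-! ### Cocompactness of the congruence subgroups -/

section Cocompact

variable {k : IntermediateField ℚ ℝ} {n : ℕ} {w : Fin (n + 1) → 𝓞 k}

/-- All the coefficients of `c` are integers of `k`. -/
def IsInt (w : Fin (n + 1) → 𝓞 k) (c : Cl (realW k w)) : Prop :=
  ∀ M, coef (realW k w) M c ∈ (algebraMap (𝓞 k) ℝ).range

theorem IsInt.genProd (hw : ∀ i, realW k w i ≠ 0) (N : Finset (Fin (n + 1))) :
    IsInt w (genProd (realW k w) N) := fun M => by
  rw [coef_genProd hw]
  split_ifs
  · exact one_mem _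
  · exact zero_mem _

theorem IsInt.mul (hw : ∀ i, realW k w i ≠ 0) {c d : Cl (realW k w)} (hc : IsInt w c)
    (hd : IsInt w d) : IsInt w (c * d) := fun P => by
  rw [← sum_coef_smul hw c, ← sum_coef_smul hw d, Finset.sum_mul_sum, map_sum]
  refine sum_mem fun M _ => ?_
  rw [map_sum]
  refine sum_mem fun N _ => ?_
  rw [smul_mul_smul_comm, map_smul, smul_eq_mul]
  refine mul_mem (mul_mem (hc M) (hd N)) ?_
  obtain ⟨ε, hε, h⟩ := genProd_mul_genProd_symmDiff (realW k w) M N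
  rw [h, map_smul, smul_eq_mul]
  refine mul_mem (mul_mem ?_ ?_) (IsInt.genProd hw _ P)
  · rcases hε with rfl | rfl
    · exact one_mem _
    · exact neg_mem (one_mem _)
  · rw [wprod_realW]; exact ⟨_, rfl⟩

theorem IsInt.reverse (hw : ∀ i, realW k w i ≠ 0) {c : Cl (realW k w)} (hc : IsInt w c) :
    IsInt w (CliffordAlgebra.reverse c) := fun P => by
  rw [← sum_coef_smul hw c, map_sum, map_sum]
  refine sum_mem fun M _ => ?_
  obtain ⟨ε, hε, h⟩ := reverse_genProd_eq hw M
  rw [map_smul, h, map_smul, map_smul, smul_eq_mul, smul_eq_mul]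
  refine mul_mem (hc M) (mul_mem ?_ (IsInt.genProd hw M P))
  rcases hε with rfl | rfl
  · exact one_mem _
  · exact neg_mem (one_mem _)

theorem IsInt.involute (hw : ∀ i, realW k w i ≠ 0) {c : Cl (realW k w)} (hc : IsInt w c) :
    IsInt w (CliffordAlgebra.involute c) := fun P => by
  rw [coef_involute hw]
  exact mul_mem (pow_mem (neg_mem (one_mem _)) _) (hc P)

theorem IsInt.gen (hw : ∀ i, realW k w i ≠ 0) (i : Fin (n + 1)) : IsInt w (gen (realW k w) i) := by
  rw [← genProd_singleton]
  exact IsInt.genProd hw _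

theorem IsInt.realPart {c : Cl (realW k w)} (hc : IsInt w c) :
    ∃ d : 𝓞 k, realPart (realW k w) c = algebraMap (𝓞 k) ℝ d := by
  obtain ⟨d, hd⟩ := hc ∅
  exact ⟨d, by rw [hd, coef_empty]⟩

theorem bilin_eq_sum {w : Fin (n + 1) → ℝ} (hw : ∀ i, w i ≠ 0) (β : Cl w →ₗ[ℝ] Cl w →ₗ[ℝ] ℝ)
    (x y : Cl w) :
    β x y = ∑ M, ∑ N, coef w M x * coef w N y * β (genProd w M) (genProd w N) := by
  conv_lhs => rw [← sum_coef_smul hw x, ← sum_coef_smul hw y]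
  rw [map_sum β, LinearMap.sum_apply]
  refine Finset.sum_congr rfl fun M _ => ?_
  rw [map_sum]
  refine Finset.sum_congr rfl fun N _ => ?_
  rw [map_smul, map_smul, LinearMap.smul_apply, smul_eq_mul, smul_eq_mul]
  ring

theorem exists_abs_sum_le {J : Type*} [Fintype J] (c : J → J → ℝ) : ∃ C : ℝ, 0 ≤ C ∧
    ∀ (R : ℝ) (x y : J → ℝ), (∀ i, |x i| ≤ R) → (∀ i, |y i| ≤ R) →
      |∑ i, ∑ j, x i * y j * c i j| ≤ C * R ^ 2 := by
  refine ⟨∑ i, ∑ j, |c i j|, by positivity, fun R x y hx hy => ?_⟩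
  rw [Finset.sum_mul]
  refine (Finset.abs_sum_le_sum_abs _ _).trans (Finset.sum_le_sum fun i _ => ?_)
  rw [Finset.sum_mul]
  refine (Finset.abs_sum_le_sum_abs _ _).trans (Finset.sum_le_sum fun j _ => ?_)
  have hR : 0 ≤ R := (abs_nonneg _).trans (hx i)
  rw [abs_mul, abs_mul, mul_comm]
  gcongr
  rw [pow_two]
  exact mul_le_mul (hx i) (hy j) (abs_nonneg _) hR

/-- An integral bilinear form that is invariant under the spin group takes values that are bounded
at both real places, on vectors whose translates are bounded. -/
theorem exists_bound_of_bilin (hw : ∀ i, realW k w i ≠ 0) (σ : k →+* ℝ)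
    (β : Cl (realW k w) →ₗ[ℝ] Cl (realW k w) →ₗ[ℝ] ℝ)
    (hβ : ∀ M N, ∃ d : 𝓞 k, β (genProd (realW k w) M) (genProd (realW k w) N)
      = algebraMap (𝓞 k) ℝ d) (R : ℝ) : ∃ C : ℝ, 0 ≤ C ∧
    ∀ (a b : Finset (Fin (n + 1)) → 𝓞 k) (x y : Cl (realW k w)),
      (∀ M, |coef (realW k w) M x| ≤ R) → (∀ M, |coef (realW k w) M y| ≤ R) →
      (∀ M, |σ (a M : k)| ≤ R) → (∀ M, |σ (b M : k)| ≤ R) →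
      β (ofInt w a) (ofInt w b) = β x y →
      ∃ d : 𝓞 k, algebraMap (𝓞 k) ℝ d = β (ofInt w a) (ofInt w b) ∧
        |algebraMap (𝓞 k) ℝ d| ≤ C ∧ |σ (d : k)| ≤ C := by
  choose e he using hβ
  obtain ⟨C, hC0, hC⟩ := exists_abs_sum_le fun M N => algebraMap (𝓞 k) ℝ (e M N)
  obtain ⟨C', hC'0, hC'⟩ := exists_abs_sum_le fun M N => σ (e M N : k)
  refine ⟨C * R ^ 2 + C' * R ^ 2, by positivity, fun a b x y hx hy ha hb hxy => ?_⟩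
  have h1 : β (ofInt w a) (ofInt w b)
      = algebraMap (𝓞 k) ℝ (∑ M, ∑ N, a M * b N * e M N) := by
    rw [bilin_eq_sum hw, map_sum]
    refine Finset.sum_congr rfl fun M _ => ?_
    rw [map_sum]
    refine Finset.sum_congr rfl fun N _ => ?_
    rw [map_mul, map_mul, coef_ofInt hw, coef_ofInt hw, he]
  have h2 := hC R _ _ hx hy
  simp only [← he] at h2
  rw [← bilin_eq_sum hw, ← hxy] at h2
  have h3 := hC' R _ _ ha hb
  have e3 : σ ((∑ M, ∑ N, a M * b N * e M N : 𝓞 k) : k)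
      = ∑ M, ∑ N, σ (a M : k) * σ (b N : k) * σ (e M N : k) := by
    change (σ.comp (algebraMap (𝓞 k) k)) (∑ M, ∑ N, a M * b N * e M N) = _
    simp only [map_sum, map_mul]
    rfl
  have hR2 : 0 ≤ R ^ 2 := sq_nonneg R
  refine ⟨_, h1.symm, ?_, ?_⟩
  · rw [← h1]; nlinarith
  · rw [e3]; nlinarith

/-- The index type of the invariants of a family of elements of the Clifford algebra. -/
abbrev InvIndex (n : ℕ) (J : Type) : Type :=
  ((J × J) ⊕ (J × J)) ⊕ ((Fin (n + 1) × J × J) ⊕ (J × J × J × J))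

/-- The invariants of a family of elements of the Clifford algebra under the spin group. -/
def invariants {w : Fin (n + 1) → ℝ} {J : Type} (x : J → Cl w) : InvIndex n J → ℝ
  | .inl (.inl (i, j)) => trForm w (x i) (x j)
  | .inl (.inr (i, j)) => twForm w (x i) (x j)
  | .inr (.inl (a, i, j)) => genForm w a (x i) (x j)
  | .inr (.inr (i, j, p, q)) => bil w (vecForm w (x i) (x j)) (vecForm w (x p) (x q))

/-- The invariants are integers of `k`. By invariance they can be computed from the translated
vectors, which are bounded at the given place, and their conjugates from the bounded conjugate
coefficients. Only finitely many values are then possible, uniformly in `s`. -/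
theorem exists_bound_invariants (h : IsAdmissible k w) (σ : k →+* ℝ) (R : ℝ) :
    ∃ C : ℝ, ∀ (s : SpinGrp (realW k w))
      (a : Finset (Fin (n + 1)) → Finset (Fin (n + 1)) → 𝓞 k),
      (∀ j M, |coef (realW k w) M (s.val * ofInt w (a j))| ≤ R) →
      (∀ j M, |σ (a j M : k)| ≤ R) → ∀ t, ∃ d : 𝓞 k,
        algebraMap (𝓞 k) ℝ d = invariants (fun j => ofInt w (a j)) t ∧
        |algebraMap (𝓞 k) ℝ d| ≤ C ∧ |σ (d : k)| ≤ C := by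
  have hw := h.isLorentz.ne_zero
  obtain ⟨C1, hC1, H1⟩ := exists_bound_of_bilin hw σ (trForm (realW k w))
    (fun M N => ((IsInt.genProd hw M).mul hw ((IsInt.genProd hw N).reverse hw)).realPart) R
  obtain ⟨C2, hC2, H2⟩ := exists_bound_of_bilin hw σ (twForm (realW k w))
    (fun M N => ((IsInt.genProd hw M).mul hw
      (((IsInt.genProd hw N).involute hw).reverse hw)).realPart) R
  have H3 := fun i => exists_bound_of_bilin hw σ (genForm (realW k w) i)
    (fun M N => ((IsInt.genProd hw M).mul hw
      (((IsInt.genProd hw N).mul hw (IsInt.gen hw i)).reverse hw)).realPart) R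
  choose C3 hC3 H3 using H3
  set S3 : ℝ := ∑ i, C3 i with hS3
  have hS3i : ∀ i, C3 i ≤ S3 := fun i =>
    Finset.single_le_sum (f := C3) (fun i _ => hC3 i) (Finset.mem_univ i)
  have hS30 : 0 ≤ S3 := Finset.sum_nonneg fun i _ => hC3 i
  have hint : ∀ M N, IsInt w (genProd (realW k w) M
      * CliffordAlgebra.reverse (genProd (realW k w) N)) := fun M N =>
    (IsInt.genProd hw M).mul hw ((IsInt.genProd hw N).reverse hw)
  have H4 := fun i : Fin (n + 1) => exists_abs_sum_le fun M N =>
    vecForm (realW k w) (genProd (realW k w) M) (genProd (realW k w) N) i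
  have hvint : ∀ M N i, ∃ d : 𝓞 k, vecForm (realW k w) (genProd (realW k w) M)
      (genProd (realW k w) N) i = algebraMap (𝓞 k) ℝ d := fun M N i => by
    obtain ⟨d, hd⟩ := hint M N {i}
    exact ⟨d, hd.symm⟩
  choose e he using hvint
  have H4' := fun i : Fin (n + 1) => exists_abs_sum_le fun M N => σ (e M N i : k)
  choose C4 hC4 H4 using H4
  choose C5 hC5 H5 using H4'
  set S4 : ℝ := ∑ i, |realW k w i| * (C4 i * R ^ 2) * (C4 i * R ^ 2) with hS4
  set S5 : ℝ := ∑ i, |σ (w i : k)| * (C5 i * R ^ 2) * (C5 i * R ^ 2) with hS5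
  have hS40 : 0 ≤ S4 := Finset.sum_nonneg fun i _ => by
    have := hC4 i
    positivity
  have hS50 : 0 ≤ S5 := Finset.sum_nonneg fun i _ => by
    have := hC5 i
    positivity
  refine ⟨C1 + C2 + S3 + S4 + S5, fun s a ha hσa t => ?_⟩
  rcases t with (⟨i, j⟩ | ⟨i, j⟩) | ⟨p, i, j⟩ | ⟨i, j, p, q⟩
  · obtain ⟨d, h1, h2, h3⟩ := H1 (a i) (a j) _ _ (ha i) (ha j) (hσa i) (hσa j)
      (trForm_val_mul hw s _ _).symm
    exact ⟨d, h1, by linarith, by linarith⟩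
  · obtain ⟨d, h1, h2, h3⟩ := H2 (a i) (a j) _ _ (ha i) (ha j) (hσa i) (hσa j)
      (twForm_val_mul hw s _ _).symm
    exact ⟨d, h1, by linarith, by linarith⟩
  · obtain ⟨d, h1, h2, h3⟩ := H3 p (a i) (a j) _ _ (ha i) (ha j) (hσa i) (hσa j)
      (genForm_val_mul hw s p _ _).symm
    exact ⟨d, h1, by linarith [hS3i p], by linarith [hS3i p]⟩
  · have hexp : ∀ (x y : Cl (realW k w)) (i : Fin (n + 1)), vecForm (realW k w) x y i
        = ∑ M, ∑ N, coef (realW k w) M x * coef (realW k w) N y *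
          vecForm (realW k w) (genProd (realW k w) M) (genProd (realW k w) N) i := fun x y i =>
      bilin_eq_sum hw ((vecForm (realW k w)).compr₂ (LinearMap.proj i)) x y
    set v : Finset (Fin (n + 1)) → Finset (Fin (n + 1)) → Fin (n + 1) → 𝓞 k := fun i j l =>
      ∑ M, ∑ N, a i M * a j N * e M N l with hv
    have hva : ∀ i j l, vecForm (realW k w) (ofInt w (a i)) (ofInt w (a j)) l
        = algebraMap (𝓞 k) ℝ (v i j l) := by
      intro i j l
      rw [hexp, hv]
      simp only [map_sum, map_mul, coef_ofInt hw, he]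
    have hvσ : ∀ i j l, |σ (v i j l : k)| ≤ C5 l * R ^ 2 := by
      intro i j l
      have e3 : σ (v i j l : k) = ∑ M, ∑ N, σ (a i M : k) * σ (a j N : k) * σ (e M N l : k) := by
        change (σ.comp (algebraMap (𝓞 k) k)) (∑ M, ∑ N, a i M * a j N * e M N l) = _
        simp only [map_sum, map_mul]
        rfl
      rw [e3]
      exact H5 l R _ _ (hσa i) (hσa j)
    have hvs : ∀ i j l, |vecForm (realW k w) (s.val * ofInt w (a i)) (s.val * ofInt w (a j)) l|
        ≤ C4 l * R ^ 2 := by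
      intro i j l
      rw [hexp]
      exact H4 l R _ _ (ha i) (ha j)
    have h1 : bil (realW k w) (vecForm (realW k w) (ofInt w (a i)) (ofInt w (a j)))
        (vecForm (realW k w) (ofInt w (a p)) (ofInt w (a q)))
        = algebraMap (𝓞 k) ℝ (∑ l, w l * v i j l * v p q l) := by
      rw [bil, map_sum]
      refine Finset.sum_congr rfl fun l _ => ?_
      rw [map_mul, map_mul, hva, hva]
    refine ⟨∑ l, w l * v i j l * v p q l, h1.symm, ?_, ?_⟩
    · rw [← h1, ← bil_vecForm_val_mul hw s]
      have : |bil (realW k w) (vecForm (realW k w) (s.val * ofInt w (a i)) (s.val * ofInt w (a j)))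
          (vecForm (realW k w) (s.val * ofInt w (a p)) (s.val * ofInt w (a q)))| ≤ S4 := by
        refine (Finset.abs_sum_le_sum_abs _ _).trans (Finset.sum_le_sum fun l _ => ?_)
        rw [abs_mul, abs_mul]
        have := hC4 l
        gcongr
        · exact hvs i j l
        · exact hvs p q l
      linarith
    · have e3 : σ ((∑ l, w l * v i j l * v p q l : 𝓞 k) : k)
          = ∑ l, σ (w l : k) * σ (v i j l : k) * σ (v p q l : k) := by
        change (σ.comp (algebraMap (𝓞 k) k)) (∑ l, w l * v i j l * v p q l) = _
        simp only [map_sum, map_mul]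
        rfl
      rw [e3]
      have : |∑ l, σ (w l : k) * σ (v i j l : k) * σ (v p q l : k)| ≤ S5 := by
        refine (Finset.abs_sum_le_sum_abs _ _).trans (Finset.sum_le_sum fun l _ => ?_)
        rw [abs_mul, abs_mul]
        have := hC5 l
        gcongr
        · exact hvσ i j l
        · exact hvσ p q l
      linarith

/-- The Gram matrix determines the coordinates with respect to a basis. -/
theorem sum_smul_eq_of_gram {w : Fin (n + 1) → ℝ} (hw : ∀ i, w i ≠ 0) {J : Type*} [Fintype J]
    (b : Module.Basis J ℝ (Cl w)) {z : J → ℝ} {c : Cl w}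
    (h : ∀ i, ∑ j, trForm w (b i) (b j) * z j = trForm w (b i) c) : ∑ j, z j • b j = c := by
  refine eq_of_trForm_eq_left hw fun y => ?_
  have : (trForm w).flip (∑ j, z j • b j) = (trForm w).flip c := by
    refine b.ext fun i => ?_
    rw [LinearMap.flip_apply, LinearMap.flip_apply, ← h, map_sum]
    exact Finset.sum_congr rfl fun j _ => by rw [map_smul, smul_eq_mul, mul_comm]
  exact congrArg (fun f : Cl w →ₗ[ℝ] ℝ => f y) this

/-- A kernel vector would be a linear relation between the basis vectors, by nondegeneracy of the
trace form. -/
theorem gram_det_ne_zero {w : Fin (n + 1) → ℝ} (hw : ∀ i, w i ≠ 0) {J : Type*} [Fintype J]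
    [DecidableEq J] (b : Module.Basis J ℝ (Cl w)) :
    (Matrix.of fun i j => trForm w (b i) (b j)).det ≠ 0 := by
  intro h0
  obtain ⟨v, hv, hv0⟩ := Matrix.exists_mulVec_eq_zero_iff.2 h0
  have := sum_smul_eq_of_gram hw b (z := v) (c := 0) fun i => by
    rw [map_zero]
    exact congrFun hv0 i
  exact hv (funext fun j => (Fintype.linearIndependent_iff.1 b.linearIndependent) v this j)

/-- An element of the spin group that carries an integral basis to a congruent one is congruent
to one. -/
theorem mem_GamI_of_congruent (hw : ∀ i, realW k w i ≠ 0) {α N : 𝓞 k}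
    (b : Module.Basis (Finset (Fin (n + 1))) ℝ (Cl (realW k w)))
    {a a' : Finset (Fin (n + 1)) → Finset (Fin (n + 1)) → 𝓞 k} (hb : ∀ j, b j = ofInt w (a j))
    {G : Matrix (Finset (Fin (n + 1))) (Finset (Fin (n + 1))) (𝓞 k)}
    (hG : ∀ i j, algebraMap (𝓞 k) ℝ (G i j) = trForm (realW k w) (b i) (b j))
    (hN : G.det ∣ N)
    (haa : ∀ j M, Ideal.Quotient.mk (Ideal.span {N * α}) (a j M)
      = Ideal.Quotient.mk (Ideal.span {N * α}) (a' j M))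
    {u : SpinGrp (realW k w)} (hu : ∀ j, u.val * b j = ofInt w (a' j)) :
    u ∈ GamI k w (Ideal.span {α}) := by
  have hdet : algebraMap (𝓞 k) ℝ G.det ≠ 0 := by
    have := gram_det_ne_zero hw b
    convert this
    rw [RingHom.map_det]
    congr 1
    ext i j
    exact hG i j
  -- Cramer's rule: the real parts `a i ∅` are the trace products of the basis with `1`, so `det G ·
  -- 1` is an integral combination of the basis. Hence `det G · (u - 1)` is the same combination of
  -- the differences `a' - a`, divisible by `N α`, and `det G ∣ N` cancels.
  set y : Finset (Fin (n + 1)) → 𝓞 k := G.adjugate.mulVec fun i => a i ∅ with hy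
  have hGy : G.mulVec y = G.det • fun i => a i ∅ := by
    rw [hy, Matrix.mulVec_mulVec, Matrix.mul_adjugate, Matrix.smul_mulVec, Matrix.one_mulVec]
  have h1 : ∑ j, algebraMap (𝓞 k) ℝ (y j) • b j = algebraMap (𝓞 k) ℝ G.det • 1 := by
    refine sum_smul_eq_of_gram hw b fun i => ?_
    have := congrArg (algebraMap (𝓞 k) ℝ) (congrFun hGy i)
    rw [Matrix.mulVec, dotProduct, map_sum] at this
    simp only [map_mul, hG, Pi.smul_apply, smul_eq_mul] at this
    rw [this, map_smul, smul_eq_mul, trForm_apply, CliffordAlgebra.reverse.map_one, mul_one,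
      hb, ← coef_empty, coef_ofInt hw]
  have h2 : algebraMap (𝓞 k) ℝ G.det • u.val
      = ∑ j, algebraMap (𝓞 k) ℝ (y j) • ofInt w (a' j) := by
    have := congrArg (u.val * ·) h1
    simp only [Finset.mul_sum, mul_smul_comm, hu, mul_one] at this
    exact this.symm
  obtain ⟨N', rfl⟩ := hN
  have h3 : ∀ j M, ∃ e : 𝓞 k, a' j M - a j M = G.det * N' * α * e := fun j M => by
    have := Ideal.Quotient.eq.1 (haa j M).symm
    exact Ideal.mem_span_singleton.1 this
  choose e he using h3
  have h4 : ∀ M, coef (realW k w) M (u.val - 1)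
      = algebraMap (𝓞 k) ℝ (α * (N' * ∑ j, y j * e j M)) := by
    intro M
    apply mul_left_cancel₀ hdet
    rw [← smul_eq_mul, ← map_smul, smul_sub, h2, ← h1, ← Finset.sum_sub_distrib, map_sum,
      ← map_mul]
    have : G.det * (α * (N' * ∑ j, y j * e j M)) = ∑ j, y j * (a' j M - a j M) := by
      simp only [he, Finset.mul_sum]
      exact Finset.sum_congr rfl fun j _ => by ring
    rw [this, map_sum]
    refine Finset.sum_congr rfl fun j _ => ?_
    rw [← smul_sub, map_smul, map_sub, hb, coef_ofInt hw, coef_ofInt hw, smul_eq_mul, map_mul,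
      map_sub]
  have h5 : u.val - 1 ∈ coeffIn k w (Ideal.span {α}) := by
    refine (mem_coeffIn_iff hw).2 ⟨fun M => ⟨_, ?_, h4 M⟩, fun M hM => ?_⟩
    · exact Ideal.mul_mem_right _ _ (Ideal.mem_span_singleton_self α)
    · exact coef_eq_zero_of_even hw (Submodule.sub_mem _ u.isSpin.1 (IsSpin.one _).1) hM
  refine ⟨?_, h5⟩
  have := add_mem (coeffIn_le_order _ h5) (one_mem_order k w)
  rwa [sub_add_cancel] at this

/-- If two translates have bases with the same Gram matrix and bounded entries, then they differ by
a bounded element. -/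
theorem exists_bound_of_gram {w : Fin (n + 1) → ℝ} (h : IsLorentz w) (R : ℝ) {J : Type*}
    [Fintype J] [DecidableEq J] (G : Matrix J J ℝ) : ∃ C : ℝ,
    ∀ (q : SpinGrp w) (b : Module.Basis J ℝ (Cl w)),
      (∀ i j, G i j = trForm w (b i) (b j)) → (∀ j M, |coef w M (b j)| ≤ R) →
      (∀ j M, |coef w M (q.val * b j)| ≤ R) →
      -bil w (basePt h).1 (act q (basePt h).1) ≤ C := by
  have hw := h.ne_zero
  set Z : ℝ := ∑ j, (∑ i, |G⁻¹ j i| * |R|) * |R| with hZ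
  refine ⟨∑ M, Z ^ 2 * |wprod w M|, fun q b hG hb hqb => ?_⟩
  have hGe : G = Matrix.of fun i j => trForm w (b i) (b j) := by ext i j; exact hG i j
  have hdet : IsUnit G.det := by
    rw [hGe]; exact (gram_det_ne_zero hw b).isUnit
  -- The coordinates of `1` in the basis depend only on `G` and on bounded real parts; multiplying
  -- by `q` writes `q` as a bounded combination of the bounded vectors `q b_j`.
  set z : J → ℝ := G⁻¹.mulVec fun i => coef w ∅ (b i) with hz
  have h1 : ∑ j, z j • b j = 1 := by
    refine sum_smul_eq_of_gram hw b fun i => ?_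
    have : G.mulVec z i = coef w ∅ (b i) := by
      rw [hz, Matrix.mulVec_mulVec, Matrix.mul_nonsing_inv _ hdet, Matrix.one_mulVec]
    rw [Matrix.mulVec, dotProduct] at this
    simp only [hG] at this
    rw [this, trForm_apply, CliffordAlgebra.reverse.map_one, mul_one, coef_empty]
  have hq : q.val = ∑ j, z j • (q.val * b j) := by
    have := congrArg (q.val * ·) h1
    simp only [Finset.mul_sum, mul_smul_comm, mul_one] at this
    exact this.symm
  have hqM : ∀ M, |coef w M q.val| ≤ Z := by
    intro M
    rw [hq, map_sum]
    refine (Finset.abs_sum_le_sum_abs _ _).trans (Finset.sum_le_sum fun j _ => ?_)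
    rw [map_smul, smul_eq_mul, abs_mul]
    refine mul_le_mul ?_ ((hqb j M).trans (le_abs_self R)) (abs_nonneg _) (by positivity)
    rw [hz, Matrix.mulVec, dotProduct]
    refine (Finset.abs_sum_le_sum_abs _ _).trans (Finset.sum_le_sum fun i _ => ?_)
    rw [abs_mul]
    exact mul_le_mul_of_nonneg_left ((hb i ∅).trans (le_abs_self R)) (abs_nonneg _)
  rw [neg_bil_basePt_act]
  refine Finset.sum_le_sum fun M _ => ?_
  rw [← sq_abs (coef w M q.val)]
  exact mul_le_mul_of_nonneg_right (pow_le_pow_left₀ (abs_nonneg _) (hqM M) 2) (abs_nonneg _)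

open scoped Classical in
/-- The principal congruence subgroups act on hyperbolic space with bounded fundamental domains. -/
theorem exists_bound_GamI (hk : Module.finrank ℚ k = 2) (h : IsAdmissible k w) {α : 𝓞 k}
    (hα : α ≠ 0) : ∃ R : ℝ, ∀ x : Hyp (realW k w), ∃ γ ∈ GamI k w (Ideal.span {α}),
      -bil (realW k w) (basePt h.isLorentz).1 (act γ x.1) ≤ R := by
  have hL := h.isLorentz
  have hw := hL.ne_zero
  obtain ⟨σ, hσ⟩ := exists_embedding_ne hk
  have : FiniteDimensional ℚ k := Module.finite_of_finrank_pos (by omega)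
  have : NumberField k := { to_charZero := inferInstance, to_finiteDimensional := this }
  obtain ⟨R, hR0, hR⟩ := exists_bounded_basis hk h hσ
  obtain ⟨C, hC⟩ := exists_bound_invariants h σ R
  choose a b hab ha hσa using hR
  choose φ hφ hφρ hφσ using fun s => hC s (a s) (ha s) (hσa s)
  set S : Set (InvIndex n (Finset (Fin (n + 1))) → 𝓞 k) :=
    {f | ∀ t, f t ∈ {x : 𝓞 k | |algebraMap (𝓞 k) ℝ x| ≤ C ∧ |σ (x : k)| ≤ C}} with hS
  have hSfin : S.Finite := Set.Finite.pi' fun _ => finite_setOf_abs_le hk hσ C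
  have hφS : ∀ s, φ s ∈ S := fun s t => ⟨hφρ s t, hφσ s t⟩
  set G : (InvIndex n (Finset (Fin (n + 1))) → 𝓞 k) →
      Matrix (Finset (Fin (n + 1))) (Finset (Fin (n + 1))) (𝓞 k) :=
    fun f => Matrix.of fun i j => f (.inl (.inl (i, j))) with hG
  have hGs : ∀ s i j, algebraMap (𝓞 k) ℝ (G (φ s) i j) = trForm (realW k w) (b s i) (b s j) := by
    intro s i j
    rw [hab, hab]
    exact hφ s (.inl (.inl (i, j)))
  have hdet : ∀ s, (G (φ s)).det ≠ 0 := by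
    intro s h0
    have := gram_det_ne_zero hw (b s)
    apply this
    rw [← map_zero (algebraMap (𝓞 k) ℝ), ← h0, RingHom.map_det]
    congr 1
    ext i j
    exact (hGs s i j).symm
  -- A common multiple of all Gram determinants that can occur; the factor `1` replaces those data
  -- in the finite set whose determinant vanishes.
  set N : 𝓞 k := ∏ f ∈ hSfin.toFinset, if (G f).det = 0 then 1 else (G f).det with hN
  have hN0 : N ≠ 0 := Finset.prod_ne_zero_iff.2 fun f _ => by
    split_ifs with h0
    · exact one_ne_zero
    · exact h0
  have hdvd : ∀ s, (G (φ s)).det ∣ N := fun s => by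
    have := Finset.dvd_prod_of_mem (fun f => if (G f).det = 0 then 1 else (G f).det)
      (hSfin.mem_toFinset.2 (hφS s))
    rwa [if_neg (hdet s)] at this
  have hfinq : Finite (𝓞 k ⧸ Ideal.span {N * α}) :=
    Ideal.finiteQuotientOfFreeOfNeBot _ (by
      rw [Ne, Ideal.span_singleton_eq_bot]; exact mul_ne_zero hN0 hα)
  have : Finite S := hSfin
  -- The finite invariant for the pigeonhole principle: Gram data together with the coefficients
  -- modulo `N α`. Elements with the same value as a fixed `c` yield translates that `Γ(α)` moves
  -- within a common bound.
  set κ : SpinGrp (realW k w) → S × (Finset (Fin (n + 1)) → Finset (Fin (n + 1)) →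
      𝓞 k ⧸ Ideal.span {N * α}) :=
    fun s => (⟨φ s, hφS s⟩, fun j M => Ideal.Quotient.mk _ (a s j M)) with hκ
  have key : ∀ c : Set.range κ, ∃ B : ℝ, ∀ s, κ s = c.1 → ∃ γ ∈ GamI k w (Ideal.span {α}),
      -bil (realW k w) (basePt hL).1 (act γ (act s⁻¹ (basePt hL).1)) ≤ B := by
    rintro ⟨_, c, rfl⟩
    obtain ⟨B, hB⟩ := exists_bound_of_gram hL R ((G (φ c)).map (algebraMap (𝓞 k) ℝ))
    refine ⟨2 * |bil (realW k w) (basePt hL).1 (act c⁻¹ (basePt hL).1)| * B, fun s hs => ?_⟩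
    have hφe : φ s = φ c := congrArg (fun x => x.1.1) hs
    have hae : ∀ j M, Ideal.Quotient.mk (Ideal.span {N * α}) (a s j M)
        = Ideal.Quotient.mk (Ideal.span {N * α}) (a c j M) := fun j M =>
      congrFun (congrFun (congrArg Prod.snd hs) j) M
    have hinv : ∀ t, invariants (b s) t = invariants (b c) t := fun t => by
      have e1 : (b s : _ → Cl (realW k w)) = fun j => ofInt w (a s j) := funext (hab s)
      have e2 : (b c : _ → Cl (realW k w)) = fun j => ofInt w (a c j) := funext (hab c)
      rw [e1, e2, ← hφ, ← hφ, hφe]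
    obtain ⟨u, hu⟩ := exists_spin_mul_eq hw (b s) (b c)
      (fun i j => hinv (.inl (.inl (i, j)))) (fun i j => hinv (.inl (.inr (i, j))))
      (fun p i j => hinv (.inr (.inl (p, i, j)))) (fun i j p q => hinv (.inr (.inr (i, j, p, q))))
    refine ⟨u, mem_GamI_of_congruent hw (b s) (hab s) (hGs s) (hdvd s) hae
      (fun j => by rw [hu, hab]), ?_⟩
    set bb : Module.Basis (Finset (Fin (n + 1))) ℝ (Cl (realW k w)) :=
      (b s).map (LinearEquiv.ofLinearMap (LinearMap.mulLeft ℝ s.val)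
        (LinearMap.mulLeft ℝ (CliffordAlgebra.reverse s.val))
        (LinearMap.ext fun x => by
          simp only [LinearMap.comp_apply, LinearMap.mulLeft_apply, LinearMap.id_apply]
          rw [← mul_assoc, val_mul_reverse, one_mul])
        (LinearMap.ext fun x => by
          simp only [LinearMap.comp_apply, LinearMap.mulLeft_apply, LinearMap.id_apply]
          rw [← mul_assoc, reverse_mul_val, one_mul])) with hbb
    have hbbj : ∀ j, bb j = s.val * b s j := fun j => rfl
    -- The element `c u s⁻¹` carries the bounded basis `s b_s` to the bounded basis `c b_c`, so it
    -- moves the base point a bounded amount.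
    have hq := hB (c * u * s⁻¹) bb (fun i j => by
        rw [hbbj, hbbj, trForm_val_mul hw, ← hGs s, hφe]; rfl)
      (fun j M => by rw [hbbj, hab]; exact ha s j M)
      (fun j M => by
        have : (c * u * s⁻¹).val * bb j = c.val * (b c j) := by
          rw [hbbj, ← hu, SpinGrp.val_mul, SpinGrp.val_mul, SpinGrp.val_inv]
          calc c.val * u.val * CliffordAlgebra.reverse s.val * (s.val * b s j)
              = c.val * u.val * ((CliffordAlgebra.reverse s.val * s.val) * b s j) := by
                simp only [mul_assoc]
            _ = _ := by rw [reverse_mul_val, one_mul, mul_assoc]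
        rw [this, hab]
        exact ha c j M)
    have hform : ∀ t : SpinGrp (realW k w), form (realW k w) (act t (basePt hL).1) = -1 :=
      fun t => by rw [form_act]; exact (basePt hL).2.1
    have h1 := abs_bil_le hL (x := (basePt hL).1) (y := act c⁻¹ (basePt hL).1)
      (z := act u (act s⁻¹ (basePt hL).1)) (basePt hL).2.1 (hform _)
      (by rw [form_act]; exact hform _)
    have h2 : bil (realW k w) (act c⁻¹ (basePt hL).1) (act u (act s⁻¹ (basePt hL).1))
        = bil (realW k w) (basePt hL).1 (act (c * u * s⁻¹) (basePt hL).1) := by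
      rw [← bil_act c, act_act_inv, ← act_mul, ← act_mul, mul_assoc]
    have h3 : |bil (realW k w) (act c⁻¹ (basePt hL).1) (act u (act s⁻¹ (basePt hL).1))| ≤ B := by
      rw [h2]
      have h4 := one_le_neg_bil hL (basePt hL) (actHyp hL (c * u * s⁻¹) (basePt hL))
      change 1 ≤ -bil (realW k w) (basePt hL).1 (act (c * u * s⁻¹) (basePt hL).1) at h4
      rw [abs_of_nonpos (by linarith)]
      exact hq
    refine (neg_le_abs _).trans (h1.trans ?_)
    gcongr
  choose B hB using key
  obtain ⟨Bmax, hBmax⟩ := (Set.finite_range B).bddAbove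
  refine ⟨Bmax, fun x => ?_⟩
  obtain ⟨s, hs⟩ := exists_act_eq hL x (basePt hL)
  obtain ⟨γ, hγ, hle⟩ := hB ⟨κ s, s, rfl⟩ s rfl
  refine ⟨γ, hγ, ?_⟩
  rw [← hs, act_inv_act, hs] at hle
  exact hle.trans (hBmax ⟨_, rfl⟩)

end Cocompact

/-! ### Quotients of hyperbolic space -/

section Quotients

variable {n : ℕ} {w : Fin (n + 1) → ℝ}

theorem continuous_bil : Continuous fun p : (Fin (n + 1) → ℝ) × (Fin (n + 1) → ℝ) =>
    bil w p.1 p.2 := by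
  unfold bil
  fun_prop

/-- On `f = -1` the zeroth coordinate never vanishes, so `x₀ > 0` may be replaced by the closed
condition `x₀ ≥ 0`. -/
theorem Hyp.isClosedEmbedding (h : IsLorentz w) :
    Topology.IsClosedEmbedding (fun x : Hyp w => x.1) := by
  refine ⟨Topology.IsEmbedding.subtypeVal, ?_⟩
  have e : Set.range (fun x : Hyp w => x.1)
      = {x | bil w x x = -1} ∩ {x | 0 ≤ x 0} := by
    ext x
    constructor
    · rintro ⟨x, rfl⟩
      exact ⟨by rw [Set.mem_ofPred_eq, ← form_eq_bil]; exact x.2.1, x.2.2.le⟩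
    · rintro ⟨h1, h2⟩
      have h3 : form w x = -1 := by rw [form_eq_bil]; exact h1
      exact ⟨⟨x, h3, lt_of_le_of_ne h2
        (zero_ne_of_form_neg h (by rw [h3]; norm_num)).symm⟩, rfl⟩
  rw [e]
  refine IsClosed.inter (isClosed_eq ?_ continuous_const)
    (isClosed_le continuous_const (continuous_apply 0))
  exact continuous_bil.comp (continuous_id.prodMk continuous_id)

/-- The condition bounds `x₀`, and the equation `f = -1` then bounds the remaining coordinates. -/
theorem isCompact_setOf_neg_bil_le (h : IsLorentz w) (R : ℝ) :
    IsCompact {x : Hyp w | -bil w (basePt h).1 x.1 ≤ R} := by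
  set S : Set (Fin (n + 1) → ℝ) := (fun x : Hyp w => x.1) '' {x : Hyp w | -bil w (basePt h).1 x.1 ≤ R} with hS
  have hcl : IsClosed {x : Hyp w | -bil w (basePt h).1 x.1 ≤ R} := by
    refine isClosed_le (Continuous.neg ?_) continuous_const
    exact continuous_bil.comp (continuous_const.prodMk continuous_subtype_val)
  have hw0 : 0 < √(-w 0) := Real.sqrt_pos.2 (by linarith [h.1])
  set B : ℝ := R / √(-w 0) with hB
  set A : ℝ := ∑ i : Fin n, (-w 0 * B ^ 2) / w i.succ with hA
  have hbd : Bornology.IsBounded S := by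
    rw [isBounded_iff_forall_norm_le]
    refine ⟨|B| + (1 + A), ?_⟩
    rintro _ ⟨x, hx, rfl⟩
    have hx0 := x.2.2
    have hxB : x.1 0 ≤ B := by
      change -bil w (basePt h).1 x.1 ≤ R at hx
      rw [bil_basePt] at hx
      rw [hB, le_div_iff₀ hw0]
      linarith
    have hB0 : 0 ≤ B := hx0.le.trans hxB
    have hsq : x.1 0 ^ 2 ≤ B ^ 2 := by gcongr
    have hAi : ∀ i : Fin n, 0 ≤ (-w 0 * B ^ 2) / w i.succ := fun i => by
      have := h.2 i.succ (Fin.succ_ne_zero i)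
      have := h.1
      exact div_nonneg (mul_nonneg (by linarith) (sq_nonneg _)) (by linarith)
    have hA0 : 0 ≤ A := Finset.sum_nonneg fun i _ => hAi i
    rw [pi_norm_le_iff_of_nonneg (by positivity)]
    intro i
    rw [Real.norm_eq_abs]
    rcases Fin.eq_zero_or_eq_succ i with rfl | ⟨i, rfl⟩
    · rw [abs_of_pos hx0, abs_of_nonneg hB0]; linarith
    · have h1 := x.2.1
      rw [form_eq_bil, bil_succ] at h1
      have h2 := Finset.single_le_sum (f := fun i : Fin n => w i.succ * x.1 i.succ * x.1 i.succ)
        (fun i _ => by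
          have := h.2 i.succ (Fin.succ_ne_zero i)
          nlinarith [mul_nonneg this.le (sq_nonneg (x.1 i.succ))]) (Finset.mem_univ i)
      have hwi := h.2 i.succ (Fin.succ_ne_zero i)
      have h3 : w i.succ * x.1 i.succ ^ 2 ≤ -w 0 * B ^ 2 := by
        have h4 := mul_le_mul_of_nonneg_left hsq (by linarith [h.1] : (0 : ℝ) ≤ -w 0)
        have h5 : w i.succ * x.1 i.succ ^ 2 = w i.succ * x.1 i.succ * x.1 i.succ := by ring
        have h6 : w 0 * x.1 0 * x.1 0 = - (-w 0 * x.1 0 ^ 2) := by ring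
        rw [h5]
        linarith
      have h4 : x.1 i.succ ^ 2 ≤ A := by
        have : x.1 i.succ ^ 2 ≤ (-w 0 * B ^ 2) / w i.succ := by
          rw [le_div_iff₀ hwi]; linarith
        exact this.trans (Finset.single_le_sum (f := fun i : Fin n => (-w 0 * B ^ 2) / w i.succ)
          (fun i _ => hAi i) (Finset.mem_univ i))
      have h5 : |x.1 i.succ| ≤ 1 + A := by
        rw [abs_le]
        constructor <;> nlinarith
      linarith [abs_nonneg B]
  refine (Hyp.isClosedEmbedding h).isInducing.isCompact_iff.2 ?_
  exact Metric.isCompact_of_isClosed_isBounded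
    ((Hyp.isClosedEmbedding h).isClosedMap _ hcl) hbd

theorem compactSpace_hypQuot (h : IsLorentz w) {G : Subgroup (SpinGrp w)} {R : ℝ}
    (hR : ∀ x : Hyp w, ∃ γ ∈ G, -bil w (basePt h).1 (act γ x.1) ≤ R) :
    CompactSpace (HypQuot G) := by
  have hc := (isCompact_setOf_neg_bil_le h R).image
    (continuous_quotient_mk' (s := orbitSetoid G))
  refine ⟨?_⟩
  convert hc
  symm
  rw [Set.eq_univ_iff_forall]
  intro q
  induction q using Quotient.inductionOn with
  | h x =>
    obtain ⟨γ, hγ, hle⟩ := hR x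
    refine ⟨actHyp h γ x, hle, ?_⟩
    exact Quotient.sound (s := orbitSetoid G)
      ⟨γ⁻¹, inv_mem hγ, act_inv_act γ x.1⟩

/-- Triangle inequality along the base point, `y = s x`, and the image of the base point; it turns a
statement about compact sets into one about coefficients. -/
theorem sum_coef_le_of_act_eq (h : IsLorentz w) {s : SpinGrp w} {x y : Hyp w} {R : ℝ}
    (hxy : act s x.1 = y.1) (hx : -bil w (basePt h).1 x.1 ≤ R)
    (hy : -bil w (basePt h).1 y.1 ≤ R) :
    ∑ M, coef w M s.val ^ 2 * |wprod w M| ≤ 2 * R * R := by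
  rw [← neg_bil_basePt_act h s]
  have h1 := one_le_neg_bil h (basePt h) x
  have h2 := one_le_neg_bil h (basePt h) y
  have h3 := abs_bil_le h (x := (basePt h).1) (y := y.1) (z := act s (basePt h).1)
    (basePt h).2.1 y.2.1 (by rw [form_act]; exact (basePt h).2.1)
  have h4 : bil w y.1 (act s (basePt h).1) = bil w (basePt h).1 x.1 := by
    rw [← hxy, bil_act, bil_comm]
  rw [h4] at h3
  refine (neg_le_abs _).trans (h3.trans ?_)
  rw [abs_of_nonpos (by linarith), abs_of_nonpos (by linarith)]
  have : 0 ≤ R := by linarith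
  gcongr

theorem finite_setOf_act_mem (h : IsLorentz w) {G : Subgroup (SpinGrp w)}
    (hG : ∀ R : ℝ, {s : SpinGrp w | s ∈ G ∧
      ∑ M, coef w M s.val ^ 2 * |wprod w M| ≤ R}.Finite) (K : Set (Hyp w)) (hK : IsCompact K) :
    {s : SpinGrp w | s ∈ G ∧ ∃ x ∈ K, ∃ y ∈ K, act s x.1 = y.1}.Finite := by
  have hcont : Continuous fun x : Hyp w => -bil w (basePt h).1 x.1 :=
    (continuous_bil.comp (continuous_const.prodMk continuous_subtype_val)).neg
  obtain ⟨R, hR⟩ := hK.bddAbove_image hcont.continuousOn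
  refine (hG (2 * R * R)).subset ?_
  rintro s ⟨hs, x, hx, y, hy, hxy⟩
  exact ⟨hs, sum_coef_le_of_act_eq h hxy (hR ⟨x, hx, rfl⟩) (hR ⟨y, hy, rfl⟩)⟩

/-- The quotient of a locally compact Hausdorff space by a properly discontinuous action is
Hausdorff; needed for the embedding of the surface. -/
theorem t2Space_hypQuot (h : IsLorentz w) {G : Subgroup (SpinGrp w)}
    (hG : ∀ K : Set (Hyp w), IsCompact K →
      {s : SpinGrp w | s ∈ G ∧ ∃ x ∈ K, ∃ y ∈ K, act s x.1 = y.1}.Finite) :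
    T2Space (HypQuot G) := by
  let : MulAction G (Hyp w) :=
    { smul := fun s x => actHyp h s.1 x
      one_smul := fun x => Subtype.ext (act_one x.1)
      mul_smul := fun s t x => Subtype.ext (act_mul s.1 t.1 x.1) }
  have hT2 : T2Space (Hyp w) := inferInstanceAs (T2Space {x : Fin (n + 1) → ℝ // _})
  have hlc : LocallyCompactSpace (Hyp w) := (Hyp.isClosedEmbedding h).locallyCompactSpace
  have hcs : ContinuousConstSMul G (Hyp w) := ⟨fun s => by
    refine Continuous.subtype_mk ?_ _
    exact (LinearMap.continuous_of_finiteDimensional (act s.1)).comp continuous_subtype_val⟩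
  have hpd : ProperlyDiscontinuousSMul G (Hyp w) := ⟨fun {K L} hK hL => by
    refine Set.Finite.of_finite_image (f := Subtype.val)
      ((hG (K ∪ L) (hK.union hL)).subset ?_) Subtype.val_injective.injOn
    rintro _ ⟨s, hs, rfl⟩
    obtain ⟨_, ⟨x, hx, rfl⟩, hy⟩ := hs
    exact ⟨s.2, x, Or.inl hx, s • x, Or.inr hy, rfl⟩⟩
  have e : orbitSetoid G = MulAction.orbitRel G (Hyp w) := by
    ext x y
    constructor
    · rintro ⟨s, hs, hxy⟩
      refine (MulAction.orbitRel G (Hyp w)).symm ⟨⟨s, hs⟩, Subtype.ext hxy⟩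
    · intro hxy
      obtain ⟨s, hs⟩ := (MulAction.orbitRel G (Hyp w)).symm hxy
      exact ⟨s.1, s.2, congrArg Subtype.val hs⟩
  change T2Space (Quotient (orbitSetoid G))
  rw [e]
  exact t2Space_of_properlyDiscontinuousSMul_of_t2Space

/-- A group with a bounded fundamental domain has finite index in every group that acts properly
discontinuously. -/
theorem relIndex_ne_zero (h : IsLorentz w) {H G : Subgroup (SpinGrp w)} (hHG : H ≤ G) {R : ℝ}
    (hR : ∀ x : Hyp w, ∃ γ ∈ H, -bil w (basePt h).1 (act γ x.1) ≤ R)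
    (hG : ∀ R : ℝ, {s : SpinGrp w | s ∈ G ∧
      ∑ M, coef w M s.val ^ 2 * |wprod w M| ≤ R}.Finite) : H.relIndex G ≠ 0 := by
  set F := {s : SpinGrp w | s ∈ G ∧ ∑ M, coef w M s.val ^ 2 * |wprod w M| ≤ R} with hF
  have : Finite F := hG R
  have : Finite (G ⧸ H.subgroupOf G) := by
    refine Finite.of_surjective (fun f : F => QuotientGroup.mk (⟨f.1, f.2.1⟩⁻¹ : G)) fun q => ?_
    obtain ⟨g, rfl⟩ := QuotientGroup.mk_surjective q
    -- Each coset `gH` contains `(γ g⁻¹)⁻¹`, where `γ ∈ H` brings `g⁻¹` of the base point back into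
    -- the ball; such elements `γ g⁻¹` are finite in number.
    obtain ⟨γ, hγ, hle⟩ := hR (actHyp h (g.1⁻¹) (basePt h))
    have hf : γ * g.1⁻¹ ∈ F := by
      refine ⟨mul_mem (hHG hγ) (inv_mem g.2), ?_⟩
      rw [← neg_bil_basePt_act h, act_mul]
      exact hle
    refine ⟨⟨_, hf⟩, ?_⟩
    rw [QuotientGroup.eq, Subgroup.mem_subgroupOf]
    simpa using hγ
  rw [Subgroup.relIndex, Subgroup.index]
  exact Nat.card_pos.ne'

/-- Points of the form `(cosh, sinh)` in the plane of `e_0` and `e_1` go to infinity, which needs a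
second coordinate. -/
theorem exists_lt_neg_bil (h : IsLorentz w) (hn : n ≠ 0) (R : ℝ) :
    ∃ x : Hyp w, R < -bil w (basePt h).1 x.1 := by
  obtain ⟨m, rfl⟩ := Nat.exists_eq_succ_of_ne_zero hn
  have hw0 : 0 < √(-w 0) := Real.sqrt_pos.2 (by linarith [h.1])
  have hw1 : 0 < w 1 := h.2 1 (by simp)
  have hs1 : 0 < √(w 1) := Real.sqrt_pos.2 hw1
  have hsq0 := Real.sq_sqrt (by linarith [h.1] : (0 : ℝ) ≤ -w 0)
  have hsq1 := Real.sq_sqrt hw1.le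
  set b : ℝ := |R| + 1 with hb
  have hb1 : 0 < b := by positivity
  set a : ℝ := √(1 + b ^ 2) with ha
  have ha0 : 0 < a := Real.sqrt_pos.2 (by positivity)
  have hasq : a ^ 2 = 1 + b ^ 2 := Real.sq_sqrt (by positivity)
  have hab : b < a := by nlinarith
  set x : Fin (m.succ + 1) → ℝ := fun i => if i = 0 then a / √(-w 0)
    else if i = 1 then b / √(w 1) else 0 with hx
  have hx0 : x 0 = a / √(-w 0) := by simp [hx]
  have hx1 : x (Fin.succ 0) = b / √(w 1) := by
    have : (Fin.succ 0 : Fin (m.succ + 1)) = 1 := rfl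
    simp [hx, this]
  have hxs : ∀ i : Fin m, x i.succ.succ = 0 := fun i => by
    have h1 : (i.succ.succ : Fin (m.succ + 1)) ≠ 1 := by
      intro h2
      have := congrArg Fin.val h2
      simp at this
    simp [hx, h1]
  have hform : form w x = -1 := by
    rw [form_eq_bil, bil_succ, Fin.sum_univ_succ, hx0, hx1]
    simp only [hxs, mul_zero, Finset.sum_const_zero, add_zero]
    have e0 : w 0 * (a / √(-w 0)) * (a / √(-w 0)) = -a ^ 2 := by
      field_simp
      rw [hsq0]; ring
    have e1 : w (Fin.succ 0) * (b / √(w 1)) * (b / √(w 1)) = b ^ 2 := by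
      have : (Fin.succ 0 : Fin (m.succ + 1)) = 1 := rfl
      rw [this]
      field_simp
      rw [hsq1]
    rw [e0, e1]; linarith
  refine ⟨⟨x, hform, by rw [hx0]; positivity⟩, ?_⟩
  rw [bil_basePt]
  change R < -(-√(-w 0) * x 0)
  rw [hx0, neg_mul, neg_neg, mul_div_cancel₀ _ hw0.ne']
  linarith [le_abs_self R]

end Quotients

/-! ### Coordinate subspaces -/

section Subspaces

variable {n d : ℕ} (hd : d ≤ n) {w : Fin (n + 1) → ℝ}

/-- The inclusion of the first coordinates. -/
def coordEmb : Fin (d + 1) ↪o Fin (n + 1) := Fin.castLEOrderEmb (Nat.add_le_add_right hd 1)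

theorem clIncl_gen (w : Fin (n + 1) → ℝ) (i : Fin (d + 1)) :
    clIncl hd w (gen (restr hd w) i) = gen w (coordEmb hd i) := by
  rw [gen, clIncl_vec, gen]
  congr 1
  funext j
  by_cases hj : ∃ l, Fin.castLE (Nat.add_le_add_right hd 1) l = j
  · obtain ⟨l, rfl⟩ := hj
    rw [coordIncl_castLE, Pi.single_apply, Pi.single_apply]
    have : Fin.castLE (Nat.add_le_add_right hd 1) l = coordEmb hd i ↔ l = i :=
      (coordEmb hd).injective.eq_iff
    simp only [this]
  · rw [coordIncl_of_not_mem hd _ j hj, Pi.single_apply, if_neg]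
    rintro rfl
    exact hj ⟨i, rfl⟩

theorem clIncl_genProd (w : Fin (n + 1) → ℝ) (M : Finset (Fin (d + 1))) :
    clIncl hd w (genProd (restr hd w) M) = genProd w (M.map (coordEmb hd).toEmbedding) := by
  have e : (M.map (coordEmb hd).toEmbedding).sort (· ≤ ·)
      = (M.sort (· ≤ ·)).map (coordEmb hd) := by
    have h1 : ((M.sort (· ≤ ·)).map (coordEmb hd)).Pairwise (· < ·) := by
      rw [List.pairwise_map]
      exact M.sortedLT_sort.pairwise.imp fun h => (coordEmb hd).lt_iff_lt.2 h
    have h2 := (List.toFinset_sort (· ≤ ·) (h1.imp ne_of_lt)).2 (h1.imp le_of_lt)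
    rw [← h2]
    congr 1
    ext i
    simp
  rw [genProd, genProd, e, map_list_prod, List.map_map, List.map_map]
  congr 2
  funext i
  exact clIncl_gen hd w i

theorem coef_clIncl_map (hw : ∀ i, w i ≠ 0) (M : Finset (Fin (d + 1))) (c : Cl (restr hd w)) :
    coef w (M.map (coordEmb hd).toEmbedding) (clIncl hd w c) = coef (restr hd w) M c := by
  have hw' : ∀ i, restr hd w i ≠ 0 := fun i => hw _
  conv_lhs => rw [← sum_coef_smul hw' c]
  rw [map_sum, map_sum, Finset.sum_eq_single M]
  · rw [map_smul, map_smul, clIncl_genProd, coef_genProd hw, if_pos rfl, smul_eq_mul, mul_one]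
  · intro N _ hN
    rw [map_smul, map_smul, clIncl_genProd, coef_genProd hw, if_neg, smul_eq_mul, mul_zero]
    exact fun h => hN (Finset.map_injective _ h)
  · simp

theorem coef_clIncl_of_not_mem (hw : ∀ i, w i ≠ 0) {N : Finset (Fin (n + 1))} {i : Fin (n + 1)}
    (hiN : i ∈ N) (hi : i ∉ Set.range (coordEmb hd)) (c : Cl (restr hd w)) :
    coef w N (clIncl hd w c) = 0 := by
  have hw' : ∀ i, restr hd w i ≠ 0 := fun i => hw _
  rw [← sum_coef_smul hw' c, map_sum, map_sum]
  refine Finset.sum_eq_zero fun M _ => ?_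
  rw [map_smul, map_smul, clIncl_genProd, coef_genProd hw, if_neg, smul_zero]
  rintro rfl
  obtain ⟨j, _, hj⟩ := Finset.mem_map.1 hiN
  exact hi ⟨j, hj⟩

theorem exists_map_eq_or (hd : d ≤ n) (N : Finset (Fin (n + 1))) :
    (∃ M : Finset (Fin (d + 1)), N = M.map (coordEmb hd).toEmbedding) ∨
      ∃ i ∈ N, i ∉ Set.range (coordEmb hd) := by
  by_cases h : ∃ i ∈ N, i ∉ Set.range (coordEmb hd)
  · exact Or.inr h
  · push Not at h
    refine Or.inl ⟨N.preimage (coordEmb hd) (coordEmb hd).injective.injOn, ?_⟩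
    ext i
    simp only [Finset.mem_map, Finset.mem_preimage]
    constructor
    · intro hi
      obtain ⟨j, rfl⟩ := h i hi
      exact ⟨j, hi, rfl⟩
    · rintro ⟨j, hj, rfl⟩
      exact hj

theorem clIncl_injective (hw : ∀ i, w i ≠ 0) : Function.Injective (clIncl hd w) := by
  intro c c' h
  refine ext_coef (fun i => hw _) fun M => ?_
  rw [← coef_clIncl_map hd hw, ← coef_clIncl_map hd hw, h]

theorem realPart_clIncl (hw : ∀ i, w i ≠ 0) (c : Cl (restr hd w)) :
    realPart w (clIncl hd w c) = realPart (restr hd w) c := by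
  rw [← coef_empty, ← coef_empty, ← coef_clIncl_map hd hw, Finset.map_empty]

theorem spinIncl_injective (hw : ∀ i, w i ≠ 0) : Function.Injective (spinIncl hd w) := by
  intro s t h
  refine SpinGrp.val_injective (clIncl_injective hd hw ?_)
  rw [← val_spinIncl, ← val_spinIncl, h]

/-- An element of the spin group that only involves the first coordinates comes from the spin group
of the restricted form. -/
theorem exists_spinIncl_eq (hw : ∀ i, w i ≠ 0) {s : SpinGrp w}
    (hs : ∀ (N : Finset (Fin (n + 1))) (i), i ∈ N → i ∉ Set.range (coordEmb hd) →
      coef w N s.val = 0) : ∃ c : SpinGrp (restr hd w), spinIncl hd w c = s := by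
  have hw' : ∀ i, restr hd w i ≠ 0 := fun i => hw _
  set c : Cl (restr hd w) := ∑ M, coef w (M.map (coordEmb hd).toEmbedding) s.val •
    genProd (restr hd w) M with hc
  have hcM : ∀ M, coef (restr hd w) M c = coef w (M.map (coordEmb hd).toEmbedding) s.val :=
    fun M => by
      have := coef_sum_smul hw' Finset.univ
        (fun M => coef w (M.map (coordEmb hd).toEmbedding) s.val) M
      rwa [if_pos (Finset.mem_univ M)] at this
  have hcs : clIncl hd w c = s.val := by
    refine ext_coef hw fun N => ?_
    rcases exists_map_eq_or hd N with ⟨M, rfl⟩ | ⟨i, hi, hi'⟩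
    · rw [coef_clIncl_map hd hw, hcM]
    · rw [coef_clIncl_of_not_mem hd hw hi hi', hs N i hi hi']
  have hspin : IsSpin (restr hd w) c := by
    refine ⟨?_, fun x => ?_, ?_⟩
    · rw [mem_even_iff hw']
      intro M hM
      rw [hcM]
      refine coef_eq_zero_of_even hw s.isSpin.1 ?_
      rwa [Finset.card_map]
    · obtain ⟨y, hy⟩ := s.isSpin.2.1 (coordIncl hd x)
      refine ⟨vecCoef _ (c * vec (restr hd w) x * CliffordAlgebra.reverse c), ?_⟩
      have e1 : clIncl hd w (c * vec (restr hd w) x * CliffordAlgebra.reverse c) = vec w y := by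
        rw [map_mul, map_mul, clIncl_vec, clIncl_reverse, hcs, hy]
      refine ext_coef hw' fun M => ?_
      have e2 : ∀ (m : ℕ) (v : Fin (m + 1) → ℝ) (hv : ∀ i, v i ≠ 0) (z : Fin (m + 1) → ℝ)
          (M : Finset (Fin (m + 1))), (∀ i, M ≠ {i}) → coef v M (vec v z) = 0 := by
        intro m v hv z M hM
        rw [vec_eq_sum v z, map_sum]
        refine Finset.sum_eq_zero fun i _ => ?_
        rw [map_smul, ← genProd_singleton, coef_genProd hv, if_neg (fun h => hM i h.symm), smul_zero]
      by_cases hM : ∃ i, M = {i}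
      · obtain ⟨i, rfl⟩ := hM
        rw [← vecCoef_apply, ← vecCoef_apply, vecCoef_vec hw']
      · push Not at hM
        rw [e2 _ _ hw' _ M hM, ← coef_clIncl_map hd hw, e1, e2 _ _ hw]
        intro i hi
        have hcard := congrArg Finset.card hi
        rw [Finset.card_map, Finset.card_singleton] at hcard
        obtain ⟨j, hj⟩ := Finset.card_eq_one.1 hcard
        exact hM j hj
    · apply clIncl_injective hd hw
      rw [map_mul, clIncl_reverse, hcs, map_one, val_mul_reverse]
  exact ⟨hspin.toSpinGrp, SpinGrp.val_injective (by
    rw [val_spinIncl, IsSpin.val_toSpinGrp, hcs])⟩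

/-! ### Reflections in the coordinate hyperplanes -/

/-- The reflection in the hyperplane `x_i = 0`. -/
def flip (i : Fin (n + 1)) : (Fin (n + 1) → ℝ) →ₗ[ℝ] (Fin (n + 1) → ℝ) :=
  LinearMap.pi fun j => (if j = i then (-1 : ℝ) else 1) • LinearMap.proj j

theorem flip_apply (i j : Fin (n + 1)) (x : Fin (n + 1) → ℝ) :
    flip i x j = (if j = i then -1 else 1) * x j := rfl

theorem flip_flip (i : Fin (n + 1)) (x : Fin (n + 1) → ℝ) : flip i (flip i x) = x := by
  funext j
  rw [flip_apply, flip_apply]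
  split_ifs <;> ring

/-- The automorphism of the Clifford algebra induced by a coordinate reflection. -/
def flipCl (w : Fin (n + 1) → ℝ) (i : Fin (n + 1)) : Cl w →ₐ[ℝ] Cl w :=
  CliffordAlgebra.map
    { flip i with
      map_app' := fun x => by
        change form w (flip i x) = _
        rw [form_apply, form_apply]
        refine Finset.sum_congr rfl fun j _ => ?_
        rw [flip_apply]
        split_ifs <;> ring }

theorem flipCl_vec (i : Fin (n + 1)) (x : Fin (n + 1) → ℝ) :
    flipCl w i (vec w x) = vec w (flip i x) := CliffordAlgebra.map_apply_ι _ _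

theorem flipCl_genProd (i : Fin (n + 1)) (M : Finset (Fin (n + 1))) :
    flipCl w i (genProd w M) = (if i ∈ M then (-1 : ℝ) else 1) • genProd w M := by
  have hgen : ∀ j, flipCl w i (gen w j) = (if j = i then (-1 : ℝ) else 1) • gen w j := by
    intro j
    rw [gen, flipCl_vec, ← map_smul]
    congr 1
    funext l
    rw [flip_apply, Pi.smul_apply, smul_eq_mul, Pi.single_apply]
    by_cases h : l = j
    · rw [h]
    · simp [h]
  have hl : ∀ l : List (Fin (n + 1)), flipCl w i ((l.map (gen w)).prod)
      = ((l.map fun j => if j = i then (-1 : ℝ) else 1).prod) • (l.map (gen w)).prod := by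
    intro l
    induction l with
    | nil => simp
    | cons a l ih =>
      rw [List.map_cons, List.prod_cons, map_mul, ih, hgen, smul_mul_smul_comm, List.map_cons,
        List.prod_cons]
  rw [genProd, hl]
  congr 1
  have : (((M.sort (· ≤ ·)).map fun j => if j = i then (-1 : ℝ) else 1)).prod
      = ∏ j ∈ M, if j = i then (-1 : ℝ) else 1 := by
    rw [← List.prod_toFinset _ (M.sort_nodup _), Finset.sort_toFinset]
  rw [this, Finset.prod_ite_eq']

theorem coef_flipCl (hw : ∀ i, w i ≠ 0) (i : Fin (n + 1)) (M : Finset (Fin (n + 1))) (c : Cl w) :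
    coef w M (flipCl w i c) = (if i ∈ M then -1 else 1) * coef w M c := by
  conv_lhs => rw [← sum_coef_smul hw c]
  rw [map_sum, map_sum, Finset.sum_eq_single M]
  · rw [map_smul, flipCl_genProd, map_smul, map_smul, coef_genProd hw]
    simp [mul_comm]
  · intro N _ hN
    rw [map_smul, flipCl_genProd, map_smul, map_smul, coef_genProd hw]
    simp [hN]
  · simp

theorem flipCl_reverse (i : Fin (n + 1)) (c : Cl w) :
    flipCl w i (CliffordAlgebra.reverse c) = CliffordAlgebra.reverse (flipCl w i c) := by
  induction c using CliffordAlgebra.induction with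
  | algebraMap r => simp
  | ι x =>
    rw [CliffordAlgebra.reverse_ι]
    erw [flipCl_vec]
    rw [CliffordAlgebra.reverse_ι]
  | mul a b ha hb => simp only [CliffordAlgebra.reverse.map_mul, map_mul, ha, hb]
  | add a b ha hb => simp only [map_add, ha, hb]

theorem isSpin_flipCl (hw : ∀ i, w i ≠ 0) (i : Fin (n + 1)) (s : SpinGrp w) :
    IsSpin w (flipCl w i s.val) := by
  refine ⟨?_, fun x => ?_, ?_⟩
  · rw [mem_even_iff hw]
    intro M hM
    rw [coef_flipCl hw, coef_eq_zero_of_even hw s.isSpin.1 hM, mul_zero]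
  · refine ⟨flip i (act s (flip i x)), ?_⟩
    rw [← flipCl_vec, vec_act, map_mul, map_mul, flipCl_reverse, flipCl_vec, flip_flip]
  · rw [← flipCl_reverse, ← map_mul, val_mul_reverse, map_one]

/-- The action of a coordinate reflection on the spin group. -/
def flipSpin (hw : ∀ i, w i ≠ 0) (i : Fin (n + 1)) (s : SpinGrp w) : SpinGrp w :=
  (isSpin_flipCl hw i s).toSpinGrp

theorem val_flipSpin (hw : ∀ i, w i ≠ 0) (i : Fin (n + 1)) (s : SpinGrp w) :
    (flipSpin hw i s).val = flipCl w i s.val := rfl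

theorem act_flipSpin (hw : ∀ i, w i ≠ 0) (i : Fin (n + 1)) (s : SpinGrp w)
    (x : Fin (n + 1) → ℝ) : act (flipSpin hw i s) x = flip i (act s (flip i x)) := by
  apply vec_injective w
  rw [vec_act, val_flipSpin, ← flipCl_vec, vec_act, map_mul, map_mul, flipCl_reverse, flipCl_vec,
    flip_flip]

theorem flip_coordIncl {i : Fin (n + 1)} (hi : i ∉ Set.range (coordEmb hd))
    (x : Fin (d + 1) → ℝ) : flip i (coordIncl hd x) = coordIncl hd x := by
  funext j
  rw [flip_apply]
  split_ifs with h
  · subst h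
    rw [coordIncl_of_not_mem hd x j hi, mul_zero]
  · rw [one_mul]

/-- A group that acts freely and is invariant under the coordinate reflections that fix `E'`
defines a totally geodesic submanifold. -/
theorem isTotallyGeodesicIn_of_flip (h : IsLorentz w) {G' : Subgroup (SpinGrp (restr hd w))}
    {G : Subgroup (SpinGrp w)} (hG : ∀ s, s ∈ G' ↔ spinIncl hd w s ∈ G)
    (hfree : ∀ s ∈ G, ∀ x : Hyp w, act s x.1 = x.1 → s = 1)
    (hflip : ∀ i, ∀ s ∈ G, flipSpin h.ne_zero i s ∈ G)
    (hT2 : T2Space (HypQuot G)) (hcpt : CompactSpace (HypQuot G')) :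
    IsTotallyGeodesicIn hd w G' G := by
  have hw := h.ne_zero
  have hcont : Continuous (hypIncl hd w) := by
    refine Continuous.subtype_mk ?_ _
    exact (LinearMap.continuous_of_finiteDimensional (coordIncl hd)).comp continuous_subtype_val
  refine ⟨fun s hs => (hG s).1 hs, ?_, ?_⟩
  · have hq : Continuous (quotMap hd w G' G fun s hs => (hG s).1 hs) :=
      Continuous.quotient_map' hcont _
    -- A continuous injection of a compact space into a Hausdorff space is a closed embedding, so
    -- only injectivity remains.
    refine (hq.isClosedEmbedding ?_).isEmbedding
    intro x y
    refine Quotient.inductionOn₂ x y fun x y hxy => ?_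
    obtain ⟨s, hs, hsxy⟩ := Quotient.exact (s := orbitSetoid G) hxy
    change act s (coordIncl hd x.1) = coordIncl hd y.1 at hsxy
    -- The reflection fixes `x` and `y`, so `s` and its reflected copy both send `x` to `y`;
    -- freeness makes them equal. Coefficients at sets containing a reflected index then equal their
    -- negatives and vanish.
    have hfix : ∀ i, i ∉ Set.range (coordEmb hd) → flipSpin hw i s = s := by
      intro i hi
      have h1 : act (s⁻¹ * flipSpin hw i s) (hypIncl hd w x).1 = (hypIncl hd w x).1 := by
        change act (s⁻¹ * flipSpin hw i s) (coordIncl hd x.1) = coordIncl hd x.1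
        rw [act_mul, act_flipSpin, flip_coordIncl hd hi, hsxy, flip_coordIncl hd hi, ← hsxy,
          act_inv_act]
      have h2 := hfree _ (mul_mem (inv_mem hs) (hflip i s hs)) _ h1
      exact (inv_mul_eq_one.1 h2).symm
    obtain ⟨c, rfl⟩ := exists_spinIncl_eq hd hw (s := s) fun N i hiN hi => by
      have h1 := coef_flipCl hw i N s.val
      rw [← val_flipSpin hw, hfix i hi, if_pos hiN] at h1
      linarith
    refine Quotient.sound (s := orbitSetoid G') ⟨c, (hG c).2 hs, ?_⟩
    rw [act_spinIncl] at hsxy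
    funext j
    rw [← coordIncl_castLE hd (act c x.1), hsxy, coordIncl_castLE]
  · rintro c ⟨g, hg, hgc⟩
    refine ⟨fun t => hypIncl hd w (g t), fun s t => ?_, fun t => ?_⟩
    · rw [hdist_hypIncl]; exact hg s t
    · rw [Function.comp_apply, hgc]; rfl

end Subspaces

/-! ### Integral structures under coordinate inclusions and reflections -/

section ArithmeticSubspaces

variable {k : IntermediateField ℚ ℝ} {n d : ℕ} (hd : d ≤ n) {w : Fin (n + 1) → 𝓞 k}

theorem clIncl_mem_coeffIn_iff (hw : ∀ i, realW k w i ≠ 0) {I : Ideal (𝓞 k)}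
    {c : Cl (realW k (restr hd w))} :
    clIncl hd (realW k w) c ∈ coeffIn k w I ↔ c ∈ coeffIn k (restr hd w) I := by
  have hw' : ∀ i, realW k (restr hd w) i ≠ 0 := fun i => hw _
  rw [mem_coeffIn_iff hw, mem_coeffIn_iff hw']
  constructor
  · rintro ⟨h1, h2⟩
    refine ⟨fun M => ?_, fun M hM => ?_⟩
    · obtain ⟨a, ha, h⟩ := h1 (M.map (coordEmb hd).toEmbedding)
      exact ⟨a, ha, (coef_clIncl_map hd hw M c).symm.trans h⟩
    · exact (coef_clIncl_map hd hw M c).symm.trans (h2 _ (by rwa [Finset.card_map]))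
  · rintro ⟨h1, h2⟩
    refine ⟨fun N => ?_, fun N hN => ?_⟩
    · rcases exists_map_eq_or hd N with ⟨M, rfl⟩ | ⟨i, hi, hi'⟩
      · obtain ⟨a, ha, h⟩ := h1 M
        exact ⟨a, ha, (coef_clIncl_map hd hw M c).trans h⟩
      · exact ⟨0, I.zero_mem, by rw [coef_clIncl_of_not_mem hd hw hi hi', map_zero]⟩
    · rcases exists_map_eq_or hd N with ⟨M, rfl⟩ | ⟨i, hi, hi'⟩
      · exact (coef_clIncl_map hd hw M c).trans (h2 M (by rwa [Finset.card_map] at hN))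
      · exact coef_clIncl_of_not_mem hd hw hi hi' c

theorem spinIncl_mem_Gam_iff (hw : ∀ i, realW k w i ≠ 0) {s : SpinGrp (realW k (restr hd w))} :
    spinIncl hd (realW k w) s ∈ Gam k w ↔ s ∈ Gam k (restr hd w) :=
  clIncl_mem_coeffIn_iff hd hw

theorem spinIncl_mem_GamI_iff (hw : ∀ i, realW k w i ≠ 0) {I : Ideal (𝓞 k)}
    {s : SpinGrp (realW k (restr hd w))} :
    spinIncl hd (realW k w) s ∈ GamI k w I ↔ s ∈ GamI k (restr hd w) I := by
  refine and_congr (spinIncl_mem_Gam_iff hd hw) ?_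
  rw [← clIncl_mem_coeffIn_iff hd hw, map_sub, map_one]
  rfl

theorem spinIncl_congrTau_iff (hw : ∀ i, realW k w i ≠ 0) {D : CongruenceLevel k}
    {s : SpinGrp (realW k (restr hd w))} :
    CongrTau k w D (spinIncl hd (realW k w) s) ↔ CongrTau k (restr hd w) D s := by
  refine exists_congr fun t => and_congr_right fun _ => ?_
  rw [← clIncl_mem_coeffIn_iff hd hw, map_sub, AlgHom.commutes]
  rfl

theorem spinIncl_mem_GamTau_iff (hw : ∀ i, realW k w i ≠ 0) {D : CongruenceLevel k}
    {s : SpinGrp (realW k (restr hd w))} :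
    spinIncl hd (realW k w) s ∈ GamTau k w D ↔ s ∈ GamTau k (restr hd w) D :=
  and_congr (spinIncl_mem_Gam_iff hd hw)
    (or_congr (spinIncl_mem_GamI_iff hd hw) (spinIncl_congrTau_iff hd hw))

/-- A reflection only changes signs of coefficients, so every congruence condition modulo an ideal
is preserved. -/
theorem flipCl_mem_coeffIn (hw : ∀ i, realW k w i ≠ 0) {I : Ideal (𝓞 k)} (i : Fin (n + 1))
    {c : Cl (realW k w)} (hc : c ∈ coeffIn k w I) : flipCl (realW k w) i c ∈ coeffIn k w I := by
  rw [mem_coeffIn_iff hw] at hc ⊢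
  refine ⟨fun M => ?_, fun M hM => by rw [coef_flipCl hw, hc.2 M hM, mul_zero]⟩
  obtain ⟨a, ha, h⟩ := hc.1 M
  rw [coef_flipCl hw, h]
  split_ifs
  · exact ⟨-a, neg_mem ha, by rw [map_neg, neg_one_mul]⟩
  · exact ⟨a, ha, by rw [one_mul]⟩

theorem flipSpin_mem_GamI (hw : ∀ i, realW k w i ≠ 0) {I : Ideal (𝓞 k)} (i : Fin (n + 1))
    {s : SpinGrp (realW k w)} (hs : s ∈ GamI k w I) : flipSpin hw i s ∈ GamI k w I := by
  refine ⟨flipCl_mem_coeffIn hw i hs.1, ?_⟩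
  have := flipCl_mem_coeffIn hw i hs.2
  rwa [map_sub, map_one] at this

theorem flipSpin_mem_GamTau (hw : ∀ i, realW k w i ≠ 0) {D : CongruenceLevel k}
    (i : Fin (n + 1)) {s : SpinGrp (realW k w)} (hs : s ∈ GamTau k w D) :
    flipSpin hw i s ∈ GamTau k w D := by
  refine ⟨flipCl_mem_coeffIn hw i hs.1, hs.2.imp (flipSpin_mem_GamI hw i) ?_⟩
  rintro ⟨t, ht, h⟩
  refine ⟨t, ht, ?_⟩
  have := flipCl_mem_coeffIn hw i h
  rwa [map_sub, AlgHom.commutes] at this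

end ArithmeticSubspaces

/-! ### Powers of elements of the spin group of a ternary form -/

section Powers

theorem reverse_genProd_of_card_two {n : ℕ} {w : Fin (n + 1) → ℝ} {M : Finset (Fin (n + 1))}
    (hM : M.card = 2) : CliffordAlgebra.reverse (genProd w M) = -genProd w M := by
  have key : ∀ a b : Fin (n + 1), a < b →
      CliffordAlgebra.reverse (genProd w {a, b}) = -genProd w {a, b} := by
    intro a b hab
    rw [genProd_insert_of_lt w (by simpa using hab), genProd_singleton,
      CliffordAlgebra.reverse.map_mul, gen, gen, CliffordAlgebra.reverse_ι,
      CliffordAlgebra.reverse_ι]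
    exact gen_mul_gen w hab.ne'
  obtain ⟨a, b, hab, rfl⟩ := Finset.card_eq_two.1 hM
  rcases lt_or_gt_of_ne hab with h | h
  · exact key a b h
  · rw [Finset.pair_comm]; exact key b a h

variable {w : Fin (2 + 1) → ℝ}

/-- In three dimensions an even element has only parts of degree zero and two, and reversal negates
bivectors. With `s s* = 1` this is the Cayley–Hamilton relation `s² - 2 s_ℝ s + 1 = 0`. -/
theorem val_add_reverse (hw : ∀ i, w i ≠ 0) (s : SpinGrp w) :
    s.val + CliffordAlgebra.reverse s.val = (2 * realPart w s.val) • (1 : Cl w) := by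
  conv_lhs => rw [← sum_coef_smul hw s.val]
  rw [map_sum, ← Finset.sum_add_distrib, Finset.sum_eq_single ∅]
  · rw [genProd_empty, coef_empty, map_smul, CliffordAlgebra.reverse.map_one, ← add_smul, two_mul]
  · intro M _ hM
    by_cases he : Even M.card
    · have h1 : M.card ≤ 3 := by simpa using Finset.card_le_univ M
      have h2 : M.card ≠ 0 := by rwa [Ne, Finset.card_eq_zero]
      have h3 : M.card = 2 := by
        obtain ⟨m, hm⟩ := he
        omega
      rw [map_smul, reverse_genProd_of_card_two h3, smul_neg, add_neg_cancel]
    · rw [coef_eq_zero_of_even hw s.isSpin.1 he]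
      simp
  · simp

theorem val_sq (hw : ∀ i, w i ≠ 0) (s : SpinGrp w) :
    (s ^ 2).val = (2 * realPart w s.val) • s.val - 1 := by
  have h := congrArg (s.val * ·) (val_add_reverse hw s)
  simp only [mul_add, val_mul_reverse, mul_smul_comm, mul_one] at h
  rw [pow_two, SpinGrp.val_mul, ← h, add_sub_cancel_right]

theorem realPart_sub_smul (a b : ℝ) (c d : Cl w) :
    realPart w (a • c - b • d) = a * realPart w c - b * realPart w d := by
  rw [← realPartLin_apply, map_sub, map_smul, map_smul]
  rfl

theorem realPart_sq (hw : ∀ i, w i ≠ 0) (s : SpinGrp w) :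
    realPart w (s ^ 2).val = 2 * realPart w s.val ^ 2 - 1 := by
  have := realPart_sub_smul (2 * realPart w s.val) 1 s.val 1
  rw [one_smul, realPart_one] at this
  rw [val_sq hw, this]
  ring

/-- The coefficients are the Chebyshev polynomials of the second kind `U₂` and `U₁` at the real
part. Modulo `U₂ = 4t² - 1` the cube is a scalar, which is why this value is taken for `α`. -/
theorem val_cube (hw : ∀ i, w i ≠ 0) (s : SpinGrp w) :
    (s ^ 3).val = (4 * realPart w s.val ^ 2 - 1) • s.val - (2 * realPart w s.val) • 1 := by
  have h := val_sq hw s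
  rw [pow_two, SpinGrp.val_mul] at h
  rw [pow_succ, SpinGrp.val_mul, val_sq hw, sub_mul, smul_mul_assoc, h, one_mul, smul_sub,
    smul_smul, sub_smul, one_smul,
    show 2 * realPart w s.val * (2 * realPart w s.val) = 4 * realPart w s.val ^ 2 by ring]
  abel

theorem realPart_cube (hw : ∀ i, w i ≠ 0) (s : SpinGrp w) :
    realPart w (s ^ 3).val = 4 * realPart w s.val ^ 3 - 3 * realPart w s.val := by
  rw [val_cube hw, realPart_sub_smul, realPart_one]
  ring

/-- The first, second and third Chebyshev polynomials. -/
def chebT {R : Type*} [CommRing R] : ℕ → R → R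
  | 1, x => x
  | 2, x => 2 * x ^ 2 - 1
  | _, x => 4 * x ^ 3 - 3 * x

theorem map_chebT {R S : Type*} [CommRing R] [CommRing S] (f : R →+* S) {j : ℕ}
    (hj : j = 1 ∨ j = 2 ∨ j = 3) (x : R) : f (chebT j x) = chebT j (f x) := by
  rcases hj with rfl | rfl | rfl <;>
    simp only [chebT, map_sub, map_mul, map_pow, map_ofNat, map_one]

theorem realPart_pow (hw : ∀ i, w i ≠ 0) (s : SpinGrp w) {j : ℕ}
    (hj : j = 1 ∨ j = 2 ∨ j = 3) :
    realPart w (s ^ j).val = chebT j (realPart w s.val) := by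
  rcases hj with rfl | rfl | rfl
  · rw [pow_one]; rfl
  · exact realPart_sq hw s
  · exact realPart_cube hw s

theorem le_chebT {t : ℝ} (ht : 1 ≤ t) {j : ℕ} (hj : j = 1 ∨ j = 2 ∨ j = 3) : t ≤ chebT j t := by
  rcases hj with rfl | rfl | rfl
  · exact le_rfl
  · simp only [chebT]; nlinarith
  · simp only [chebT]; nlinarith [mul_nonneg (by linarith : (0 : ℝ) ≤ t) (sq_nonneg (t - 1))]

theorem abs_chebT_le {x : ℝ} (hx : |x| ≤ 1) {j : ℕ} (hj : j = 1 ∨ j = 2 ∨ j = 3) :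
    |chebT j x| ≤ 1 := by
  have hx2 := (sq_le_one_iff_abs_le_one x).2 hx
  rcases hj with rfl | rfl | rfl
  · exact hx
  · simp only [chebT]
    rw [abs_le]
    constructor <;> nlinarith
  · simp only [chebT]
    rw [← sq_le_one_iff_abs_le_one]
    have e : 1 - (4 * x ^ 3 - 3 * x) ^ 2 = (1 - x ^ 2) * (4 * x ^ 2 - 1) ^ 2 := by ring
    have := mul_nonneg (sub_nonneg.2 hx2) (sq_nonneg (4 * x ^ 2 - 1))
    linarith

/-- The index of the Chebyshev polynomial that is used for elements of real part `t`. -/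
def chebIndex (t : ℝ) : ℕ :=
  if 2 ≤ 4 * quadConj t ^ 2 then 1
  else if 2 ≤ 4 * (2 * quadConj t ^ 2 - 1) ^ 2 then 2 else 3

theorem chebIndex_eq (t : ℝ) : chebIndex t = 1 ∨ chebIndex t = 2 ∨ chebIndex t = 3 := by
  unfold chebIndex
  split_ifs <;> simp

/-- If `cos θ` and `cos 2θ` both have square below `1/2`, then up to symmetry `θ` lies between 45
and 67.5 degrees, so `3θ` lies between 135 and 202.5 degrees. This ensures `σ(α) = 4 σ(T)² - 1 ≥ 1`.
-/
theorem two_le_chebT_sq (t : ℝ) : 2 ≤ 4 * chebT (chebIndex t) (quadConj t) ^ 2 := by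
  unfold chebIndex
  split_ifs with h1 h2
  · exact h1
  · exact h2
  · push Not at h1 h2
    simp only [chebT]
    set y := quadConj t ^ 2 with hy
    have e : 4 * (4 * quadConj t ^ 3 - 3 * quadConj t) ^ 2 - 2
        = 4 * ((1 - 2 * y) * (8 * y - 8 * y ^ 2 - 1 / 2)) := by rw [hy]; ring
    have h3 : 0 ≤ 1 - 2 * y := by linarith
    have h4 : 0 ≤ 8 * y - 8 * y ^ 2 - 1 / 2 := by nlinarith
    have := mul_nonneg h3 h4
    linarith

/-- The leading coefficient of `4 T_j²` is `4^j`, and the next nonzero terms of `4 T_j² - 1` are two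
degrees lower; the largest coefficient there is `96`, for `j = 3`. -/
theorem abs_sub_le_of_chebT {t : ℝ} (ht : 10 < t) {j : ℕ} (hj : j = 1 ∨ j = 2 ∨ j = 3) :
    |4 * chebT j t ^ 2 - 1 - 4 ^ j * t ^ (2 * j)| ≤ 100 * t ^ (2 * j - 2) := by
  have h2 : 0 < t ^ 2 := by positivity
  have h21 : 1 ≤ t ^ 2 := by nlinarith
  rcases hj with rfl | rfl | rfl
  · simp only [chebT]
    norm_num
  · simp only [chebT]
    have e : 4 * (2 * t ^ 2 - 1) ^ 2 - 1 - 4 ^ 2 * t ^ (2 * 2) = -16 * t ^ 2 + 3 := by ring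
    rw [e, abs_le]
    norm_num
    constructor <;> linarith
  · simp only [chebT]
    have e : 4 * (4 * t ^ 3 - 3 * t) ^ 2 - 1 - 4 ^ 3 * t ^ (2 * 3)
        = -96 * t ^ 4 + 36 * t ^ 2 - 1 := by ring
    have h4 : t ^ 2 ≤ t ^ 4 := by nlinarith
    rw [e, abs_le]
    norm_num
    constructor <;> linarith

end Powers

/-! ### The congruence level of an element -/

section Level

variable {k : IntermediateField ℚ ℝ} {n : ℕ} {w : Fin (n + 1) → 𝓞 k}

/-- The pair `D` is the one attached to the integer `T`, which is large at the given real place and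
small at the other one. -/
structure IsLevel (D : CongruenceLevel k) (T : 𝓞 k) (σ : k →+* ℝ) : Prop where
  le : 10 ≤ algebraMap (𝓞 k) ℝ T
  conj_le : |σ (T : k)| ≤ 1
  α_eq : D.α = 4 * T ^ 2 - 1
  one_le_conj : 1 ≤ |σ (D.α : k)|
  τ_eq : Ideal.Quotient.mk (Ideal.span {D.α}) (4 * T ^ 3 - 3 * T) = D.τ

theorem IsLevel.α_ne_zero {D : CongruenceLevel k} {T : 𝓞 k} {σ : k →+* ℝ} (hD : IsLevel D T σ) :
    D.α ≠ 0 := by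
  intro h0
  have h1 := hD.one_le_conj
  rw [h0, conj_eq_zero.2 rfl, abs_zero] at h1
  linarith

/-- A filler value, `α = 0` and `τ = -1`, for real numbers that are not real parts of suitable
elements. -/
theorem exists_default_level (k : IntermediateField ℚ ℝ) : Nonempty (CongruenceLevel k) := by
  refine ⟨⟨0, -1, orderOf_eq_prime (by simp) fun h => ?_⟩⟩
  have h1 := congrArg Units.val h
  have h2 : Ideal.Quotient.mk (Ideal.span {(0 : 𝓞 k)}) (-1) = Ideal.Quotient.mk _ 1 := by
    rw [map_neg, map_one]
    simpa using h1
  rw [Ideal.Quotient.eq, Ideal.mem_span_singleton, zero_dvd_iff] at h2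
  norm_num at h2

/-- The pair is chosen from the real number alone: `T` is determined by its value in `ℝ` and the
nontrivial embedding is unique, so one choice serves all admissible `T` and `σ`. -/
theorem exists_level (hk : Module.finrank ℚ k = 2) (x : ℝ) : ∃ D : CongruenceLevel k,
    ∀ (T : 𝓞 k) (σ : k →+* ℝ), σ ≠ algebraMap k ℝ → algebraMap (𝓞 k) ℝ T = x → 10 ≤ x →
      |σ (T : k)| ≤ 1 → 1 ≤ |σ ((4 * T ^ 2 - 1 : 𝓞 k) : k)| → IsLevel D T σ := by
  by_cases hex : ∃ (T : 𝓞 k) (σ : k →+* ℝ), σ ≠ algebraMap k ℝ ∧ algebraMap (𝓞 k) ℝ T = x ∧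
      10 ≤ x ∧ |σ (T : k)| ≤ 1 ∧ 1 ≤ |σ ((4 * T ^ 2 - 1 : 𝓞 k) : k)|
  · obtain ⟨T, σ, hσ, hT, hx, h1, h2⟩ := hex
    obtain ⟨D, hα, hτ⟩ := exists_congruenceLevel hk hσ (hT ▸ hx) h1 h2
    refine ⟨D, fun T' σ' hσ' hT' _ _ _ => ?_⟩
    obtain rfl : σ' = σ := embedding_unique hk hσ hσ'
    obtain rfl : T' = T := algebraMap_ringOfIntegers_injective (hT'.trans hT.symm)
    exact ⟨hT ▸ hx, h1, hα, hα ▸ h2, hτ⟩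
  · obtain ⟨D⟩ := exists_default_level k
    exact ⟨D, fun T σ h1 h2 h3 h4 h5 => absurd ⟨T, σ, h1, h2, h3, h4, h5⟩ hex⟩

theorem isClosedHyperbolicManifold_of_GamI_le (hk : Module.finrank ℚ k = 2)
    (h : IsAdmissible k w) {G : Subgroup (SpinGrp (realW k w))} (hG : G ≤ Gam k w) {α : 𝓞 k}
    (hα : α ≠ 0) (hαG : GamI k w (Ideal.span {α}) ≤ G)
    (hfree : ∀ s ∈ G, |realPart (realW k w) s.val| ≤ 1 → s = 1) :
    IsClosedHyperbolicManifold G := by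
  refine ⟨fun s hs x hx => hfree s hs (abs_realPart_le_one h.isLorentz hx), ?_, ?_⟩
  · exact finite_setOf_act_mem h.isLorentz fun R =>
      (finite_setOf_sum_coef_le hk h R).subset fun s hs => ⟨hG hs.1, hs.2⟩
  · obtain ⟨R, hR⟩ := exists_bound_GamI hk h hα
    exact compactSpace_hypQuot h.isLorentz fun x => by
      obtain ⟨γ, hγ, hle⟩ := hR x
      exact ⟨γ, hαG hγ, hle⟩

theorem GamI_le_GamTau (D : CongruenceLevel k) : GamI k w (Ideal.span {D.α}) ≤ GamTau k w D :=
  fun _ hs => ⟨hs.1, Or.inl hs⟩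

theorem IsLevel.isCongruenceSubgroup {D : CongruenceLevel k} {T : 𝓞 k} {σ : k →+* ℝ}
    (hD : IsLevel D T σ) : IsCongruenceSubgroup k w (GamTau k w D) :=
  ⟨fun _ hs => hs.1, _, by rw [Ne, Ideal.span_singleton_eq_bot]; exact hD.α_ne_zero,
    GamI_le_GamTau D⟩

theorem IsLevel.le_abs_realPart (hk : Module.finrank ℚ k = 2) (h : IsAdmissible k w)
    {D : CongruenceLevel k} {T : 𝓞 k} {σ : k →+* ℝ} (hσ : σ ≠ algebraMap k ℝ)
    (hD : IsLevel D T σ) {r : SpinGrp (realW k w)} (hr : r ∈ GamTau k w D) (hr1 : r ≠ 1) :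
    4 * algebraMap (𝓞 k) ℝ T ^ 3 - 3 * algebraMap (𝓞 k) ℝ T ≤ |realPart (realW k w) r.val| :=
  le_abs_realPart_of_mem_GamTau hk h hσ hD.le hD.conj_le hD.α_eq hD.one_le_conj hD.τ_eq hr hr1

theorem ten_le_cheb {T : ℝ} (hT : 10 ≤ T) : T ≤ 4 * T ^ 3 - 3 * T := by
  have : 0 ≤ T * (T ^ 2 - 1) := mul_nonneg (by linarith) (by nlinarith)
  nlinarith

theorem IsLevel.isClosedHyperbolicManifold (hk : Module.finrank ℚ k = 2) (h : IsAdmissible k w)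
    {D : CongruenceLevel k} {T : 𝓞 k} {σ : k →+* ℝ} (hσ : σ ≠ algebraMap k ℝ)
    (hD : IsLevel D T σ) : IsClosedHyperbolicManifold (GamTau k w D) := by
  refine isClosedHyperbolicManifold_of_GamI_le hk h (fun _ hs => hs.1) hD.α_ne_zero
    (GamI_le_GamTau D) fun s hs hs1 => ?_
  by_contra hne
  have h1 := hD.le_abs_realPart hk h hσ hs hne
  have h2 := ten_le_cheb hD.le
  have h3 := hD.le
  linarith

theorem isClosedHyperbolicManifold_GamI_three (hk : Module.finrank ℚ k = 2)
    (h : IsAdmissible k w) : IsClosedHyperbolicManifold (GamI k w (Ideal.span {3})) :=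
  isClosedHyperbolicManifold_of_GamI_le hk h (α := 3) (fun _ hs => hs.1) (by norm_num) le_rfl
    fun _ hs hs1 => eq_one_of_mem_GamI_three hk h hs hs1

theorem isCongruenceSubgroup_GamI_three :
    IsCongruenceSubgroup k w (GamI k w (Ideal.span {3})) :=
  ⟨fun _ hs => hs.1, _, by rw [Ne, Ideal.span_singleton_eq_bot]; norm_num, le_rfl⟩

theorem isTotallyGeodesicIn_GamTau {d : ℕ} (hd : d ≤ n) (hk : Module.finrank ℚ k = 2)
    (h : IsAdmissible k w) {D : CongruenceLevel k} {T : 𝓞 k} {σ : k →+* ℝ}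
    (hσ : σ ≠ algebraMap k ℝ) (hD : IsLevel D T σ) :
    IsTotallyGeodesicIn hd (realW k w) (GamTau k (restr hd w) D) (GamTau k w D) := by
  have hm := hD.isClosedHyperbolicManifold hk h hσ
  exact isTotallyGeodesicIn_of_flip hd h.isLorentz
    (fun s => (spinIncl_mem_GamTau_iff hd h.isLorentz.ne_zero).symm) hm.1
    (fun i s hs => flipSpin_mem_GamTau _ i hs) (t2Space_hypQuot h.isLorentz hm.2.1)
    (hD.isClosedHyperbolicManifold hk (h.restr hd) hσ).2.2

theorem isTotallyGeodesicIn_GamI_three {d : ℕ} (hd : d ≤ n) (hk : Module.finrank ℚ k = 2)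
    (h : IsAdmissible k w) :
    IsTotallyGeodesicIn hd (realW k w) (GamI k (restr hd w) (Ideal.span {3}))
      (GamI k w (Ideal.span {3})) := by
  have hm := isClosedHyperbolicManifold_GamI_three hk h
  exact isTotallyGeodesicIn_of_flip hd h.isLorentz
    (fun s => (spinIncl_mem_GamI_iff hd h.isLorentz.ne_zero).symm) hm.1
    (fun i s hs => flipSpin_mem_GamI _ i hs) (t2Space_hypQuot h.isLorentz hm.2.1)
    (isClosedHyperbolicManifold_GamI_three hk (h.restr hd)).2.2

/-- If `T` is congruent to `1` modulo `3`, then so are the elements of `Γ_τ(α)`. -/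
theorem GamTau_le_GamI_three {D : CongruenceLevel k} {T : 𝓞 k} {σ : k →+* ℝ}
    (hD : IsLevel D T σ) (hT : 3 ∣ T - 1) : GamTau k w D ≤ GamI k w (Ideal.span {3}) := by
  have hα : Ideal.span {D.α} ≤ Ideal.span {3} := by
    rw [Ideal.span_singleton_le_span_singleton, hD.α_eq]
    have e : 4 * T ^ 2 - 1 = 3 + (T - 1) * (4 * (T + 1)) := by ring
    rw [e]
    exact dvd_add dvd_rfl (hT.mul_right _)
  rintro r ⟨hr, hr' | ⟨t, ht, hr'⟩⟩
  · exact ⟨hr, coeffIn_mono hα hr'.2⟩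
  · refine ⟨hr, ?_⟩
    have h1 : Ideal.Quotient.mk (Ideal.span {3}) t = Ideal.Quotient.mk (Ideal.span {3}) 1 := by
      rw [← hD.τ_eq, Ideal.Quotient.eq] at ht
      have h2 := hα ht
      rw [Ideal.Quotient.eq]
      have h3 : 4 * T ^ 3 - 3 * T - 1 ∈ Ideal.span {(3 : 𝓞 k)} := by
        rw [Ideal.mem_span_singleton]
        have e : 4 * T ^ 3 - 3 * T - 1 = (T - 1) * (4 * T ^ 2 + 4 * T + 1) := by ring
        rw [e]
        exact hT.mul_right _
      have := add_mem h2 h3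
      rwa [sub_add_sub_cancel] at this
    have := congr_change k w (coeffIn_mono hα hr') h1
    rwa [scal, map_one, map_one] at this

/-- Chebyshev polynomials have integral coefficients and value `1` at `1`. -/
theorem three_dvd_chebT_sub_one {x : 𝓞 k} (hx : 3 ∣ x - 1) {j : ℕ}
    (hj : j = 1 ∨ j = 2 ∨ j = 3) : 3 ∣ chebT j x - 1 := by
  rcases hj with rfl | rfl | rfl
  · exact hx
  · have e : chebT 2 x - 1 = (x - 1) * (2 * (x + 1)) := by simp only [chebT]; ring
    rw [e]; exact hx.mul_right _
  · have e : chebT 3 x - 1 = (x - 1) * (4 * x ^ 2 + 4 * x + 1) := by simp only [chebT]; ring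
    rw [e]; exact hx.mul_right _

theorem three_dvd_realPart_sub_one (hw : ∀ i, realW k w i ≠ 0) {s : SpinGrp (realW k w)}
    (hs : s ∈ GamI k w (Ideal.span {3})) {x : 𝓞 k}
    (hx : realPart (realW k w) s.val = algebraMap (𝓞 k) ℝ x) : 3 ∣ x - 1 := by
  obtain ⟨a, ha, h⟩ := exists_realPart_eq hw hs.2
  rw [← realPartLin_apply, map_sub, realPartLin_apply, realPartLin_apply, realPart_one, hx] at h
  have : x - 1 = a := algebraMap_ringOfIntegers_injective (by rw [map_sub, map_one, h])
  rw [this]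
  exact Ideal.mem_span_singleton.1 ha

end Level

/-! ### The cube of an element and its congruence level -/

section Cube

theorem two_arcosh_pos {T : ℝ} (hT : 1 < T) : 0 < 2 * Real.arcosh T :=
  mul_pos two_pos (Real.arcosh_pos hT)

theorem isLeast_closedGeodesicLengths {n : ℕ} {w : Fin (n + 1) → ℝ} (h : IsLorentz w)
    {G : Subgroup (SpinGrp w)} {T : ℝ} (hT : 1 < T)
    (hG : ∀ s ∈ G, s ≠ 1 → T ≤ |realPart w s.val|) {s : SpinGrp w} (hs : s ∈ G) {x : Hyp w}
    {u : Fin (n + 1) → ℝ} (hu : IsAxis s x u (2 * Real.arcosh T)) :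
    IsLeast (closedGeodesicLengths G) (2 * Real.arcosh T) :=
  ⟨hu.mem_closedGeodesicLengths h (two_arcosh_pos hT) hs,
    fun _ hr => le_of_mem_closedGeodesicLengths h hT.le hG hr⟩

theorem IsLoxodromic.ne_one {n : ℕ} {w : Fin (n + 1) → ℝ} (h : IsLorentz w) {s : SpinGrp w}
    (hs : IsLoxodromic s) : s ≠ 1 := by
  rintro rfl
  exact hs.1 (basePt h) (act_one _)

theorem isLoxodromic_of_one_lt_realPart {w : Fin (2 + 1) → ℝ} (h : IsLorentz w) {s : SpinGrp w}
    (hs : 1 < realPart w s.val) : IsLoxodromic s := by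
  obtain ⟨x, u, hu⟩ := exists_isAxis h s hs rfl
  exact hu.isLoxodromic h (two_arcosh_pos hs) (hs.trans_le (le_abs_self _))

variable {k : IntermediateField ℚ ℝ}

/-- The relation for the cube rearranges to `S³ - (4T³ - 3T) = (4T² - 1)(S - T)`, and `S - T` is
integral. -/
theorem cube_sub_scal_mem {w : Fin (2 + 1) → 𝓞 k} (hw : ∀ i, realW k w i ≠ 0)
    {S : SpinGrp (realW k w)} (hS : S ∈ Gam k w) {T : 𝓞 k}
    (hT : realPart (realW k w) S.val = algebraMap (𝓞 k) ℝ T) :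
    (S ^ 3).val - scal k w (4 * T ^ 3 - 3 * T)
      ∈ coeffIn k w (Ideal.span {4 * T ^ 2 - 1}) := by
  have e : (S ^ 3).val - scal k w (4 * T ^ 3 - 3 * T)
      = algebraMap (𝓞 k) ℝ (4 * T ^ 2 - 1) • (S.val - algebraMap (𝓞 k) ℝ T • 1) := by
    have e1 : algebraMap (𝓞 k) ℝ (4 * T ^ 2 - 1) = 4 * algebraMap (𝓞 k) ℝ T ^ 2 - 1 := by
      simp only [map_sub, map_mul, map_pow, map_ofNat, map_one]
    have e2 : algebraMap (𝓞 k) ℝ (4 * T ^ 3 - 3 * T)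
        = 4 * algebraMap (𝓞 k) ℝ T ^ 3 - 3 * algebraMap (𝓞 k) ℝ T := by
      simp only [map_sub, map_mul, map_pow, map_ofNat]
    rw [val_cube hw, hT, scal, e1, e2]
    generalize algebraMap (𝓞 k) ℝ T = r
    rw [Algebra.algebraMap_eq_smul_one, smul_sub, smul_smul, sub_sub, ← add_smul]
    congr 2
    ring
  rw [e]
  exact smul_mem_coeffIn_span (sub_mem hS (smul_mem_coeffIn_right k w T (one_mem_order k w)))

variable {n : ℕ} {w : Fin (n + 1) → 𝓞 k} (hn : 2 ≤ n)

theorem realPart_spinIncl (hw : ∀ i, realW k w i ≠ 0) (s : SpinGrp (realW k (restr hn w))) :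
    realPart (realW k w) (spinIncl hn (realW k w) s).val
      = realPart (realW k (restr hn w)) s.val :=
  realPart_clIncl hn hw s.val

theorem spinIncl_cube_sub_scal_mem (h : IsAdmissible k w) {S : SpinGrp (realW k (restr hn w))}
    (hS : S ∈ Gam k (restr hn w)) {T : 𝓞 k}
    (hT : realPart (realW k (restr hn w)) S.val = algebraMap (𝓞 k) ℝ T) :
    (spinIncl hn (realW k w) (S ^ 3)).val - scal k w (4 * T ^ 3 - 3 * T)
      ∈ coeffIn k w (Ideal.span {4 * T ^ 2 - 1}) := by
  have h1 := cube_sub_scal_mem (h.restr hn).isLorentz.ne_zero hS hT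
  have h2 := (clIncl_mem_coeffIn_iff hn h.isLorentz.ne_zero).2 h1
  rwa [map_sub, scal, AlgHom.commutes] at h2

theorem IsLevel.one_lt {σ : k →+* ℝ} {D : CongruenceLevel k} {T : 𝓞 k} (hD : IsLevel D T σ) :
    1 < 4 * algebraMap (𝓞 k) ℝ T ^ 3 - 3 * algebraMap (𝓞 k) ℝ T := by
  have h1 := ten_le_cheb hD.le
  have h2 := hD.le
  linarith

/-- Conditions under which the cube of `S` is the shortest loxodromic element of the group
attached to `D`. -/
structure IsLevelOf (D : CongruenceLevel k) (T : 𝓞 k) (σ : k →+* ℝ)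
    (S : SpinGrp (realW k (restr hn w))) : Prop where
  finrank : Module.finrank ℚ k = 2
  adm : IsAdmissible k w
  ne : σ ≠ algebraMap k ℝ
  level : IsLevel D T σ
  mem : S ∈ Gam k (restr hn w)
  realPart_eq : realPart (realW k (restr hn w)) S.val = algebraMap (𝓞 k) ℝ T

namespace IsLevelOf

variable {hn} {D : CongruenceLevel k} {T : 𝓞 k} {σ : k →+* ℝ}
  {S : SpinGrp (realW k (restr hn w))}

theorem realPart_cube (H : IsLevelOf hn D T σ S) :
    realPart (realW k (restr hn w)) (S ^ 3).val
      = 4 * algebraMap (𝓞 k) ℝ T ^ 3 - 3 * algebraMap (𝓞 k) ℝ T := by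
  rw [HypArith.realPart_cube (H.adm.restr hn).isLorentz.ne_zero, H.realPart_eq]

theorem exists_rep (H : IsLevelOf hn D T σ S) : ∃ t' : 𝓞 k,
    algebraMap (𝓞 k) ℝ t' = realPart (realW k w) (spinIncl hn (realW k w) (S ^ 3)).val ∧
    Ideal.Quotient.mk (Ideal.span {D.α}) t' = D.τ ∧
    (spinIncl hn (realW k w) (S ^ 3)).val - scal k w t' ∈ coeffIn k w (Ideal.span {D.α}) := by
  refine ⟨4 * T ^ 3 - 3 * T, ?_, H.level.τ_eq, ?_⟩
  · rw [realPart_spinIncl hn H.adm.isLorentz.ne_zero, H.realPart_cube]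
    simp only [map_sub, map_mul, map_pow, map_ofNat]
  · have := spinIncl_cube_sub_scal_mem hn H.adm H.mem H.realPart_eq
    rwa [← H.level.α_eq] at this

theorem spinIncl_cube_mem (H : IsLevelOf hn D T σ S) :
    spinIncl hn (realW k w) (S ^ 3) ∈ GamTau k w D := by
  obtain ⟨t', -, h1, h2⟩ := H.exists_rep
  exact ⟨(spinIncl_mem_Gam_iff hn H.adm.isLorentz.ne_zero).2 (pow_mem H.mem 3),
    Or.inr ⟨t', h1, h2⟩⟩

theorem cube_mem (H : IsLevelOf hn D T σ S) : S ^ 3 ∈ GamTau k (restr hn w) D :=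
  (spinIncl_mem_GamTau_iff hn H.adm.isLorentz.ne_zero).1 H.spinIncl_cube_mem

theorem exists_isAxis (H : IsLevelOf hn D T σ S) : ∃ x u, IsAxis (S ^ 3) x u
    (2 * Real.arcosh (4 * algebraMap (𝓞 k) ℝ T ^ 3 - 3 * algebraMap (𝓞 k) ℝ T)) :=
  HypArith.exists_isAxis (H.adm.restr hn).isLorentz _ H.level.one_lt H.realPart_cube

theorem le_abs_realPart_spinIncl (H : IsLevelOf hn D T σ S) :
    4 * algebraMap (𝓞 k) ℝ T ^ 3 - 3 * algebraMap (𝓞 k) ℝ T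
      ≤ |realPart (realW k w) (spinIncl hn (realW k w) (S ^ 3)).val| := by
  rw [realPart_spinIncl hn H.adm.isLorentz.ne_zero, H.realPart_cube]
  exact le_abs_self _

theorem isLoxodromic (H : IsLevelOf hn D T σ S) :
    IsLoxodromic (spinIncl hn (realW k w) (S ^ 3)) := by
  obtain ⟨x, u, hu⟩ := H.exists_isAxis
  exact IsAxis.isLoxodromic H.adm.isLorentz (hu.spinIncl hn) (two_arcosh_pos H.level.one_lt)
    (H.level.one_lt.trans_le H.le_abs_realPart_spinIncl)

theorem translationLength_eq (H : IsLevelOf hn D T σ S) :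
    translationLength (spinIncl hn (realW k w) (S ^ 3))
      = 2 * Real.arcosh (4 * algebraMap (𝓞 k) ℝ T ^ 3 - 3 * algebraMap (𝓞 k) ℝ T) := by
  obtain ⟨x, u, hu⟩ := H.exists_isAxis
  exact HypArith.translationLength_eq H.adm.isLorentz H.level.one_lt.le H.le_abs_realPart_spinIncl
    (IsAxis.hdist_eq H.adm.isLorentz (hu.spinIncl hn)
      (two_arcosh_pos H.level.one_lt).le)

theorem translationLength_le (H : IsLevelOf hn D T σ S) {r : SpinGrp (realW k w)}
    (hr : r ∈ GamTau k w D) (hr' : IsLoxodromic r) :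
    translationLength (spinIncl hn (realW k w) (S ^ 3)) ≤ translationLength r := by
  rw [H.translationLength_eq]
  exact two_arcosh_le_translationLength H.adm.isLorentz H.level.one_lt.le
    (H.level.le_abs_realPart H.finrank H.adm H.ne hr (hr'.ne_one H.adm.isLorentz))

theorem isLeast (H : IsLevelOf hn D T σ S) : IsLeast (closedGeodesicLengths (GamTau k w D))
    (translationLength (spinIncl hn (realW k w) (S ^ 3))) := by
  obtain ⟨x, u, hu⟩ := H.exists_isAxis
  rw [H.translationLength_eq]
  exact isLeast_closedGeodesicLengths H.adm.isLorentz H.level.one_lt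
    (fun r hr hr1 => H.level.le_abs_realPart H.finrank H.adm H.ne hr hr1) H.spinIncl_cube_mem
    (hu.spinIncl hn)

theorem isLeast_restr (H : IsLevelOf hn D T σ S) :
    IsLeast (closedGeodesicLengths (GamTau k (restr hn w) D))
      (translationLength (spinIncl hn (realW k w) (S ^ 3))) := by
  obtain ⟨x, u, hu⟩ := H.exists_isAxis
  rw [H.translationLength_eq]
  exact isLeast_closedGeodesicLengths (H.adm.restr hn).isLorentz H.level.one_lt
    (fun r hr hr1 => H.level.le_abs_realPart H.finrank (H.adm.restr hn) H.ne hr hr1) H.cube_mem hu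

theorem systole_eq (H : IsLevelOf hn D T σ S) :
    systole (GamTau k (restr hn w) D) = systole (GamTau k w D) :=
  H.isLeast_restr.csInf_eq.trans H.isLeast.csInf_eq.symm

end IsLevelOf

/-! ### Levels attached to real numbers -/

/-- With `T` the Chebyshev value selected by the conjugate of `x`, one has `1/2 ≤ σ(T)² ≤ 1`, so
`σ(α) = 4 σ(T)² - 1` lies between `1` and `3`. -/
theorem exists_levels (hk : Module.finrank ℚ k = 2) : ∃ D : ℝ → CongruenceLevel k,
    ∀ (σ : k →+* ℝ) (x : 𝓞 k), σ ≠ algebraMap k ℝ → 10 < algebraMap (𝓞 k) ℝ x →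
      |σ (x : k)| ≤ 1 →
      IsLevel (D (algebraMap (𝓞 k) ℝ x)) (chebT (chebIndex (algebraMap (𝓞 k) ℝ x)) x) σ ∧
      |σ ((D (algebraMap (𝓞 k) ℝ x)).α : k)| ≤ 5 := by
  choose D hD using exists_level hk
  refine ⟨fun t => D (chebT (chebIndex t) t), fun σ x hσ hx hx1 => ?_⟩
  have hj := chebIndex_eq (algebraMap (𝓞 k) ℝ x)
  set j := chebIndex (algebraMap (𝓞 k) ℝ x) with hjdef
  have hq : quadConj (algebraMap (𝓞 k) ℝ x) = σ (x : k) := by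
    -- The conjugate differs from `x` because it is at most `1` in absolute value while `x > 10`.
    refine quadConj_eq hk hσ fun h0 => ?_
    change σ (x : k) = algebraMap (𝓞 k) ℝ x at h0
    rw [h0] at hx1
    have := (le_abs_self _).trans hx1
    linarith
  have e : σ ((chebT j x : 𝓞 k) : k) = chebT j (σ (x : k)) :=
    map_chebT (σ.comp (algebraMap (𝓞 k) k)) hj x
  have hT1 : |σ ((chebT j x : 𝓞 k) : k)| ≤ 1 := e ▸ abs_chebT_le hx1 hj
  have hα : σ ((4 * chebT j x ^ 2 - 1 : 𝓞 k) : k) = 4 * σ ((chebT j x : 𝓞 k) : k) ^ 2 - 1 := by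
    change (σ.comp (algebraMap (𝓞 k) k)) (4 * chebT j x ^ 2 - 1) = _
    simp only [map_sub, map_mul, map_pow, map_ofNat, map_one]
    rfl
  have h2 : 2 ≤ 4 * σ ((chebT j x : 𝓞 k) : k) ^ 2 := by
    rw [e, ← hq]
    exact two_le_chebT_sq _
  have h3 : σ ((chebT j x : 𝓞 k) : k) ^ 2 ≤ 1 := (sq_le_one_iff_abs_le_one _).2 hT1
  have hlev : IsLevel (D (chebT j (algebraMap (𝓞 k) ℝ x))) (chebT j x) σ := by
    refine hD _ _ _ hσ (map_chebT _ hj x) (hx.le.trans (le_chebT (by linarith) hj)) hT1 ?_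
    rw [hα]
    exact le_trans (by linarith) (le_abs_self _)
  refine ⟨hlev, ?_⟩
  change |σ ((D (chebT j (algebraMap (𝓞 k) ℝ x))).α : k)| ≤ 5
  rw [hlev.α_eq, hα, abs_le]
  constructor <;> linarith

end Cube

/-! ### Covers of unbounded degree -/

section Degree

theorem card_le_relIndex {G : Type*} [Group G] {H K : Subgroup G} (hne : H.relIndex K ≠ 0)
    {m : ℕ} (g : Fin m → G) (hg : ∀ i, g i ∈ K)
    (hd : ∀ i j, i ≠ j → (g i)⁻¹ * g j ∉ H) : m ≤ H.relIndex K := by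
  have : Finite (K ⧸ H.subgroupOf K) := Nat.finite_of_card_ne_zero hne
  have hinj : Function.Injective
      fun i => (QuotientGroup.mk (⟨g i, hg i⟩ : K) : K ⧸ H.subgroupOf K) := by
    intro i j hij
    by_contra hne'
    have h1 : (⟨g i, hg i⟩ : K)⁻¹ * ⟨g j, hg j⟩ ∈ H.subgroupOf K := QuotientGroup.eq.1 hij
    exact hd i j hne' h1
  have := Nat.card_le_card_of_injective _ hinj
  rwa [Nat.card_eq_fintype_card, Fintype.card_fin] at this

/-- Real parts under repeated squaring: `t - 1` is multiplied by `2 (t + 1)`, so it grows at least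
linearly in the number of steps. -/
theorem tendsto_of_chebyshev {t : ℕ → ℝ} (h0 : 1 < t 0) (h : ∀ i, t (i + 1) = 2 * t i ^ 2 - 1) :
    StrictMono t ∧ Filter.Tendsto t Filter.atTop Filter.atTop := by
  have h1 : ∀ i, 1 < t i := by
    intro i
    induction i with
    | zero => exact h0
    | succ i ih => rw [h]; nlinarith
  have h2 : ∀ i : ℕ, (t 0 - 1) * i ≤ t i - 1 := by
    intro i
    induction i with
    | zero => simpa using h0.le
    | succ i ih =>
      have h3 : t 0 - 1 ≤ t i - 1 := by
        clear ih
        induction i with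
        | zero => exact le_rfl
        | succ i ih => have := h1 i; rw [h]; nlinarith
      have := h1 i
      rw [h]
      push_cast
      nlinarith
  refine ⟨strictMono_nat_of_lt_succ fun i => ?_, ?_⟩
  · have := h1 i
    rw [h]
    nlinarith
  · refine Filter.tendsto_atTop_mono (fun i => ?_)
      (tendsto_natCast_atTop_atTop.const_mul_atTop (sub_pos.2 h0))
    linarith [h2 i]

variable {k : IntermediateField ℚ ℝ} {n : ℕ} {w : Fin (n + 1) → 𝓞 k}

/-- The trivial group has no bounded fundamental domain on the unbounded space `ℍⁿ`. -/
theorem exists_ne_one_mem_GamI (hk : Module.finrank ℚ k = 2) (h : IsAdmissible k w) (hn : n ≠ 0)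
    {α : 𝓞 k} (hα : α ≠ 0) : ∃ s ∈ GamI k w (Ideal.span {α}), s ≠ 1 := by
  by_contra! hall
  obtain ⟨R, hR⟩ := exists_bound_GamI hk h hα
  obtain ⟨x, hx⟩ := exists_lt_neg_bil h.isLorentz hn R
  obtain ⟨γ, hγ, hle⟩ := hR x
  rw [hall γ hγ, act_one] at hle
  exact absurd hle (not_le.2 hx)

/-- Start from a nontrivial element of `Γ(3)`, whose real part exceeds one in absolute value;
squaring once makes it positive, and further squaring sends it to infinity. -/
theorem exists_seq_mem_GamI_three {w : Fin (2 + 1) → 𝓞 k} (hk : Module.finrank ℚ k = 2)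
    (h : IsAdmissible k w) : ∃ s : ℕ → SpinGrp (realW k w),
      (∀ i, s i ∈ GamI k w (Ideal.span {3})) ∧
      StrictMono (fun i => realPart (realW k w) (s i).val) ∧
      (∀ i, 1 < realPart (realW k w) (s i).val) ∧
      Filter.Tendsto (fun i => realPart (realW k w) (s i).val) Filter.atTop Filter.atTop := by
  obtain ⟨γ, hγ, hγ1⟩ := exists_ne_one_mem_GamI hk h two_ne_zero (α := 3) (by norm_num)
  have hw := h.isLorentz.ne_zero
  have h1 : 1 < |realPart (realW k w) γ.val| := by
    by_contra! hle
    exact hγ1 (eq_one_of_mem_GamI_three hk h hγ hle)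
  have h0 : 1 < realPart (realW k w) ((γ ^ 2) ^ 2 ^ 0).val := by
    rw [pow_zero, pow_one, realPart_sq hw, ← sq_abs]
    nlinarith
  obtain ⟨hm, ht⟩ := tendsto_of_chebyshev
    (t := fun i => realPart (realW k w) ((γ ^ 2) ^ 2 ^ i).val) h0
    fun i => by simp only [pow_succ 2 i, pow_mul (γ ^ 2)]; exact realPart_sq hw _
  exact ⟨fun i => (γ ^ 2) ^ 2 ^ i, fun i => pow_mem (pow_mem hγ 2) _, hm,
    fun i => h0.trans_le (hm.monotone (Nat.zero_le i)), ht⟩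

theorem IsLevel.relIndex_ne_zero (hk : Module.finrank ℚ k = 2) (h : IsAdmissible k w)
    {D : CongruenceLevel k} {T : 𝓞 k} {σ : k →+* ℝ} (hD : IsLevel D T σ)
    (hle : GamTau k w D ≤ GamI k w (Ideal.span {3})) :
    (GamTau k w D).relIndex (GamI k w (Ideal.span {3})) ≠ 0 := by
  obtain ⟨R, hR⟩ := exists_bound_GamI hk h hD.α_ne_zero
  refine HypArith.relIndex_ne_zero h.isLorentz hle (R := R) (fun x => ?_) fun R =>
    (finite_setOf_sum_coef_le hk h R).subset fun s hs => ⟨hs.1.1, hs.2⟩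
  obtain ⟨γ, hγ, hx⟩ := hR x
  exact ⟨γ, GamI_le_GamTau D hγ, hx⟩

theorem GamI_restr_eq {d : ℕ} (hd : d ≤ n) (hw : ∀ i, realW k w i ≠ 0) (I : Ideal (𝓞 k)) :
    GamI k (restr hd w) I
      = Gam k (restr hd w) ⊓ (GamI k w I).comap (spinIncl hd (realW k w)) := by
  ext s
  exact ⟨fun hs => ⟨hs.1, (spinIncl_mem_GamI_iff hd hw).2 hs⟩,
    fun hs => (spinIncl_mem_GamI_iff hd hw).1 hs.2⟩

/-- Fix `N + 1` distinct elements of `Γ(3)`. Once the real part defining the level exceeds the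
absolute real parts of all their quotients, no nontrivial quotient can lie in `Γ_τ(α)`, so the
elements represent distinct cosets. -/
theorem exists_lt_relIndex (hn : 2 ≤ n) (hk : Module.finrank ℚ k = 2) (h : IsAdmissible k w)
    {σ : k →+* ℝ} (hσ : σ ≠ algebraMap k ℝ) {D : ℝ → CongruenceLevel k}
    (hD : ∀ x : 𝓞 k, 10 < algebraMap (𝓞 k) ℝ x → |σ (x : k)| ≤ 1 →
      IsLevel (D (algebraMap (𝓞 k) ℝ x)) (chebT (chebIndex (algebraMap (𝓞 k) ℝ x)) x) σ)
    (N : ℕ) : ∃ s ∈ GamI k (restr hn w) (Ideal.span {3}), IsLoxodromic s ∧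
      10 < realPart (realW k (restr hn w)) s.val ∧
      N < (GamTau k w (D (realPart (realW k (restr hn w)) s.val))).relIndex
        (GamI k w (Ideal.span {3})) := by
  have hw := h.isLorentz.ne_zero
  have hw' := (h.restr hn).isLorentz.ne_zero
  obtain ⟨s, hs, hmono, h1, ht⟩ := exists_seq_mem_GamI_three hk (h.restr hn)
  set g : Fin (N + 1) → SpinGrp (realW k w) := fun i => spinIncl hn (realW k w) (s i) with hg
  have hginj : Function.Injective g := fun i j hij => Fin.ext (hmono.injective
    (by simp only [spinIncl_injective hn hw hij]))
  obtain ⟨B, hB⟩ := (Set.finite_range fun p : Fin (N + 1) × Fin (N + 1) =>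
    |realPart (realW k w) ((g p.1)⁻¹ * g p.2).val|).bddAbove
  obtain ⟨m, hm10, hmB⟩ := ((ht.eventually_gt_atTop 10).and (ht.eventually_gt_atTop B)).exists
  refine ⟨s m, hs m, isLoxodromic_of_one_lt_realPart (h.restr hn).isLorentz (h1 m), hm10, ?_⟩
  obtain ⟨x, -, hx⟩ := exists_realPart_eq hw' (hs m).1
  have hx3 := three_dvd_realPart_sub_one hw' (hs m) hx
  have hxσ := abs_conj_realPart_le (h.restr hn) hσ (hs m).1 hx
  simp only [hx] at hm10 hmB ⊢
  have hlev := hD x hm10 hxσ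
  have hj := chebIndex_eq (algebraMap (𝓞 k) ℝ x)
  have hle := GamTau_le_GamI_three (w := w) hlev (three_dvd_chebT_sub_one hx3 hj)
  refine card_le_relIndex (hlev.relIndex_ne_zero hk h hle) g
    (fun i => (spinIncl_mem_GamI_iff hn hw).2 (hs i)) fun i j hij hmem => ?_
  have h2 := hlev.le_abs_realPart hk h hσ hmem
    fun h0 => hij (hginj (inv_mul_eq_one.1 h0))
  have h3 := ten_le_cheb hlev.le
  have h4 := le_chebT (by linarith : 1 ≤ algebraMap (𝓞 k) ℝ x) hj
  rw [← map_chebT (algebraMap (𝓞 k) ℝ) hj] at h4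
  have h5 := hB ⟨(i, j), rfl⟩
  simp only at h5
  linarith

end Degree

/-! ### Existence of admissible forms -/

section Existence

open IntermediateField Polynomial in
theorem finrank_adjoin_sqrt_two : Module.finrank ℚ ℚ⟮√2⟯ = 2 := by
  have h2 : (√2) ^ 2 = (2 : ℝ) := Real.sq_sqrt (by norm_num)
  have hmonic : (X ^ 2 - C 2 : ℚ[X]).Monic := monic_X_pow_sub_C 2 two_ne_zero
  have hroot : aeval √2 (X ^ 2 - C 2 : ℚ[X]) = 0 := by simp
  have hint : IsIntegral ℚ √2 := ⟨_, hmonic, hroot⟩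
  rw [adjoin.finrank hint]
  refine le_antisymm ?_ ((minpoly.two_le_natDegree_iff hint).2 ?_)
  · exact (natDegree_le_of_dvd (minpoly.dvd ℚ _ hroot) hmonic.ne_zero).trans
      (natDegree_X_pow_sub_C).le
  · rintro ⟨q, hq⟩
    exact irrational_sqrt_two ⟨q, hq⟩

open IntermediateField in
-- Take `ℚ(√2)` with weights `-√2, 1, ..., 1`: conjugation changes `-√2` into `√2` and makes the
-- form positive definite.
theorem exists_isAdmissible (n : ℕ) : ∃ (k : IntermediateField ℚ ℝ) (w : Fin (n + 1) → 𝓞 k),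
    Module.finrank ℚ k = 2 ∧ IsAdmissible k w := by
  have hpos : 0 < √2 := Real.sqrt_pos.2 two_pos
  let r : 𝓞 ℚ⟮√2⟯ := ⟨⟨√2, mem_adjoin_simple_self ℚ √2⟩, by
    have e : (⟨√2, mem_adjoin_simple_self ℚ √2⟩ : ℚ⟮√2⟯) ^ 2 = 2 :=
      Subtype.ext (Real.sq_sqrt (by norm_num))
    refine IsIntegral.of_pow two_pos ?_
    rw [e, ← map_ofNat (algebraMap ℤ ℚ⟮√2⟯) 2]
    exact isIntegral_algebraMap⟩
  have hr : algebraMap (𝓞 ℚ⟮√2⟯) ℝ r = √2 := rfl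
  refine ⟨ℚ⟮√2⟯, fun i => if i = 0 then -r else 1, finrank_adjoin_sqrt_two, ?_, ?_, ?_⟩
  · change algebraMap (𝓞 ℚ⟮√2⟯) ℝ (if (0 : Fin (n + 1)) = 0 then -r else 1) < 0
    rw [if_pos rfl, map_neg, hr]
    exact neg_neg_of_pos hpos
  · intro i hi
    change 0 < algebraMap (𝓞 ℚ⟮√2⟯) ℝ (if i = 0 then -r else 1)
    rw [if_neg hi, map_one]
    exact one_pos
  · intro σ hσ
    have hneg : σ (r : ℚ⟮√2⟯) < 0 := by
      obtain ⟨q, hq⟩ := (exists_rat_trace_norm finrank_adjoin_sqrt_two hσ (r : ℚ⟮√2⟯)).1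
      have h2 : σ (r : ℚ⟮√2⟯) ^ 2 = 2 := by
        have : (r : ℚ⟮√2⟯) ^ 2 = 2 := by
          apply Subtype.ext
          exact Real.sq_sqrt (by norm_num)
        rw [← map_pow, this, map_ofNat]
      by_contra! h0
      have h1 : σ (r : ℚ⟮√2⟯) = √2 := by rw [← Real.sqrt_sq h0, h2]
      rw [h1] at hq
      change √2 + √2 = q at hq
      exact irrational_sqrt_two ⟨q / 2, by push_cast; linarith⟩
    refine Or.inl fun i => ?_
    by_cases hi : i = 0
    · simpa [hi] using hneg
    · simp [hi]

end Existence

end HypArith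

end

/-! ### The main theorem -/

theorem theoremC :
    -- admissible forms over real quadratic fields exist in every dimension
    (∀ n : ℕ, 3 ≤ n → ∃ (k : IntermediateField ℚ ℝ) (w : Fin (n + 1) → 𝓞 k),
      Module.finrank ℚ k = 2 ∧ IsAdmissible k w) ∧
    -- universal constants, and an exponent that depends only on the real part
    ∃ (L K : ℝ) (C : ℕ → ℝ) (l : ℝ → ℕ), 0 < L ∧ (∀ i, 0 < C i) ∧
      (∀ t, l t = 2 ∨ l t = 5 ∨ l t = 8) ∧
      ∀ (n : ℕ) (hn : 2 < n) (k : IntermediateField ℚ ℝ) (w : Fin (n + 1) → 𝓞 k),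
        Module.finrank ℚ k = 2 → IsAdmissible k w →
        ∃ D : ℝ → CongruenceLevel k,
          -- the congruence covers attached to the loxodromic elements with large real part
          (∀ s ∈ Gam k (restr hn.le w), IsLoxodromic s →
            ∀ t : ℝ, t = realPart (realW k (restr hn.le w)) s.val → L < t →
            (D t).α ≠ 0 ∧
            (∀ σ : k →+* ℝ, σ ≠ algebraMap k ℝ →
              1 ≤ |σ ((D t).α : k)| ∧ |σ ((D t).α : k)| ≤ 5) ∧
            |algebraMap (𝓞 k) ℝ (D t).α - C (l t) * t ^ (2 * (l t + 1) / 3)|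
              ≤ K * t ^ (2 * (l t + 1) / 3 - 2) ∧
            (∃ t' : 𝓞 k,
              algebraMap (𝓞 k) ℝ t'
                = realPart (realW k w) (spinIncl hn.le (realW k w) (s ^ (l t + 1))).val ∧
              Ideal.Quotient.mk (Ideal.span {(D t).α}) t' = (D t).τ ∧
              (spinIncl hn.le (realW k w) (s ^ (l t + 1))).val - scal k w t'
                ∈ coeffIn k w (Ideal.span {(D t).α})) ∧
            IsCongruenceSubgroup k w (GamTau k w (D t)) ∧
            IsCongruenceSubgroup k (restr hn.le w) (GamTau k (restr hn.le w) (D t)) ∧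
            IsClosedHyperbolicManifold (GamTau k w (D t)) ∧
            IsClosedHyperbolicManifold (GamTau k (restr hn.le w) (D t)) ∧
            IsTotallyGeodesicIn hn.le (realW k w) (GamTau k (restr hn.le w) (D t))
              (GamTau k w (D t)) ∧
            s ^ (l t + 1) ∈ GamTau k (restr hn.le w) (D t) ∧
            IsLoxodromic (spinIncl hn.le (realW k w) (s ^ (l t + 1))) ∧
            (∀ r ∈ GamTau k w (D t), IsLoxodromic r →
              translationLength (spinIncl hn.le (realW k w) (s ^ (l t + 1)))
                ≤ translationLength r) ∧
            IsLeast (closedGeodesicLengths (GamTau k w (D t)))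
              (translationLength (spinIncl hn.le (realW k w) (s ^ (l t + 1)))) ∧
            IsLeast (closedGeodesicLengths (GamTau k (restr hn.le w) (D t)))
              (translationLength (spinIncl hn.le (realW k w) (s ^ (l t + 1)))) ∧
            systole (GamTau k (restr hn.le w) (D t)) = systole (GamTau k w (D t))) ∧
          -- the manifold `M`, the surface `S`, and their covers
          ∃ (G : Subgroup (SpinGrp (realW k w)))
            (G' : Subgroup (SpinGrp (realW k (restr hn.le w)))),
            G' = Gam k (restr hn.le w) ⊓ G.comap (spinIncl hn.le (realW k w)) ∧
            IsCongruenceSubgroup k w G ∧ IsCongruenceSubgroup k (restr hn.le w) G' ∧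
            IsClosedHyperbolicManifold G ∧ IsClosedHyperbolicManifold G' ∧
            IsTotallyGeodesicIn hn.le (realW k w) G' G ∧
            (∀ s ∈ G', IsLoxodromic s →
              ∀ t : ℝ, t = realPart (realW k (restr hn.le w)) s.val → L < t →
              GamTau k w (D t) ≤ G ∧ GamTau k (restr hn.le w) (D t) ≤ G') ∧
            ∀ N : ℕ, ∃ s ∈ G', IsLoxodromic s ∧
              ∃ t : ℝ, t = realPart (realW k (restr hn.le w)) s.val ∧ L < t ∧
              N < (GamTau k w (D t)).relIndex G := by
  -- The exponent is `l + 1 = 3j` with `j` the Chebyshev index, since `s^(l+1)` is the cube of `S =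
  -- s^j`; accordingly `C_l = 4^j` is the leading coefficient of `4 T_j² - 1`.
  refine ⟨fun n _ => exists_isAdmissible n, 10, 100, fun i => 4 ^ ((i + 1) / 3),
    fun t => 3 * chebIndex t - 1, by norm_num, fun i => by positivity, fun t => ?_,
    fun n hn k w hk h => ?_⟩
  · rcases chebIndex_eq t with h | h | h <;> simp [h]
  obtain ⟨σ, hσ⟩ := exists_embedding_ne hk
  have hw := h.isLorentz.ne_zero
  have hw' := (h.restr hn.le).isLorentz.ne_zero
  obtain ⟨D, hD⟩ := exists_levels hk
  refine ⟨D, ?_, GamI k w (Ideal.span {3}), GamI k (restr hn.le w) (Ideal.span {3}),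
    GamI_restr_eq hn.le hw _, isCongruenceSubgroup_GamI_three, isCongruenceSubgroup_GamI_three,
    isClosedHyperbolicManifold_GamI_three hk h,
    isClosedHyperbolicManifold_GamI_three hk (h.restr hn.le),
    isTotallyGeodesicIn_GamI_three hn.le hk h, ?_, fun N => ?_⟩
  · rintro s hs - t ht hLt
    obtain ⟨x, -, hx⟩ := exists_realPart_eq hw' hs
    obtain rfl := ht.trans hx
    have hxσ := abs_conj_realPart_le (h.restr hn.le) hσ hs hx
    obtain ⟨hlev, h5⟩ := hD σ x hσ hLt hxσ
    have hj := chebIndex_eq (algebraMap (𝓞 k) ℝ x)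
    beta_reduce
    set j := chebIndex (algebraMap (𝓞 k) ℝ x)
    -- The truncated subtraction is harmless because `j ≥ 1`, and the divisions by `3` are exact.
    have hl : 3 * j - 1 + 1 = j * 3 := by omega
    have hl2 : 2 * (j * 3) / 3 = 2 * j := by omega
    have hl3 : j * 3 / 3 = j := by omega
    have H : IsLevelOf hn.le (D (algebraMap (𝓞 k) ℝ x)) (chebT j x) σ (s ^ j) :=
      ⟨hk, h, hσ, hlev, pow_mem hs j, by rw [realPart_pow hw' s hj, hx, map_chebT _ hj]⟩
    have hpow : s ^ (j * 3) = (s ^ j) ^ 3 := pow_mul s j 3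
    simp only [hl, hl2, hl3, hpow]
    refine ⟨hlev.α_ne_zero, fun σ' hσ' => ?_, ?_, H.exists_rep, hlev.isCongruenceSubgroup,
      hlev.isCongruenceSubgroup, hlev.isClosedHyperbolicManifold hk h hσ,
      hlev.isClosedHyperbolicManifold hk (h.restr hn.le) hσ,
      isTotallyGeodesicIn_GamTau hn.le hk h hσ hlev, H.cube_mem, H.isLoxodromic,
      fun r hr hr' => H.translationLength_le hr hr', H.isLeast, H.isLeast_restr, H.systole_eq⟩
    · obtain rfl := embedding_unique hk hσ hσ'
      exact ⟨hlev.one_le_conj, h5⟩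
    · have e : algebraMap (𝓞 k) ℝ (D (algebraMap (𝓞 k) ℝ x)).α
          = 4 * chebT j (algebraMap (𝓞 k) ℝ x) ^ 2 - 1 := by
        rw [hlev.α_eq, ← map_chebT (algebraMap (𝓞 k) ℝ) hj]
        simp only [map_sub, map_mul, map_pow, map_ofNat, map_one]
      rw [e]
      exact abs_sub_le_of_chebT hLt hj
  · rintro s hs - t ht hLt
    obtain ⟨x, -, hx⟩ := exists_realPart_eq hw' hs.1
    obtain rfl := ht.trans hx
    have hxσ := abs_conj_realPart_le (h.restr hn.le) hσ hs.1 hx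
    have hT := three_dvd_chebT_sub_one (three_dvd_realPart_sub_one hw' hs hx) 
      (chebIndex_eq (algebraMap (𝓞 k) ℝ x))
    have hlev := (hD σ x hσ hLt hxσ).1
    exact ⟨GamTau_le_GamI_three hlev hT, GamTau_le_GamI_three hlev hT⟩
  · obtain ⟨s, hs, hlox, hgt, hN⟩ := exists_lt_relIndex hn.le hk h hσ
      (fun x hx hxσ => (hD σ x hσ hx hxσ).1) N
    exact ⟨s, hs, hlox, _, rfl, hgt, hN⟩
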